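/- **Definitions.** A symmetric real matrix $A=(a_{ij})$ is *fundamental* if $a_{ii}=-2$, $a_{ij}\ge 0$ for $i\ne j$, and $a_{ij}=2\cos(\pi/m_{ij})$ with an integer $m_{ij}\ge 2$ whenever $i\neq j$ and $a_{ij}<2$. Its graph joins two distinct indices $i,j$ whenever $a_{ij}\ne0$: by a thin edge of weight $m_{ij}\ge 3$ if $0<a_{ij}=2\cos(\pi/m_{ij})<2$, by a thick edge if $a_{ij}=2$, and by a broken edge of weight $a_{ij}$ if $a_{ij}>2$ ("weight $2$" means no edge). It has *minimality* $t$ if $a_{ij}<t$ for all $i,j$. It is *hyperbolic* if its quadratic form modulo the kernel has signature $(1,m)$ for some $m$. The *ground field* of $A$ is the field $\mathbb K\subset\mathbb R$ generated over $\mathbb Q$ by all cyclic products $a_{i_1i_2}a_{i_2i_3}\cdots a_{i_{m-1}i_m}a_{i_mi_1}$. A hyperbolic fundamental matrix $A$ is *V-arithmetic* if all cyclic products are algebraic integers, the field $\widetilde{\mathbb K}=\mathbb Q(\{a_{ij}\})$ is totally real, and for every embedding $\sigma:\widetilde{\mathbb K}\to\mathbb R$ that is not the identity on $\mathbb K$ the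 form of $\sigma(A)$ modulo its kernel is negative definite. Let $\mathcal M$ be a fundamental chamber of a discrete reflection group of hyperbolic $n$-space, let $P(\mathcal M)$ be the set of vectors $e$ with $e^2=-2$ orthogonal to its codimension-one faces, with $\mathcal M=\{[x] : x\cdot e\ge0 \text{ for all } e\in P(\mathcal M)\}$; its Gram matrix $(e\cdot e')_{e,e'\in P(\mathcal M)}$ is fundamental. $\mathcal M$ (and its Gram matrix and graph) is a *finite edge chamber (matrix, graph)* if $\mathcal M$ has a one-dimensional edge $v_1v_2$ with two distinct finite vertices $v_1,v_2$ such that every hyperplane bounding $\mathcal M$ contains $v_1$ or $v_2$. For $u>2$ consider graphs with four vertices $e_1,e_2,f,g$, where $e_1e_2$ is a broken edge of weight $u$ and the other edges are as follows (pairs not listed are not joined): * $\Gamma^{(4)}_1$: $e_1f,\ e_2f,\ e_1g,\ e_2g$ are thin of weights $s,k,r,p\ge3$; * $\Gamma^{(4)}_2$: $e_1f,\ e_2f,\ fg$ are thin of weights $s,k,p\ge3$; * $\Gamma^{(4)}_3$: $e_1f,\ e_2g,\ fg$ have weights $s\ge2$, $k,r\ge3$; * $\Gamma^{(4)}_4$: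 $e_1f,\ e_2f,\ e_1g$ have weights $s\ge3$, $k\ge2$, $r\ge3$; * $\Gamma^{(4)}_5$: $e_1f,\ e_2g$ are thin of weights $s,k\ge3$. For $1\le i\le5$ let $\mathcal F\Gamma^{(4)}_i(14)$ be the set of ground fields of all V-arithmetic finite edge graphs of type $\Gamma^{(4)}_i$ with $2<u<14$. **Theorem.** All fields in the sets $\mathcal F\Gamma^{(4)}_i(14)$ are finite extensions of $\mathbb Q$, and * the degree over $\mathbb Q$ of each field in $\mathcal F\Gamma^{(4)}_1(14)$ and in $\mathcal F\Gamma^{(4)}_2(14)$ is at most $23$; * the degree over $\mathbb Q$ of each field in $\mathcal F\Gamma^{(4)}_3(14)$, $\mathcal F\Gamma^{(4)}_4(14)$ and $\mathcal F\Gamma^{(4)}_5(14)$ is at most $25$. Consequently one can take $N(14)=25$: for every V-arithmetic finite edge chamber of minimality $14$ (in hyperbolic space of any dimension), the ground field $\mathbb K$ of its Gram matrix is a finite extension of $\mathbb Q$, and if $[\mathbb K:\mathbb Q]>25$, then its Gram graph has exactly one connected component whose Gram matrix is hyperbolic, and this component has fewer than $4$ vertices. -/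

import Mathlib

noncomputable section

namespace HypEdge

open scoped Matrix

/-! ### Hyperbolic space and fundamental chambers -/

/-- The standard hyperbolic form of signature `(1, n)` on `ℝ^{n+1}`. -/
def lorentz {n : ℕ} (x y : Fin (n + 1) → ℝ) : ℝ :=
  x 0 * y 0 - ∑ i : Fin n, x i.succ * y i.succ

/-- The half `V⁺` of the cone `x² > 0`. Points of hyperbolic `n`-space are the rays in `V⁺`. -/
def posCone (n : ℕ) : Set (Fin (n + 1) → ℝ) :=
  {x | 0 < lorentz x x ∧ 0 < x 0}

variable {ι : Type*}

/-- The Gram matrix `(eᵢ · eⱼ)`. -/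
def gramMatrix {n : ℕ} (e : ι → Fin (n + 1) → ℝ) : Matrix ι ι ℝ :=
  Matrix.of fun i j => lorentz (e i) (e j)

/-- Fundamental matrices: symmetric, `-2` on the diagonal, non-negative off the diagonal, and
an off-diagonal entry below `2` is `2 cos (π / m)` for an integer `m ≥ 2`. -/
structure IsFundamental (A : Matrix ι ι ℝ) : Prop where
  symm : A.IsSymm
  diag : ∀ i, A i i = -2
  nonneg : ∀ i j, i ≠ j → 0 ≤ A i j
  angle : ∀ i j, i ≠ j → A i j < 2 → ∃ m : ℕ, 2 ≤ m ∧ A i j = 2 * Real.cos (Real.pi / m)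

/-- The polyhedron `⋂ {x | x · eᵢ ≥ 0}`, as a union of rays of `V⁺`. -/
def polyhedron {n : ℕ} (e : ι → Fin (n + 1) → ℝ) : Set (Fin (n + 1) → ℝ) :=
  {x | x ∈ posCone n ∧ ∀ i, 0 ≤ lorentz x (e i)}

/-- `e` is the family `P(M)` of the vectors of square `-2` orthogonal to the codimension one faces
of a fundamental chamber `M` of a discrete reflection group of hyperbolic `n`-space: the Gram matrix
is fundamental, and each `eᵢ` really defines a face of codimension one. -/
structure IsFundamentalChamber {n : ℕ} (e : ι → Fin (n + 1) → ℝ) : Prop where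
  fundamental : IsFundamental (gramMatrix e)
  facet : ∀ i, ∃ x ∈ posCone n, lorentz x (e i) = 0 ∧ ∀ j, j ≠ i → 0 < lorentz x (e j)

/-- `[v]` is a (finite) vertex of the polyhedron: it lies in it, and it is the only common point
of the bounding hyperplanes through it. -/
def IsFiniteVertex {n : ℕ} (e : ι → Fin (n + 1) → ℝ) (v : Fin (n + 1) → ℝ) : Prop :=
  v ∈ polyhedron e ∧
    ∀ x, (∀ i, lorentz v (e i) = 0 → lorentz x (e i) = 0) → x ∈ Submodule.span ℝ {v}

/-- Finite edge chambers: fundamental chambers with a one-dimensional edge `v₁v₂` joining two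
distinct finite vertices such that every bounding hyperplane contains `v₁` or `v₂`. -/
def IsFiniteEdgeChamber {n : ℕ} (e : ι → Fin (n + 1) → ℝ) : Prop :=
  IsFundamentalChamber e ∧
    ∃ v₁ v₂ : Fin (n + 1) → ℝ,
      IsFiniteVertex e v₁ ∧ IsFiniteVertex e v₂ ∧
      -- the two points are distinct
      v₂ ∉ Submodule.span ℝ {v₁} ∧
      -- the smallest face containing both points is one-dimensional
      (∀ x, (∀ i, lorentz v₁ (e i) = 0 → lorentz v₂ (e i) = 0 → lorentz x (e i) = 0) →
        x ∈ Submodule.span ℝ {v₁, v₂}) ∧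
      ∀ i, lorentz v₁ (e i) = 0 ∨ lorentz v₂ (e i) = 0

/-- Gram matrices of finite edge chambers. -/
def IsFiniteEdgeMatrix (A : Matrix ι ι ℝ) : Prop :=
  ∃ (n : ℕ) (e : ι → Fin (n + 1) → ℝ), IsFiniteEdgeChamber e ∧ gramMatrix e = A

/-- Minimality `t`: all the entries are below `t`. -/
def HasMinimality (A : Matrix ι ι ℝ) (t : ℝ) : Prop :=
  ∀ i j, A i j < t

/-! ### V-arithmetic matrices and their ground fields -/

/-- The form of the symmetric matrix `A`, taken modulo its kernel, is hyperbolic, that is, of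
signature `(1, m)` for some `m`: it has exactly one positive square. -/
def IsHyperbolicMatrix [Fintype ι] (A : Matrix ι ι ℝ) : Prop :=
  open scoped Classical in sigPos A.toQuadraticForm' = 1

/-- The cyclic product `a_{c 0, c 1} a_{c 1, c 2} ⋯ a_{c m, c 0}` (addition in `Fin (m + 1)` is
cyclic). -/
def cyclicProduct (A : Matrix ι ι ℝ) {m : ℕ} (c : Fin (m + 1) → ι) : ℝ :=
  ∏ k : Fin (m + 1), A (c k) (c (k + 1))

/-- The ground field, generated by all the cyclic products. -/
def groundField (A : Matrix ι ι ℝ) : IntermediateField ℚ ℝ :=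
  IntermediateField.adjoin ℚ {b | ∃ (m : ℕ) (c : Fin (m + 1) → ι), b = cyclicProduct A c}

/-- The field generated by all the entries. -/
def entryField (A : Matrix ι ι ℝ) : IntermediateField ℚ ℝ :=
  IntermediateField.adjoin ℚ {a | ∃ i j, a = A i j}

theorem entry_mem (A : Matrix ι ι ℝ) (i j : ι) : A i j ∈ entryField A :=
  IntermediateField.subset_adjoin ℚ _ ⟨i, j, rfl⟩

/-- The matrix `σ(A)` for an embedding `σ` of the field of entries. -/
def conjMatrix (A : Matrix ι ι ℝ) (σ : entryField A →+* ℝ) : Matrix ι ι ℝ :=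
  Matrix.of fun i j => σ ⟨A i j, entry_mem A i j⟩

/-- V-arithmetic matrices. -/
structure IsVArithmetic [Fintype ι] (A : Matrix ι ι ℝ) : Prop where
  fundamental : IsFundamental A
  hyperbolic : IsHyperbolicMatrix A
  integral : ∀ (m : ℕ) (c : Fin (m + 1) → ι), IsIntegral ℤ (cyclicProduct A c)
  totallyReal : NumberField.IsTotallyReal (entryField A)
  /-- For an embedding that is not the identity on the ground field, the conjugate form is negative
  definite modulo its kernel. -/
  negative : ∀ σ : entryField A →+* ℝ,
    (∃ x : entryField A, (x : ℝ) ∈ groundField A ∧ σ x ≠ (x : ℝ)) → (-conjMatrix A σ).PosSemidef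

/-- The graph of a fundamental matrix: distinct vertices are joined when the entry is non-zero. -/
def gramGraph (A : Matrix ι ι ℝ) : SimpleGraph ι :=
  SimpleGraph.fromRel fun i j => A i j ≠ 0

open scoped Classical in
/-- A connected component of the graph whose Gram matrix is hyperbolic. -/
def IsHyperbolicComponent [Fintype ι] (A : Matrix ι ι ℝ)
    (C : (gramGraph A).ConnectedComponent) : Prop :=
  IsHyperbolicMatrix (A.submatrix (Subtype.val : C.supp → ι) Subtype.val)

/-- `N` is an admissible value of the constant `N(t)`: each V-arithmetic finite edge chamber of
minimality `t` whose ground field has degree greater than `N` over `ℚ` has a (unique) hyperbolic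
connected component, and this component has fewer than `4` vertices. -/
def IsTransitionBound (t : ℝ) (N : ℕ) : Prop :=
  ∀ (n : ℕ) (ι : Type) [Fintype ι] (e : ι → Fin (n + 1) → ℝ),
    IsFiniteEdgeChamber e → IsVArithmetic (gramMatrix e) → HasMinimality (gramMatrix e) t →
      FiniteDimensional ℚ (groundField (gramMatrix e)) ∧
      (N < Module.finrank ℚ (groundField (gramMatrix e)) →
        ∃ C : (gramGraph (gramMatrix e)).ConnectedComponent,
          IsHyperbolicComponent (gramMatrix e) C ∧
          (∀ D, IsHyperbolicComponent (gramMatrix e) D → D = C) ∧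
          C.supp.ncard < 4)

/-! ### The five types of connected finite edge graphs with four vertices -/

/-- The entry of a thin edge of weight `m` (no edge for `m = 2`). -/
def thin (m : ℕ) : ℝ := 2 * Real.cos (Real.pi / m)

/- In the following matrices the vertices are `e₁, e₂, f, g` in this order, `e₁` and `e₂` are joined
by the broken edge of weight `u`, and `f`, `g` define the hyperplanes containing the edge. -/

/-- Type 1: `e₁f`, `e₂f`, `e₁g`, `e₂g` have weights `s`, `k`, `r`, `p`. -/
def Gamma1 (u : ℝ) : Set (Matrix (Fin 4) (Fin 4) ℝ) :=
  {A | ∃ s k r p : ℕ, 3 ≤ s ∧ 3 ≤ k ∧ 3 ≤ r ∧ 3 ≤ p ∧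
    A = !![-2, u, thin s, thin r;
           u, -2, thin k, thin p;
           thin s, thin k, -2, 0;
           thin r, thin p, 0, -2]}

/-- Type 2: `e₁f`, `e₂f`, `fg` have weights `s`, `k`, `p`. -/
def Gamma2 (u : ℝ) : Set (Matrix (Fin 4) (Fin 4) ℝ) :=
  {A | ∃ s k p : ℕ, 3 ≤ s ∧ 3 ≤ k ∧ 3 ≤ p ∧
    A = !![-2, u, thin s, 0;
           u, -2, thin k, 0;
           thin s, thin k, -2, thin p;
           0, 0, thin p, -2]}

/-- Type 3: `e₁f`, `e₂g`, `fg` have weights `s`, `k`, `r`. -/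
def Gamma3 (u : ℝ) : Set (Matrix (Fin 4) (Fin 4) ℝ) :=
  {A | ∃ s k r : ℕ, 2 ≤ s ∧ 3 ≤ k ∧ 3 ≤ r ∧
    A = !![-2, u, thin s, 0;
           u, -2, 0, thin k;
           thin s, 0, -2, thin r;
           0, thin k, thin r, -2]}

/-- Type 4: `e₁f`, `e₂f`, `e₁g` have weights `s`, `k`, `r`. -/
def Gamma4 (u : ℝ) : Set (Matrix (Fin 4) (Fin 4) ℝ) :=
  {A | ∃ s k r : ℕ, 3 ≤ s ∧ 2 ≤ k ∧ 3 ≤ r ∧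
    A = !![-2, u, thin s, thin r;
           u, -2, thin k, 0;
           thin s, thin k, -2, 0;
           thin r, 0, 0, -2]}

/-- Type 5: `e₁f`, `e₂g` have weights `s`, `k`. -/
def Gamma5 (u : ℝ) : Set (Matrix (Fin 4) (Fin 4) ℝ) :=
  {A | ∃ s k : ℕ, 3 ≤ s ∧ 3 ≤ k ∧
    A = !![-2, u, thin s, 0;
           u, -2, 0, thin k;
           thin s, 0, -2, 0;
           0, thin k, 0, -2]}

/-- The set of the ground fields of the V-arithmetic finite edge graphs of a given type with
`2 < u < t`. -/
def groundFields (Γ : ℝ → Set (Matrix (Fin 4) (Fin 4) ℝ)) (t : ℝ) : Set (IntermediateField ℚ ℝ) :=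
  {K | ∃ (u : ℝ) (A : Matrix (Fin 4) (Fin 4) ℝ), 2 < u ∧ u < t ∧ A ∈ Γ u ∧
    IsFiniteEdgeMatrix A ∧ IsVArithmetic A ∧ K = groundField A}

end HypEdge

end

noncomputable section

namespace HypEdge

/-! ### Certified upper bounds for products of polynomials -/

/-! The degree bounds come from a norm argument. If σ is an embedding that is nontrivial on the
ground field K, then -σ(A) is positive semidefinite. So algebraic integers built from cyclic
products, such as a_pq² or a_pq² + a_pq·a_pf·a_qf, have all their nontrivial conjugates in a small
explicit region, while at the identity they are bounded because the entries stay below 14. Let P be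
a product of integer polynomials that at the identity is nonzero and at most M, and on the region is
at most c ≤ 1 in absolute value. The norm of its value from K to ℚ is a nonzero integer, whence 1 ≤
M·c^(d-1) with d = [K : ℚ], and M·c^N < 1 forces d ≤ N (`finrank_le_of_conj_le`). The estimate |P| ≤
c is checked by bisection with interval arithmetic in ℕ (`verify_sound`,
`IsVArithmetic.finrank_le_of_check`).

The geometry supplies the regions. Exactly one face p passes through v₁ but not v₂, exactly one face
q through v₂ but not v₁, and all other faces contain the edge (`eq_of_vertex`,
`IsFiniteEdgeChamber.exists_edgeData`). Normals at a finite vertex are orthogonal to a timelike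
vector and hence span a negative definite space. Among the faces through one vertex all entries are
therefore below 2, the graph has no triangle, and adjacent edges satisfy a² + b² < 4. Since nonzero
entries are at least 1, two adjacent edges of this kind both have entries 1, √2 or the golden ratio.

Suppose now that a component containing p and q has at least four vertices. If a_pq² > 16/5, two
further vertices f, g form with p, q a triangle with short sides (bound 23), a fork, a path or a
4-cycle, each with its own polynomial (`IsVArithmetic.finrank_le_of_edge`). If a_pq² ≤ 16/5, either
all entries of the component lie in ℚ(√2, √3, √5), and then so does K
(`IsVArithmetic.finrank_le_of_small`), or some edge of weight at least 7 meets exactly one of p, q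
and takes over the role of the edge pq (`IsVArithmetic.finrank_le_of_large_pendant`).

Finally, a vector vanishing at p or at q combines normals at a single vertex, so its value is
nonpositive. Hence every hyperbolic component contains p and q, and splitting a positive vector
along components shows that there is one. -/

/-- Polynomials with natural coefficients in three variables and a homogenizing variable `W`. -/
inductive NatPoly where
  | X : NatPoly
  | Y : NatPoly
  | Z : NatPoly
  | W : NatPoly
  | C : ℕ → NatPoly
  | add : NatPoly → NatPoly → NatPoly
  | mul : NatPoly → NatPoly → NatPoly

/-- The value of a polynomial in a semiring. -/
def NatPoly.eval {R : Type*} [CommSemiring R] (x y z w : R) : NatPoly → R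
  | X => x
  | Y => y
  | Z => z
  | W => w
  | C k => (k : R)
  | add p q => p.eval x y z w + q.eval x y z w
  | mul p q => p.eval x y z w * q.eval x y z w

/-- The degree of a homogeneous polynomial. -/
def NatPoly.deg : NatPoly → ℕ
  | C _ => 0
  | add p _ => p.deg
  | mul p q => p.deg + q.deg
  | _ => 1

/-- Homogeneity. -/
def NatPoly.isHom : NatPoly → Bool
  | add p q => p.isHom && q.isHom && p.deg == q.deg
  | mul p q => p.isHom && q.isHom
  | _ => true

/-- The value at natural numbers, with `W = 2 ^ 16`, in a form that the kernel evaluates fast. -/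
def NatPoly.ev (x y z : ℕ) (p : NatPoly) : ℕ :=
  NatPoly.rec (motive := fun _ => ℕ) x y z 65536 (fun k => k) (fun _ _ a b => Nat.add a b)
    (fun _ _ a b => Nat.mul a b) p

/-- A factor `pos - neg` with its exponent. -/
structure Factor where
  pos : NatPoly
  neg : NatPoly
  exp : ℕ

/-- The value of the difference of polynomials. -/
def Factor.eval {R : Type*} [CommRing R] (x y z w : R) (F : Factor) : R :=
  F.pos.eval x y z w - F.neg.eval x y z w

/-- Homogeneity of the difference. -/
def Factor.isHom (F : Factor) : Bool :=
  F.pos.isHom && F.neg.isHom && F.pos.deg == F.neg.deg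

/-- The maximum of two natural numbers, in a form that the kernel evaluates fast. -/
def natMax (a b : ℕ) : ℕ :=
  match Nat.ble a b with
  | true => b
  | false => a

/-- An upper bound for the product of the factors over a box. -/
def prodBound (a b c a' b' c' : ℕ) (Fs : List Factor) : ℕ :=
  List.rec (motive := fun _ => ℕ) 1 (fun F _ r =>
    Nat.mul (Nat.pow (natMax (Nat.sub (F.pos.ev a' b' c') (F.neg.ev a b c))
      (Nat.sub (F.neg.ev a' b' c') (F.pos.ev a b c))) F.exp) r) Fs

/-- Some constraint is negative on the whole box. -/
def excluded (a b c a' b' c' : ℕ) : List Factor → Bool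
  | [] => false
  | F :: Fs =>
    match Nat.ble (F.neg.ev a b c) (F.pos.ev a' b' c') with
    | true => excluded a b c a' b' c' Fs
    | false => true

/-- Bisection: on the part of the box `[a, a'] × [b, b'] × [c, c']` where the constraints `gs` are
non-negative, the product of the factors `Fs` is at most `lim`. -/
def verify (gs Fs : List Factor) (lim : ℕ) : ℕ → ℕ → ℕ → ℕ → ℕ → ℕ → ℕ → Bool
  | 0, _, _, _, _, _, _ => false
  | n + 1, a, b, c, a', b', c' =>
    match excluded a b c a' b' c' gs || Nat.ble (prodBound a b c a' b' c' Fs) lim with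
    | true => true
    | false =>
      match Nat.ble (Nat.sub b' b) (Nat.sub a' a) && Nat.ble (Nat.sub c' c) (Nat.sub a' a),
        Nat.ble (Nat.sub c' c) (Nat.sub b' b) with
      | true, _ =>
        verify gs Fs lim n a b c (Nat.div (Nat.add a a') 2) b' c' &&
          verify gs Fs lim n (Nat.div (Nat.add a a') 2) b c a' b' c'
      | false, true =>
        verify gs Fs lim n a b c a' (Nat.div (Nat.add b b') 2) c' &&
          verify gs Fs lim n a (Nat.div (Nat.add b b') 2) c a' b' c'
      | false, false =>
        verify gs Fs lim n a b c a' b' (Nat.div (Nat.add c c') 2) &&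
          verify gs Fs lim n a b (Nat.div (Nat.add c c') 2) a' b' c'

/-- The product of the absolute values of the factors. -/
def prodAbs (x y z w : ℝ) : List Factor → ℝ
  | [] => 1
  | F :: Fs => |F.eval x y z w| ^ F.exp * prodAbs x y z w Fs

lemma prodAbs_nonneg (x y z w : ℝ) (Fs : List Factor) : 0 ≤ prodAbs x y z w Fs := by
  induction Fs with
  | nil => simp [prodAbs]
  | cons F Fs ih => exact mul_nonneg (by positivity) ih

/-- Nonnegative coefficients make the polynomial monotone on the octant. This is why factors are
stored as differences and all coordinates are kept nonnegative: the corners of a box then bound each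
part. -/
lemma NatPoly.ev_mono {x y z x' y' z' : ℝ} (hx : 0 ≤ x) (hy : 0 ≤ y) (hz : 0 ≤ z)
    (hxx : x ≤ x') (hyy : y ≤ y') (hzz : z ≤ z') (p : NatPoly) :
    0 ≤ p.eval x y z 65536 ∧ p.eval x y z 65536 ≤ p.eval x' y' z' 65536 := by
  induction p with
  | X => exact ⟨hx, hxx⟩
  | Y => exact ⟨hy, hyy⟩
  | Z => exact ⟨hz, hzz⟩
  | W => simp [NatPoly.eval]
  | C k => simp [NatPoly.eval]
  | add p q hp hq => exact ⟨add_nonneg hp.1 hq.1, add_le_add hp.2 hq.2⟩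
  | mul p q hp hq =>
    exact ⟨mul_nonneg hp.1 hq.1, mul_le_mul hp.2 hq.2 hq.1 (hp.1.trans hp.2)⟩

lemma NatPoly.cast_ev (x y z : ℕ) (p : NatPoly) :
    ((p.ev x y z : ℕ) : ℝ) = p.eval (x : ℝ) y z 65536 := by
  induction p with
  | X => rfl
  | Y => rfl
  | Z => rfl
  | W => norm_num [NatPoly.ev, NatPoly.eval]
  | C k => rfl
  | add p q hp hq => simp [NatPoly.ev, NatPoly.eval, ← hp, ← hq]
  | mul p q hp hq => simp [NatPoly.ev, NatPoly.eval, ← hp, ← hq]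

lemma le_natMax (a b : ℕ) : a ≤ natMax a b ∧ b ≤ natMax a b := by
  unfold natMax
  split
  · rename_i h
    exact ⟨Nat.le_of_ble_eq_true h, le_rfl⟩
  · rename_i h
    have : ¬ a ≤ b := fun h' => by simp [Nat.ble_eq_true_of_le h'] at h
    exact ⟨le_rfl, by omega⟩

lemma sub_le_cast_sub (a b : ℕ) : (a : ℝ) - b ≤ ((a - b : ℕ) : ℝ) := by
  rcases le_total b a with h | h
  · rw [Nat.cast_sub h]
  · have : (a : ℝ) ≤ b := by exact_mod_cast h
    have h2 : (0 : ℝ) ≤ ((a - b : ℕ) : ℝ) := Nat.cast_nonneg _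
    linarith

/-- The point `(x, y, z)` lies in the box. -/
def InBox (x y z : ℝ) (a b c a' b' c' : ℕ) : Prop :=
  ((a : ℝ) ≤ x ∧ x ≤ a') ∧ ((b : ℝ) ≤ y ∧ y ≤ b') ∧ ((c : ℝ) ≤ z ∧ z ≤ c')

/-- Each difference lies between its two extreme corner differences; truncated subtraction in ℕ only
enlarges the bound. -/
lemma prodAbs_le_prodBound {x y z : ℝ} {a b c a' b' c' : ℕ} (h : InBox x y z a b c a' b' c')
    (Fs : List Factor) : prodAbs x y z 65536 Fs ≤ prodBound a b c a' b' c' Fs := by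
  induction Fs with
  | nil => simp [prodAbs, prodBound]
  | cons F Fs ih =>
    obtain ⟨⟨h1, h2⟩, ⟨h3, h4⟩, h5, h6⟩ := h
    have l (p : NatPoly) := (NatPoly.ev_mono (Nat.cast_nonneg a) (Nat.cast_nonneg b)
      (Nat.cast_nonneg c) h1 h3 h5 p).2
    have u (p : NatPoly) := (NatPoly.ev_mono ((Nat.cast_nonneg a).trans h1)
      ((Nat.cast_nonneg b).trans h3) ((Nat.cast_nonneg c).trans h5) h2 h4 h6 p).2
    simp only [← NatPoly.cast_ev] at l u
    simp only [prodAbs, prodBound, Nat.mul_eq, Nat.pow_eq, Nat.cast_mul, Nat.cast_pow]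
    refine mul_le_mul (pow_le_pow_left₀ (abs_nonneg _) ?_ _) ih (prodAbs_nonneg _ _ _ _ _)
      (by positivity)
    have m := le_natMax (F.pos.ev a' b' c' - F.neg.ev a b c) (F.neg.ev a' b' c' - F.pos.ev a b c)
    have m1 := (sub_le_cast_sub _ _).trans (Nat.cast_le (α := ℝ).2 m.1)
    have m2 := (sub_le_cast_sub _ _).trans (Nat.cast_le (α := ℝ).2 m.2)
    have e1 := l F.pos
    have e2 := l F.neg
    have e3 := u F.pos
    have e4 := u F.neg
    rw [abs_le]
    simp only [Nat.sub_eq, Factor.eval]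
    constructor <;> linarith

lemma not_excluded {x y z : ℝ} {a b c a' b' c' : ℕ} (h : InBox x y z a b c a' b' c')
    {gs : List Factor} (hg : ∀ g ∈ gs, 0 ≤ g.eval x y z 65536) :
    excluded a b c a' b' c' gs = false := by
  induction gs with
  | nil => rfl
  | cons F gs ih =>
    obtain ⟨⟨h1, h2⟩, ⟨h3, h4⟩, h5, h6⟩ := h
    have l := (NatPoly.ev_mono (Nat.cast_nonneg a) (Nat.cast_nonneg b)
      (Nat.cast_nonneg c) h1 h3 h5 F.neg).2
    have u := (NatPoly.ev_mono ((Nat.cast_nonneg a).trans h1)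
      ((Nat.cast_nonneg b).trans h3) ((Nat.cast_nonneg c).trans h5) h2 h4 h6 F.pos).2
    simp only [← NatPoly.cast_ev] at l u
    have h0 := hg F (by simp)
    have hle : F.neg.ev a b c ≤ F.pos.ev a' b' c' := by
      rw [← Nat.cast_le (α := ℝ)]
      simp only [Factor.eval] at h0
      linarith
    rw [excluded, Nat.ble_eq_true_of_le hle]
    exact ih fun g hg' => hg g (by simp [hg'])

/-- Homogeneity lets the computation run on integers of size 65536 times the real coordinates,
without fractions. -/
lemma NatPoly.eval_scale (x y z w : ℝ) (p : NatPoly) (hp : p.isHom = true) :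
    p.eval (w * x) (w * y) (w * z) w = w ^ p.deg * p.eval x y z 1 := by
  induction p with
  | X | Y | Z | W | C => simp [NatPoly.eval, NatPoly.deg]
  | add p q ihp ihq =>
    simp only [isHom, Bool.and_eq_true, beq_iff_eq] at hp
    simp only [NatPoly.eval, NatPoly.deg, ihp hp.1.1, ihq hp.1.2, hp.2]
    ring
  | mul p q ihp ihq =>
    simp only [isHom, Bool.and_eq_true] at hp
    simp only [NatPoly.eval, NatPoly.deg, ihp hp.1, ihq hp.2]
    ring

lemma Factor.eval_scale (x y z w : ℝ) (F : Factor) (hF : F.isHom = true) :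
    F.eval (w * x) (w * y) (w * z) w = w ^ F.pos.deg * F.eval x y z 1 := by
  simp only [Factor.isHom, Bool.and_eq_true, beq_iff_eq] at hF
  simp only [Factor.eval, NatPoly.eval_scale _ _ _ _ _ hF.1.1, NatPoly.eval_scale _ _ _ _ _ hF.1.2,
    hF.2]
  ring

/-- The total degree of a product of factors. -/
def totalDeg : List Factor → ℕ
  | [] => 0
  | F :: Fs => F.pos.deg * F.exp + totalDeg Fs

lemma prodAbs_scale (x y z : ℝ) {w : ℝ} (hw : 0 < w) (Fs : List Factor)
    (hF : Fs.all Factor.isHom = true) :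
    prodAbs (w * x) (w * y) (w * z) w Fs = w ^ totalDeg Fs * prodAbs x y z 1 Fs := by
  induction Fs with
  | nil => simp [prodAbs, totalDeg]
  | cons F Fs ih =>
    simp only [List.all_cons, Bool.and_eq_true] at hF
    simp only [prodAbs, totalDeg, ih hF.2, Factor.eval_scale _ _ _ _ _ hF.1, abs_mul, mul_pow,
      abs_pow, abs_of_pos hw, pow_add, pow_mul]
    ring

theorem verify_sound {gs Fs : List Factor} {lim n : ℕ} {a b c a' b' c' : ℕ}
    (hv : verify gs Fs lim n a b c a' b' c' = true) {x y z : ℝ}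
    (h : InBox x y z a b c a' b' c') (hg : ∀ g ∈ gs, 0 ≤ g.eval x y z 65536) :
    prodAbs x y z 65536 Fs ≤ lim := by
  induction n generalizing a b c a' b' c' with
  | zero => simp [verify] at hv
  | succ n ih =>
    rw [verify, not_excluded h hg, Bool.false_or] at hv
    split at hv
    · rename_i h1
      exact (prodAbs_le_prodBound h Fs).trans (Nat.cast_le.2 (Nat.le_of_ble_eq_true h1))
    · obtain ⟨h1, h2, h3⟩ := h
      split at hv <;> rw [Bool.and_eq_true] at hv
      · rcases le_total x ((Nat.div (Nat.add a a') 2 : ℕ) : ℝ) with h | h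
        · exact ih hv.1 ⟨⟨h1.1, h⟩, h2, h3⟩
        · exact ih hv.2 ⟨⟨h, h1.2⟩, h2, h3⟩
      · rcases le_total y ((Nat.div (Nat.add b b') 2 : ℕ) : ℝ) with h | h
        · exact ih hv.1 ⟨h1, ⟨h2.1, h⟩, h3⟩
        · exact ih hv.2 ⟨h1, ⟨h, h2.2⟩, h3⟩
      · rcases le_total z ((Nat.div (Nat.add c c') 2 : ℕ) : ℝ) with h | h
        · exact ih hv.1 ⟨h1, h2, ⟨h3.1, h⟩⟩
        · exact ih hv.2 ⟨h1, h2, ⟨h, h3.2⟩⟩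

/-- The scaled point `(x, y, z)` lies in one of the boxes, and satisfies the constraints there. -/
def InRegion (x y z : ℝ) (gs : List Factor) (B : List (ℕ × ℕ × ℕ × ℕ × ℕ × ℕ)) : Prop :=
  (∃ b ∈ B, InBox (65536 * x) (65536 * y) (65536 * z) b.1 b.2.1 b.2.2.1 b.2.2.2.1 b.2.2.2.2.1
    b.2.2.2.2.2) ∧ ∀ g ∈ gs, 0 ≤ g.eval x y z 1

/-- Verification on a list of boxes. -/
def verifyAll (gs Fs : List Factor) (lim : ℕ) (B : List (ℕ × ℕ × ℕ × ℕ × ℕ × ℕ)) : Bool :=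
  Fs.all Factor.isHom && gs.all Factor.isHom &&
    -- The number 50 is the allowed bisection depth; running out of it can only make the test fail.
    B.all fun b => verify gs Fs lim 50 b.1 b.2.1 b.2.2.1 b.2.2.2.1 b.2.2.2.2.1 b.2.2.2.2.2

theorem verifyAll_sound {gs Fs : List Factor} {lim : ℕ} {B : List (ℕ × ℕ × ℕ × ℕ × ℕ × ℕ)}
    (hv : verifyAll gs Fs lim B = true) {x y z : ℝ} (h : InRegion x y z gs B) :
    prodAbs x y z 1 Fs ≤ lim / 65536 ^ totalDeg Fs := by
  simp only [verifyAll, Bool.and_eq_true] at hv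
  obtain ⟨⟨hF, hg⟩, hv⟩ := hv
  obtain ⟨⟨b, hb, hx⟩, h⟩ := h
  rw [List.all_eq_true] at hv hg
  have := verify_sound (hv b hb) hx fun g hgm => by
    rw [Factor.eval_scale _ _ _ _ _ (hg g hgm)]
    exact mul_nonneg (by positivity) (h g hgm)
  rw [prodAbs_scale _ _ _ (by norm_num) _ hF] at this
  rw [le_div_iff₀ (by positivity), mul_comm]
  exact this

end HypEdge

end

namespace HypEdge

open IntermediateField

/-! ### Degrees of fields and sizes of conjugates -/

/-- In a totally real extension `L`, all the complex embeddings of a subfield are restrictions of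
real embeddings of `L`. -/
theorem exists_real_extension {K L : IntermediateField ℚ ℝ} [FiniteDimensional ℚ L]
    [NumberField.IsTotallyReal L] (h : K ≤ L) (τ : K →ₐ[ℚ] ℂ) :
    ∃ σ : L →+* ℝ, ∀ x : K, ((σ ⟨x, h x.2⟩ : ℝ) : ℂ) = τ x := by
  let _ := (inclusion h).toAlgebra
  have : IsScalarTower ℚ K L := IsScalarTower.of_algHom (inclusion h)
  have : Algebra.IsAlgebraic K L := Algebra.IsAlgebraic.tower_top (K := ℚ) K
  obtain ⟨φ, hφ⟩ := IsAlgClosed.surjective_domRestrict_of_isAlgebraic (E := L) τ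
  have hr := NumberField.IsTotallyReal.complexEmbedding_isReal (φ : L →+* ℂ)
  refine ⟨hr.embedding, fun x => ?_⟩
  rw [NumberField.ComplexEmbedding.IsReal.coe_embedding_apply, ← hφ]
  -- Total reality makes an extension of τ to L real, so it factors through ℝ.
  rfl

/-- The norm of α is a nonzero integer and the product of the conjugates: one is at most M, the
other [K : ℚ] - 1 are at most c. -/
theorem finrank_le_of_conj_le {K L : IntermediateField ℚ ℝ} [FiniteDimensional ℚ L]
    [NumberField.IsTotallyReal L] (h : K ≤ L) (α : ℝ) (hα : α ∈ K) (hint : IsIntegral ℤ α)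
    (h0 : α ≠ 0) {M c : ℝ} (hM : |α| ≤ M) (hc0 : 0 ≤ c) (hc1 : c ≤ 1)
    (hc : ∀ σ : L →+* ℝ, (∃ x : L, (x : ℝ) ∈ K ∧ σ x ≠ x) → |σ ⟨α, h hα⟩| ≤ c)
    {N : ℕ} (hN : M * c ^ N < 1) : Module.finrank ℚ K ≤ N := by
  have : FiniteDimensional ℚ K := by
    have := FiniteDimensional.of_injective (inclusion h).toLinearMap (inclusion_injective h)
    exact this
  by_contra! hlt
  set a : K := ⟨α, hα⟩ with ha
  have ha0 : a ≠ 0 := fun hh => h0 (congrArg Subtype.val hh)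
  have hai : IsIntegral ℤ a := by
    refine (isIntegral_algHom_iff ((K.val).restrictScalars ℤ) Subtype.val_injective).1 ?_
    exact hint
  have h1 : IsIntegral ℤ (Algebra.norm ℚ a) := Algebra.isIntegral_norm ℚ hai
  obtain ⟨k, hk⟩ := IsIntegrallyClosed.isIntegral_iff.1 h1
  have hk0 : k ≠ 0 := by
    rintro rfl
    have : Algebra.norm ℚ a = 0 := by simpa using hk.symm
    exact ha0 (Algebra.norm_eq_zero_iff.1 this)
  have hprod := Algebra.norm_eq_prod_embeddings ℚ ℂ a
  rw [← hk] at hprod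
  have hnorm := congrArg (‖·‖) hprod
  simp only [norm_prod] at hnorm
  classical
  let ι : K →ₐ[ℚ] ℂ := (Complex.ofRealAm.restrictScalars ℚ).comp K.val
  rw [← Finset.mul_prod_erase Finset.univ _ (Finset.mem_univ ι)] at hnorm
  have hι : ‖ι a‖ ≤ M := by
    have : ι a = ((α : ℝ) : ℂ) := rfl
    rw [this, Complex.norm_real]
    exact hM
  have hle : ∏ τ ∈ Finset.univ.erase ι, ‖τ a‖ ≤ c ^ N := by
    have h2 : ∏ τ ∈ Finset.univ.erase ι, ‖τ a‖ ≤ ∏ τ ∈ Finset.univ.erase ι, c := by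
      refine Finset.prod_le_prod (fun _ _ => norm_nonneg _) fun τ hτ => ?_
      obtain ⟨σ, hσ⟩ := exists_real_extension h τ
      have hne : ∃ x : L, (x : ℝ) ∈ K ∧ σ x ≠ x := by
        by_contra! hcon
        refine (Finset.mem_erase.1 hτ).1 (AlgHom.ext fun x => ?_)
        rw [← hσ x, hcon ⟨x, h x.2⟩ x.2]
        rfl
      rw [← hσ a, Complex.norm_real]
      exact hc σ hne
    refine h2.trans ?_
    rw [Finset.prod_const, Finset.card_erase_of_mem (Finset.mem_univ _), Finset.card_univ,
      AlgHom.card ℚ K ℂ]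
    -- The contrary assumption N < [K : ℚ] leaves at least N embeddings besides the identity.
    exact pow_le_pow_of_le_one hc0 hc1 (by omega)
  have hge : 1 ≤ ‖(algebraMap ℚ ℂ) ((algebraMap ℤ ℚ) k)‖ := by
    have : (algebraMap ℚ ℂ) ((algebraMap ℤ ℚ) k) = (k : ℂ) := by simp
    rw [this, Complex.norm_intCast]
    exact_mod_cast Int.one_le_abs hk0
  have hM0 : 0 ≤ M := (abs_nonneg α).trans hM
  have : ‖(algebraMap ℚ ℂ) ((algebraMap ℤ ℚ) k)‖ ≤ M * c ^ N := by
    rw [hnorm]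
    exact mul_le_mul hι hle (Finset.prod_nonneg fun _ _ => norm_nonneg _) hM0
  linarith

/-- An element fixed by all the real embeddings of a totally real field that are the identity on a
subfield `F` lies in `F`. -/
theorem mem_of_forall_fixed {F L : IntermediateField ℚ ℝ} [FiniteDimensional ℚ L]
    [NumberField.IsTotallyReal L] (h : F ≤ L) (b : L)
    (hb : ∀ σ : L →+* ℝ, (∀ x : L, (x : ℝ) ∈ F → σ x = x) → σ b = b) : (b : ℝ) ∈ F := by
  let _ := (inclusion h).toAlgebra
  have : IsScalarTower ℚ F L := IsScalarTower.of_algHom (inclusion h)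
  have : Algebra.IsAlgebraic F L := Algebra.IsAlgebraic.tower_top (K := ℚ) F
  have : CharZero F := inferInstance
  let _ : Algebra F ℂ := ((Complex.ofRealAm.restrictScalars ℚ).comp F.val).toAlgebra
  have hint : IsIntegral F b := (Algebra.IsAlgebraic.isAlgebraic b).isIntegral
  -- Every complex root is the image of b under an embedding over F, which is real and so fixes b.
  -- Separability then leaves a minimal polynomial of degree 1.
  have hroots : ∀ z ∈ (minpoly F b).rootSet ℂ, z = ((b : ℝ) : ℂ) := by
    intro z hz
    rw [← Algebra.IsAlgebraic.range_eval_eq_rootSet_minpoly ℂ b] at hz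
    obtain ⟨φ, rfl⟩ := hz
    have hr := NumberField.IsTotallyReal.complexEmbedding_isReal (φ : L →+* ℂ)
    have := hb hr.embedding fun x hx => by
      have h1 := φ.commutes ⟨x, hx⟩
      have h2 : (φ : L →+* ℂ) x = ((x : ℝ) : ℂ) := h1
      have h3 := NumberField.ComplexEmbedding.IsReal.coe_embedding_apply hr x
      rw [h2] at h3
      exact_mod_cast h3
    have h3 := NumberField.ComplexEmbedding.IsReal.coe_embedding_apply hr b
    rw [this] at h3
    exact h3.symm
  have hcard := Polynomial.card_rootSet_eq_natDegree
    (minpoly.irreducible hint).separable (IsAlgClosed.splits ((minpoly F b).map (algebraMap F ℂ)))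
  have hle : Fintype.card ((minpoly F b).rootSet ℂ) ≤ 1 :=
    Fintype.card_le_one_iff.2 fun x y => Subtype.ext ((hroots _ x.2).trans (hroots _ y.2).symm)
  have hdeg : (minpoly F b).natDegree = 1 :=
    le_antisymm (hcard ▸ hle) (minpoly.natDegree_pos hint)
  obtain ⟨x, hx⟩ := minpoly.natDegree_eq_one_iff.1 hdeg
  rw [← hx]
  exact x.2

/-! ### Degree bounds from certificates -/

lemma NatPoly.map_eval {R S : Type*} [CommSemiring R] [CommSemiring S] (f : R →+* S)
    (x y z w : R) (p : NatPoly) : f (p.eval x y z w) = p.eval (f x) (f y) (f z) (f w) := by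
  induction p with
  | X | Y | Z | W | C => simp [NatPoly.eval]
  | add p q ihp ihq => simp [NatPoly.eval, ihp, ihq]
  | mul p q ihp ihq => simp [NatPoly.eval, ihp, ihq]

lemma Factor.map_eval {R S : Type*} [CommRing R] [CommRing S] (f : R →+* S)
    (x y z w : R) (F : Factor) : f (F.eval x y z w) = F.eval (f x) (f y) (f z) (f w) := by
  simp [Factor.eval, NatPoly.map_eval]

/-- The product of the factors, with their exponents. -/
def prodEval {R : Type*} [CommRing R] (x y z : R) : List Factor → R
  | [] => 1
  | F :: Fs => F.eval x y z 1 ^ F.exp * prodEval x y z Fs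

lemma map_prodEval {R S : Type*} [CommRing R] [CommRing S] (f : R →+* S)
    (x y z : R) (Fs : List Factor) :
    f (prodEval x y z Fs) = prodEval (f x) (f y) (f z) Fs := by
  induction Fs with
  | nil => simp [prodEval]
  | cons F Fs ih => simp [prodEval, ih, Factor.map_eval]

lemma abs_prodEval (x y z : ℝ) (Fs : List Factor) :
    |prodEval x y z Fs| = prodAbs x y z 1 Fs := by
  induction Fs with
  | nil => simp [prodEval, prodAbs]
  | cons F Fs ih => simp [prodEval, prodAbs, abs_mul, ih]

lemma NatPoly.eval_mem {R : Type*} [CommRing R] (S : Subring R) {x y z : R} (hx : x ∈ S)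
    (hy : y ∈ S) (hz : z ∈ S) (p : NatPoly) : p.eval x y z 1 ∈ S := by
  induction p with
  | X => exact hx
  | Y => exact hy
  | Z => exact hz
  | W => exact S.one_mem
  | C k => exact natCast_mem S k
  | add p q ihp ihq => exact S.add_mem ihp ihq
  | mul p q ihp ihq => exact S.mul_mem ihp ihq

lemma prodEval_mem {R : Type*} [CommRing R] (S : Subring R) {x y z : R} (hx : x ∈ S)
    (hy : y ∈ S) (hz : z ∈ S) (Fs : List Factor) : prodEval x y z Fs ∈ S := by
  induction Fs with
  | nil => exact S.one_mem
  | cons F Fs ih =>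
    exact S.mul_mem (S.pow_mem (S.sub_mem (NatPoly.eval_mem S hx hy hz _)
      (NatPoly.eval_mem S hx hy hz _)) _) ih

/-- A certificate: bounded products of factors on a region, with bounds for the factors at a
distinguished point. -/
structure Certificate where
  constraints : List Factor
  factors : List (Factor × ℕ)
  lim : ℕ
  boxes : List (ℕ × ℕ × ℕ × ℕ × ℕ × ℕ)

/-- The bound for the product at the distinguished point. -/
def pointBound : List (Factor × ℕ) → ℕ
  | [] => 1
  | F :: Fs => F.2 ^ F.1.exp * pointBound Fs

/-- The certificate proves that the degree is at most `N`. -/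
noncomputable def Certificate.check (T : Certificate) (N : ℕ) : Bool :=
  -- With c = lim / 65536^totalDeg and M = `pointBound`, the three tests say that the product is at
  -- most c on the region, that c ≤ 1, and that M·c^N < 1.
  verifyAll T.constraints (T.factors.map Prod.fst) T.lim T.boxes &&
    Nat.ble T.lim (65536 ^ totalDeg (T.factors.map Prod.fst)) &&
    Nat.blt (pointBound T.factors * T.lim ^ N) (65536 ^ (totalDeg (T.factors.map Prod.fst) * N))

lemma prodAbs_le_pointBound {x y z : ℝ} {Fs : List (Factor × ℕ)}
    (h : ∀ F ∈ Fs, |F.1.eval x y z 1| ≤ F.2) :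
    prodAbs x y z 1 (Fs.map Prod.fst) ≤ pointBound Fs := by
  induction Fs with
  | nil => simp [prodAbs, pointBound]
  | cons F Fs ih =>
    simp only [List.map_cons, prodAbs, pointBound, Nat.cast_mul, Nat.cast_pow]
    exact mul_le_mul (pow_le_pow_left₀ (abs_nonneg _) (h F (by simp)) _)
      (ih fun G hG => h G (by simp [hG])) (prodAbs_nonneg _ _ _ _ _) (by positivity)

lemma prodEval_ne_zero {x y z : ℝ} {Fs : List (Factor × ℕ)}
    (h : ∀ F ∈ Fs, F.1.eval x y z 1 ≠ 0) : prodEval x y z (Fs.map Prod.fst) ≠ 0 := by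
  induction Fs with
  | nil => simp [prodEval]
  | cons F Fs ih =>
    simp only [List.map_cons, prodEval]
    exact mul_ne_zero (pow_ne_zero _ (h F (by simp))) (ih fun G hG => h G (by simp [hG]))

/-! ### Integers of the ground field -/

variable {ι : Type*}

/-- The integral elements of the ground field, as a subring of the field of entries. -/
noncomputable def groundIntegers (A : Matrix ι ι ℝ) : Subring (entryField A) :=
  (groundField A).toSubfield.toSubring.comap (entryField A).val.toRingHom ⊓
    (integralClosure ℤ (entryField A)).toSubring

/-- The embeddings of the field of entries that are not the identity on the ground field. -/
def IsNontrivial (A : Matrix ι ι ℝ) (σ : entryField A →+* ℝ) : Prop :=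
  ∃ x : entryField A, (x : ℝ) ∈ groundField A ∧ σ x ≠ (x : ℝ)

theorem groundField_le_entryField (A : Matrix ι ι ℝ) : groundField A ≤ entryField A := by
  refine adjoin_le_iff.2 ?_
  rintro _ ⟨m, c, rfl⟩
  exact prod_mem fun k _ => entry_mem A _ _

/-- The entries as elements of the field of entries. -/
noncomputable def entry (A : Matrix ι ι ℝ) (i j : ι) : entryField A := ⟨A i j, entry_mem A i j⟩

theorem coe_entry (A : Matrix ι ι ℝ) (i j : ι) : (entry A i j : ℝ) = A i j := rfl

theorem cyclicProduct_mem (A : Matrix ι ι ℝ) {m : ℕ} (c : Fin (m + 1) → ι) :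
    cyclicProduct A c ∈ groundField A :=
  subset_adjoin ℚ _ ⟨m, c, rfl⟩

section Arithmetic

variable [Fintype ι] {A : Matrix ι ι ℝ}

theorem IsVArithmetic.mem_groundIntegers (hA : IsVArithmetic A) {x : entryField A} {m : ℕ}
    (c : Fin (m + 1) → ι) (hx : (x : ℝ) = cyclicProduct A c) : x ∈ groundIntegers A := by
  refine ⟨?_, ?_⟩
  · have := cyclicProduct_mem A c
    rw [← hx] at this
    exact this
  · have : IsIntegral ℤ (x : ℝ) := hx ▸ hA.integral m c
    exact (isIntegral_algHom_iff (((entryField A).val).restrictScalars ℤ)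
      Subtype.val_injective).1 this

theorem IsVArithmetic.mul_mem (hA : IsVArithmetic A) (i j : ι) :
    entry A i j * entry A j i ∈ groundIntegers A := by
  refine hA.mem_groundIntegers ![i, j] ?_
  simp [cyclicProduct, Fin.prod_univ_succ, coe_entry]

theorem IsVArithmetic.entry_comm (hA : IsVArithmetic A) (i j : ι) : entry A i j = entry A j i :=
  Subtype.ext (hA.fundamental.symm.apply j i)

theorem IsVArithmetic.sq_mem (hA : IsVArithmetic A) (i j : ι) :
    entry A i j ^ 2 ∈ groundIntegers A := by
  have := hA.mul_mem i j
  rwa [hA.entry_comm j i, ← sq] at this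

theorem IsVArithmetic.triangle_mem (hA : IsVArithmetic A) (i j k : ι) :
    entry A i j * entry A j k * entry A k i ∈ groundIntegers A := by
  refine hA.mem_groundIntegers ![i, j, k] ?_
  simp [cyclicProduct, Fin.prod_univ_succ, coe_entry, mul_assoc]

theorem IsVArithmetic.quadrilateral_mem (hA : IsVArithmetic A) (i j k l : ι) :
    entry A i j * entry A j k * entry A k l * entry A l i ∈ groundIntegers A := by
  refine hA.mem_groundIntegers ![i, j, k, l] ?_
  simp [cyclicProduct, Fin.prod_univ_succ, coe_entry, mul_assoc]

/-- The square of an entry is a cyclic product of length two, so each of the finitely many entries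
is integral. -/
theorem IsVArithmetic.finiteDimensional_entryField (hA : IsVArithmetic A) :
    FiniteDimensional ℚ (entryField A) := by
  have hfin : {a | ∃ i j, a = A i j}.Finite := by
    refine (Set.finite_range fun p : ι × ι => A p.1 p.2).subset ?_
    rintro _ ⟨i, j, rfl⟩
    exact ⟨(i, j), rfl⟩
  have := hfin.to_subtype
  refine finiteDimensional_adjoin (K := ℚ) ?_
  rintro _ ⟨i, j, rfl⟩
  have h : IsIntegral ℤ (A i j * A j i) := by
    have := hA.integral 1 ![i, j]
    simpa [cyclicProduct, Fin.prod_univ_succ] using this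
  rw [hA.fundamental.symm.apply i j, ← sq] at h
  exact (IsIntegral.of_pow (by norm_num) h).tower_top

theorem IsVArithmetic.finiteDimensional_groundField (hA : IsVArithmetic A) :
    FiniteDimensional ℚ (groundField A) :=
  have := hA.finiteDimensional_entryField
  FiniteDimensional.of_injective (inclusion (groundField_le_entryField A)).toLinearMap
    (inclusion_injective (groundField_le_entryField A))

/-- The product of the factors at x, y, z is an integer of the ground field to which
`finrank_le_of_conj_le` applies; the certificate provides both of its bounds. -/
theorem IsVArithmetic.finrank_le_of_check (hA : IsVArithmetic A) {T : Certificate} {N : ℕ}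
    (hT : T.check N = true) {x y z : entryField A} (hx : x ∈ groundIntegers A)
    (hy : y ∈ groundIntegers A) (hz : z ∈ groundIntegers A)
    (hσ : ∀ σ, IsNontrivial A σ → InRegion (σ x) (σ y) (σ z) T.constraints T.boxes)
    (hid : ∀ F ∈ T.factors, F.1.eval (x : ℝ) y z 1 ≠ 0 ∧ |F.1.eval (x : ℝ) y z 1| ≤ F.2) :
    Module.finrank ℚ (groundField A) ≤ N := by
  have := hA.finiteDimensional_entryField
  have := hA.totallyReal
  simp only [Certificate.check, Bool.and_eq_true, Nat.ble_eq, Nat.blt_eq] at hT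
  obtain ⟨⟨hv, hl⟩, hN⟩ := hT
  set Fs := T.factors.map Prod.fst with hFs
  have hmem := prodEval_mem (groundIntegers A) hx hy hz Fs
  have hcoe : ((prodEval x y z Fs : entryField A) : ℝ) = prodEval (x : ℝ) y z Fs :=
    map_prodEval (entryField A).val.toRingHom x y z Fs
  have hint : IsIntegral ℤ ((prodEval x y z Fs : entryField A) : ℝ) :=
    (isIntegral_algHom_iff (((entryField A).val).restrictScalars ℤ) Subtype.val_injective).2 hmem.2
  have hpos : (0 : ℝ) < 65536 ^ totalDeg Fs := by positivity
  refine finrank_le_of_conj_le (groundField_le_entryField A)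
    ((prodEval x y z Fs : entryField A) : ℝ) hmem.1 hint (M := pointBound T.factors)
    (c := T.lim / 65536 ^ totalDeg Fs) ?_ ?_ (by positivity) ?_ ?_ ?_
  · rw [hcoe]
    exact prodEval_ne_zero fun F hF => (hid F hF).1
  · rw [hcoe, abs_prodEval]
    exact prodAbs_le_pointBound fun F hF => (hid F hF).2
  · rw [div_le_one hpos]
    exact_mod_cast hl
  · intro σ hs
    have := verifyAll_sound hv (hσ σ hs)
    rw [← abs_prodEval, ← map_prodEval] at this
    exact this
  · rw [div_pow, ← mul_div_assoc, div_lt_one (by positivity), ← pow_mul]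
    exact_mod_cast hN

end Arithmetic

end HypEdge

namespace HypEdge

/-! ### Certificates -/

local notation:65 p:65 "⨥" q:66 => NatPoly.add p q
local notation:70 p:70 "⨰" q:71 => NatPoly.mul p q

/-- Digits in the names are weights of thin edges. The coordinates are algebraic integers, shifted
by ordinary integers so that their conjugates are nonnegative. A box lists its lower corner, then
its upper one, in units of 1/65536. The number attached to a factor bounds it at the identity, and
`lim` is just below 65536^totalDeg·M^(-1/N), the most the check can accept. Integer points of the
region must be zeros of the product, since otherwise its value there is a nonzero integer; this
explains most of the linear factors. Here X = a_pq² and a_qf = √2, so X ≤ 2 at the conjugates. -/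
def pendant4Certificate : Certificate where
  constraints := []
  factors := [(⟨.X, .C 0 ⨰ .W, 1⟩, 196),
    (⟨.X, .W, 1⟩, 195),
    (⟨.X, .C 2 ⨰ .W, 1⟩, 194)]
  lim := 149498245335342
  boxes := [(0, 0, 0, 131072, 0, 0)]

theorem pendant4Certificate_check : pendant4Certificate.check 25 = true := by
  decide +kernel

/-- X = a_pq² and Y = a_qf², the square of the golden ratio. The two boxes enclose the two possible
conjugates (3 ± √5)/2 of Y, as in all certificates with a golden weight. -/
def pendant5Certificate : Certificate where
  constraints := [⟨.C 4 ⨰ .W, .X ⨥ .Y, 1⟩]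
  factors := [(⟨.X, .C 0 ⨰ .W, 2⟩, 196),
    (⟨.X, .W, 3⟩, 195),
    (⟨.X ⨥ .Y, .C 4 ⨰ .W, 2⟩, 195),
    (⟨.X ⨥ .Y, .C 3 ⨰ .W, 3⟩, 196),
    (⟨.Y, .C 0 ⨰ .W, 5⟩, 3)]
  lim := 171916108492320913490164224408857144764949422902006216689866520486237238
  boxes := [(0, 171575, 0, 262144, 171576, 0), (0, 25032, 0, 262144, 25033, 0)]

theorem pendant5Certificate_check : pendant5Certificate.check 25 = true := by
  decide +kernel

/-- For x = a_pq², y = 4 - a_qf² and x' = y - x, the coordinates are X = x·x' and Y = x + x'. In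
these terms the factors are symmetric products: xx', (1 - x)(1 - x'), (2 - x)(2 - x'), (x² - 3x +
1)(x'² - 3x' + 1), and polynomials in y. The constraint is (x - x')² ≥ 0. -/
def pendant6Certificate : Certificate where
  constraints := [⟨.Y ⨰ .Y, .C 4 ⨰ .X ⨰ .W, 1⟩]
  factors := [(⟨.X, .C 0 ⨰ .W, 13⟩, 38416),
    (⟨.X ⨥ .W, .Y, 11⟩, 38416),
    (⟨.X ⨥ .C 4 ⨰ .W, .C 2 ⨰ .Y, 2⟩, 38416),
    (⟨.C 4 ⨰ .W, .Y, 12⟩, 4),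
    (⟨.Y, .C 2 ⨰ .W, 2⟩, 2),
    (⟨.Y, .C 3 ⨰ .W, 11⟩, 3),
    (⟨.Y ⨰ .Y ⨥ .C 5 ⨰ .W ⨰ .W, .C 5 ⨰ .Y ⨰ .W, 4⟩, 5),
    (⟨.X ⨰ .X ⨥ .C 7 ⨰ .X ⨰ .W ⨥ .Y ⨰ .Y ⨥ .W ⨰ .W,
      .C 3 ⨰ .X ⨰ .Y ⨥ .C 3 ⨰ .Y ⨰ .W, 2⟩, 1475789056)]
  lim :=
    2004385765104135720744274875703065493072321334900944611227349939724610881277524548314434477448842861883048635224706362326119408247553488964345692467685652331462270786775698073001232863428783892431219772551459329631865122254674941923108726864194716204288387755251460111084569954148968548499857956927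
  boxes := [(0, 0, 0, 262144, 262144, 0)]

theorem pendant6Certificate_check : pendant6Certificate.check 25 = true := by
  decide +kernel

def pendant3Certificate : Certificate where
  constraints := []
  factors := [(⟨.X, .C 0 ⨰ .W, 2⟩, 4),
    (⟨.X, .W, 3⟩, 3),
    (⟨.X, .C 2 ⨰ .W, 3⟩, 2),
    (⟨.X, .C 3 ⨰ .W, 2⟩, 1),
    (⟨.X ⨰ .X ⨥ .W ⨰ .W, .C 3 ⨰ .X ⨰ .W, 2⟩, 5)]
  lim := 17110333677767464498758662306185591956479605209411223612467512096543
  boxes := [(0, 0, 0, 196608, 0, 0)]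

theorem pendant3Certificate_check : pendant3Certificate.check 25 = true := by
  decide +kernel

def path33Certificate : Certificate where
  constraints := []
  factors := [(⟨.X, .C 0 ⨰ .W, 1⟩, 196),
    (⟨.X, .W, 1⟩, 195),
    (⟨.X, .C 2 ⨰ .W, 2⟩, 194),
    (⟨.X ⨰ .X ⨥ .W ⨰ .W, .C 3 ⨰ .X ⨰ .W, 1⟩, 37829)]
  lim := 22358920079726020790596868545
  boxes := [(0, 0, 0, 174764, 0, 0)]

theorem path33Certificate_check : path33Certificate.check 25 = true := by
  decide +kernel

def path35Certificate : Certificate where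
  constraints := [⟨.X ⨰ .Y ⨥ .C 12 ⨰ .W ⨰ .W, .C 4 ⨰ .X ⨰ .W ⨥ .C 4 ⨰ .Y ⨰ .W, 1⟩]
  factors := [(⟨.Y, .C 0 ⨰ .W, 2⟩, 3),
    (⟨.X ⨥ .Y, .C 3 ⨰ .W, 2⟩, 196),
    (⟨.X, .C 0 ⨰ .W, 1⟩, 196),
    (⟨.X, .W, 2⟩, 195)]
  lim := 1655450946637695435271450130071522
  boxes := [(0, 171575, 0, 262144, 171576, 0), (0, 25032, 0, 262144, 25033, 0)]

theorem path35Certificate_check : path35Certificate.check 25 = true := by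
  decide +kernel

/-- X = a_pq + 2; the lower corner 21845 is 65536/3 rounded down, because a_pq ≥ -5/3 at the
conjugates. -/
def cycle3Certificate : Certificate where
  constraints := []
  factors := [(⟨.X, .C 2 ⨰ .W, 1⟩, 14),
    (⟨.X, .C 3 ⨰ .W, 1⟩, 13),
    (⟨.X, .W, 2⟩, 15),
    (⟨.X ⨰ .X ⨥ .W ⨰ .W, .C 3 ⨰ .X ⨰ .W, 1⟩, 209)]
  lim := 41839219670733667394399245895
  boxes := [(21845, 0, 0, 196608, 0, 0)]

theorem cycle3Certificate_check : cycle3Certificate.check 25 = true := by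
  decide +kernel

def cycle4Certificate : Certificate where
  constraints := []
  factors := [(⟨.X, .W, 1⟩, 216)]
  lim := 52856
  boxes := [(32768, 0, 0, 98304, 0, 0)]

theorem cycle4Certificate_check : cycle4Certificate.check 25 = true := by
  decide +kernel

def cycle5Certificate : Certificate where
  constraints := [⟨.X ⨰ .Y ⨥ .C 15 ⨰ .W ⨰ .W, .C 4 ⨰ .X ⨰ .W ⨥ .C 5 ⨰ .Y ⨰ .W, 1⟩,
    ⟨.C 4 ⨰ .X ⨰ .W ⨥ .Y ⨰ .W, .X ⨰ .Y ⨥ .C 3 ⨰ .W ⨰ .W, 1⟩]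
  factors := [(⟨.Y, .C 0 ⨰ .W, 2⟩, 3),
    (⟨.X ⨥ .Y, .C 4 ⨰ .W, 1⟩, 15),
    (⟨.X ⨥ .Y, .C 3 ⨰ .W, 2⟩, 16),
    (⟨.X, .W, 2⟩, 15)]
  lim := 2752512274225218796154652286063995
  boxes := [(0, 171575, 0, 262144, 171576, 0), (0, 25032, 0, 262144, 25033, 0)]

theorem cycle5Certificate_check : cycle5Certificate.check 25 = true := by
  decide +kernel

/-- X = x + 1 for x = a_pq² + a_pq·a_pf·a_qf, and Y = a_qf², whose edge has arbitrary thin weight.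
The last factor is (x - 1)² - Y. -/
def fork3Certificate : Certificate where
  constraints := [⟨.C 4 ⨰ .X ⨥ .Y, .C 4 ⨰ .W, 1⟩,
    ⟨.C 12 ⨰ .W, .C 4 ⨰ .X ⨥ .C 3 ⨰ .Y, 1⟩]
  factors := [(⟨.X, .W, 4⟩, 224),
    (⟨.X ⨥ .Y, .C 3 ⨰ .W, 4⟩, 226),
    (⟨.X ⨥ .Y, .C 4 ⨰ .W, 1⟩, 225),
    (⟨.X, .C 2 ⨰ .W, 1⟩, 223),
    (⟨.X ⨰ .X ⨥ .C 4 ⨰ .W ⨰ .W, .C 4 ⨰ .X ⨰ .W ⨥ .Y ⨰ .W, 3⟩, 49729)]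
  lim := 3625510726730802770582570190578369531099024154046878778714817819196949587296
  boxes := [(0, 0, 0, 196608, 262144, 0)]

theorem fork3Certificate_check : fork3Certificate.check 25 = true := by
  decide +kernel

def fork4Certificate : Certificate where
  constraints := [⟨.C 4 ⨰ .X ⨥ .C 2 ⨰ .Y, .C 8 ⨰ .W, 1⟩,
    ⟨.C 12 ⨰ .W, .C 4 ⨰ .X ⨥ .C 3 ⨰ .Y, 1⟩]
  factors := [(⟨.X, .C 2 ⨰ .W, 1⟩, 236),
    (⟨.X ⨥ .Y, .C 4 ⨰ .W, 1⟩, 238),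
    (⟨.X ⨥ .Y, .C 3 ⨰ .W, 1⟩, 239)]
  lim := 145990406365452
  boxes := [(0, 0, 0, 196608, 262144, 0)]

theorem fork4Certificate_check : fork4Certificate.check 25 = true := by
  decide +kernel

/-- In the triangle certificates X is x = a_pq² + a_pq·a_pf·a_qf up to a shift; the digits are the
weights of pf and qf. -/
def triangle33Certificate : Certificate where
  constraints := []
  factors := [(⟨.X, .W, 10⟩, 210),
    (⟨.X, .C 2 ⨰ .W, 7⟩, 209),
    (⟨.X, .C 3 ⨰ .W, 8⟩, 208)]
  lim :=
    7761100820406187391802334349876105305359675974272393457414295563492026167045217521058661352927650580662620816491888062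
  boxes := [(49152, 0, 0, 196608, 0, 0)]

theorem triangle33Certificate_check : triangle33Certificate.check 23 = true := by
  decide +kernel

def triangle34Certificate : Certificate where
  constraints := []
  factors := [(⟨.X, .W, 2⟩, 216),
    (⟨.X, .C 2 ⨰ .W, 1⟩, 215)]
  lim := 139647590167749
  boxes := [(32768, 0, 0, 131072, 0, 0)]

theorem triangle34Certificate_check : triangle34Certificate.check 23 = true := by
  decide +kernel

def triangle44Certificate : Certificate where
  constraints := []
  factors := [(⟨.X, .W, 1⟩, 224),
    (⟨.X, .C 0 ⨰ .W, 1⟩, 225)]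
  lim := 2682293885
  boxes := [(0, 0, 0, 65536, 0, 0)]

theorem triangle44Certificate_check : triangle44Certificate.check 23 = true := by
  decide +kernel

def triangle35Certificate : Certificate where
  constraints := [⟨.C 4 ⨰ .X ⨥ .Y, .C 8 ⨰ .W, 1⟩,
    ⟨.C 20 ⨰ .W, .C 4 ⨰ .X ⨥ .C 4 ⨰ .Y, 1⟩]
  factors := [(⟨.Y, .C 0 ⨰ .W, 2⟩, 3),
    (⟨.X ⨥ .Y, .C 5 ⨰ .W, 1⟩, 219),
    (⟨.X ⨥ .Y, .C 4 ⨰ .W, 2⟩, 220),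
    (⟨.X, .C 2 ⨰ .W, 2⟩, 219)]
  lim := 1461862284174152554231598558163950
  boxes := [(0, 171575, 0, 327680, 171576, 0), (0, 25032, 0, 327680, 25033, 0)]

theorem triangle35Certificate_check : triangle35Certificate.check 23 = true := by
  decide +kernel

def triangle45Certificate : Certificate where
  constraints := [⟨.C 4 ⨰ .X ⨥ .C 2 ⨰ .Y, .C 8 ⨰ .W, 1⟩,
    ⟨.C 16 ⨰ .W, .C 4 ⨰ .X ⨥ .C 4 ⨰ .Y, 1⟩]
  factors := [(⟨.Y, .C 0 ⨰ .W, 2⟩, 3),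
    (⟨.X ⨥ .Y, .C 4 ⨰ .W, 1⟩, 230),
    (⟨.X ⨥ .Y, .C 3 ⨰ .W, 2⟩, 231),
    (⟨.X, .W, 1⟩, 230)]
  lim := 27957070688735721359825402529
  boxes := [(0, 171575, 0, 262144, 171576, 0), (0, 25032, 0, 262144, 25033, 0)]

theorem triangle45Certificate_check : triangle45Certificate.check 23 = true := by
  decide +kernel

def triangle55Certificate : Certificate where
  constraints := [⟨.C 4 ⨰ .X ⨰ .W ⨥ .Y ⨰ .Y, .C 8 ⨰ .W ⨰ .W, 1⟩,
    ⟨.C 24 ⨰ .W, .C 4 ⨰ .X ⨥ .C 8 ⨰ .Y, 1⟩]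
  factors := [(⟨.Y, .C 0 ⨰ .W, 2⟩, 3),
    (⟨.X ⨥ .C 2 ⨰ .Y, .C 6 ⨰ .W, 1⟩, 235),
    (⟨.X ⨥ .Y, .C 3 ⨰ .W, 1⟩, 235)]
  lim := 10429202585238780106
  boxes := [(0, 171575, 0, 393216, 171576, 0), (0, 25032, 0, 393216, 25033, 0)]

theorem triangle55Certificate_check : triangle55Certificate.check 23 = true := by
  decide +kernel

/-- A side of weight 6 occurs only when a_pq < 2, which keeps the bound at the identity small. -/
def triangle64Certificate : Certificate where
  constraints := []
  factors := [(⟨.X, .W, 1⟩, 15)]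
  lim := 58256
  boxes := [(32768, 0, 0, 65536, 0, 0)]

theorem triangle64Certificate_check : triangle64Certificate.check 23 = true := by
  decide +kernel

def triangle65Certificate : Certificate where
  constraints := [⟨.C 4 ⨰ .X ⨥ .C 3 ⨰ .Y, .C 8 ⨰ .W, 1⟩,
    ⟨.C 12 ⨰ .W, .C 4 ⨰ .X ⨥ .C 4 ⨰ .Y, 1⟩]
  factors := [(⟨.X ⨥ .Y, .C 3 ⨰ .W, 2⟩, 16),
    (⟨.X ⨰ .X, .C 2 ⨰ .X ⨰ .W, 1⟩, 224)]
  lim := 11455892788952529337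
  boxes := [(0, 171575, 0, 262144, 171576, 0), (0, 25032, 0, 262144, 25033, 0)]

theorem triangle65Certificate_check : triangle65Certificate.check 23 = true := by
  decide +kernel

/-- X = x + 3 for x = a_pq² + a_pq·a_pf·a_qf, Y = a_qf², and Z = a_pf², the golden square. In the
second constraint the product YZ cancels, so it is linear. -/
def fork5Certificate : Certificate where
  constraints := [⟨.C 4 ⨰ .X ⨰ .W ⨥ .Y ⨰ .Z, .C 12 ⨰ .W ⨰ .W, 1⟩,
    ⟨.C 24 ⨰ .W, .C 4 ⨰ .X ⨥ .C 3 ⨰ .Y ⨥ .C 4 ⨰ .Z, 1⟩]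
  factors := [(⟨.Z, .C 0 ⨰ .W, 9⟩, 3),
    (⟨.C 4 ⨰ .W, .Y, 3⟩, 4),
    (⟨.X, .C 3 ⨰ .W, 1⟩, 242),
    (⟨.X ⨥ .Y, .C 4 ⨰ .W, 3⟩, 245),
    (⟨.X ⨥ .Y ⨥ .Z, .C 6 ⨰ .W, 7⟩, 246),
    (⟨.X ⨰ .W ⨥ .Y ⨰ .Z, .C 2 ⨰ .Y ⨰ .W ⨥ .C 3 ⨰ .W ⨰ .W, 3⟩, 245)]
  lim :=
    1246501577773174200641839543085031573763447161764151670535920310456834650324164187693673225175846115884783434939511857292294331124415957714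
  boxes := [(0, 0, 171575, 393216, 262144, 171576), (0, 0, 25032, 393216, 262144, 25033)]

theorem fork5Certificate_check : fork5Certificate.check 25 = true := by
  decide +kernel

end HypEdge

namespace HypEdge

/-! ### Degree bounds for the individual shapes -/

lemma bound_of_pos {t m : ℝ} (h : 0 < t) (hm : t ≤ m) : t ≠ 0 ∧ |t| ≤ m :=
  ⟨h.ne', by rwa [abs_of_pos h]⟩

lemma bound_of_neg {t m : ℝ} (h : t < 0) (hm : -t ≤ m) : t ≠ 0 ∧ |t| ≤ m :=
  ⟨h.ne, by rwa [abs_of_neg h]⟩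

/-- The two roots are (3 ± √5)/2, about 2.618 and 0.382. -/
lemma golden_bounds {c : ℝ} (h : c ^ 2 = 3 * c - 1) :
    171575 ≤ 65536 * c ∧ 65536 * c ≤ 171576 ∨ 25032 ≤ 65536 * c ∧ 65536 * c ≤ 25033 := by
  rcases le_total 2 c with h2 | h2
  · left; constructor <;> nlinarith
  · right
    have : c < 1 := by nlinarith
    constructor <;> nlinarith

lemma golden_bounds_of_lt {c : ℝ} (h : c ^ 2 = 3 * c - 1) (h2 : 2 < c) :
    171575 ≤ 65536 * c ∧ 65536 * c ≤ 171576 := by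
  constructor <;> nlinarith

lemma golden_map {R : Type*} [CommRing R] {c : R} (h : c ^ 2 = 3 * c - 1) (σ : R →+* ℝ) :
    σ c ^ 2 = 3 * σ c - 1 := by
  have := congrArg σ h
  rwa [map_pow, map_sub, map_mul, map_one, map_ofNat] at this

section

variable {ι : Type*} {A : Matrix ι ι ℝ}

lemma golden_bounds_coe {c : entryField A} (h : c ^ 2 = 3 * c - 1) (h2 : 2 < (c : ℝ)) :
    171575 ≤ 65536 * (c : ℝ) ∧ 65536 * (c : ℝ) ≤ 171576 :=
  golden_bounds_of_lt (golden_map h (entryField A).val.toRingHom) h2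

end

section

variable {ι : Type*} [Fintype ι] {A : Matrix ι ι ℝ}

theorem IsVArithmetic.finrank_le_of_le_two (hA : IsVArithmetic A) {x : entryField A}
    (hx : x ∈ groundIntegers A)
    (hi0 : 16 / 5 < (x : ℝ)) (hi1 : (x : ℝ) < 196)
    (hσ : ∀ σ, IsNontrivial A σ → 0 ≤ σ x ∧ σ x ≤ 2) :
    Module.finrank ℚ (groundField A) ≤ 25 := by
  refine hA.finrank_le_of_check (x := x) (y := 0) (z := 0) pendant4Certificate_check
    hx (zero_mem _) (zero_mem _)
    (fun σ h => ⟨?_, ?_⟩) ?_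
  · obtain ⟨h3, h4⟩ := hσ σ h
    refine ⟨_, List.mem_cons_self, ?_⟩
    norm_num [InBox]
    refine ⟨?_, ?_⟩ <;> linarith
  · simp [pendant4Certificate]
  · simp only [pendant4Certificate, List.forall_mem_cons, Factor.eval, NatPoly.eval]
    push_cast
    refine ⟨bound_of_pos ?_ ?_, bound_of_pos ?_ ?_, bound_of_pos ?_ ?_, by simp⟩ <;> linarith

theorem IsVArithmetic.finrank_le_of_add_golden_le (hA : IsVArithmetic A) {x c : entryField A}
    (hx : x ∈ groundIntegers A) (hc : c ∈ groundIntegers A)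
    (hc2 : c ^ 2 = 3 * c - 1) (hc0 : 2 < (c : ℝ))
    (hi0 : 16 / 5 < (x : ℝ)) (hi1 : (x : ℝ) < 196)
    (hσ : ∀ σ, IsNontrivial A σ → 0 ≤ σ x ∧ σ x + σ c ≤ 4) :
    Module.finrank ℚ (groundField A) ≤ 25 := by
  refine hA.finrank_le_of_check (x := x) (y := c) (z := 0) pendant5Certificate_check
    hx hc (zero_mem _)
    (fun σ h => ⟨?_, ?_⟩) ?_
  · obtain ⟨h3, h4⟩ := hσ σ h
    rcases golden_bounds (golden_map hc2 σ) with ⟨g1, g2⟩ | ⟨g1, g2⟩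
    · refine ⟨_, List.mem_cons_self, ?_⟩
      norm_num [InBox]
      refine ⟨⟨?_, ?_⟩, ?_, ?_⟩ <;> linarith
    · refine ⟨_, List.mem_cons_of_mem _ List.mem_cons_self, ?_⟩
      norm_num [InBox]
      refine ⟨⟨?_, ?_⟩, ?_, ?_⟩ <;> linarith
  · obtain ⟨h3, h4⟩ := hσ σ h
    simp [pendant5Certificate, Factor.eval, NatPoly.eval]
    linarith
  · obtain ⟨g1, g2⟩ := golden_bounds_coe hc2 hc0
    simp only [pendant5Certificate, List.forall_mem_cons, Factor.eval, NatPoly.eval]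
    push_cast
    refine ⟨bound_of_pos ?_ ?_, bound_of_pos ?_ ?_, bound_of_pos ?_ ?_, bound_of_pos ?_ ?_,
      bound_of_pos ?_ ?_, by simp⟩ <;> linarith

theorem IsVArithmetic.finrank_le_of_add_le (hA : IsVArithmetic A) {x y : entryField A}
    (hx : x ∈ groundIntegers A) (hy : y ∈ groundIntegers A)
    (hi0 : 16 / 5 < (x : ℝ)) (hi1 : (x : ℝ) < 196) (hi2 : 0 < (y : ℝ)) (hi3 : (y : ℝ) ≤ 1)
    (hσ : ∀ σ, IsNontrivial A σ → 0 ≤ σ x ∧ σ x ≤ σ y ∧ σ y ≤ 4) :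
    Module.finrank ℚ (groundField A) ≤ 25 := by
  -- The conditions 0 ≤ x ≤ y are symmetric under x ↦ y - x, so the invariant x(y - x) together with
  -- y suffices.
  refine hA.finrank_le_of_check (x := x * (y - x)) (y := y) (z := 0) pendant6Certificate_check
    (Subring.mul_mem _ hx (sub_mem hy hx)) hy (zero_mem _)
    (fun σ h => ⟨?_, ?_⟩) ?_
  · obtain ⟨h3, h4, h5⟩ := hσ σ h
    refine ⟨_, List.mem_cons_self, ?_⟩
    norm_num [InBox]
    refine ⟨⟨?_, ?_⟩, ?_, ?_⟩ <;> nlinarith [sq_nonneg (σ y - 2 * σ x)]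
  · obtain ⟨h3, h4, h5⟩ := hσ σ h
    simp [pendant6Certificate, Factor.eval, NatPoly.eval]
    nlinarith [sq_nonneg (σ y - 2 * σ x)]
  · have e1 : 0 < (x : ℝ) ^ 2 - 3 * x + 1 := by nlinarith
    have e2 : 0 < ((y : ℝ) - x) ^ 2 - 3 * (y - x) + 1 := by nlinarith
    have e3 : (x : ℝ) ^ 2 - 3 * x + 1 ≤ 37829 := by nlinarith
    have e4 : ((y : ℝ) - x) ^ 2 - 3 * (y - x) + 1 ≤ 39005 := by nlinarith
    have e5 := mul_pos e1 e2
    have e6 := mul_le_mul e3 e4 e2.le (by norm_num)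
    simp only [pendant6Certificate, List.forall_mem_cons, Factor.eval, NatPoly.eval]
    push_cast
    refine ⟨bound_of_neg ?_ ?_, bound_of_neg ?_ ?_, bound_of_neg ?_ ?_, bound_of_pos ?_ ?_,
      bound_of_neg ?_ ?_, bound_of_neg ?_ ?_, bound_of_pos ?_ ?_, bound_of_pos ?_ ?_, by simp⟩ <;>
      nlinarith [mul_pos (sub_pos.2 hi0) hi2, e5, e6]

theorem IsVArithmetic.finrank_le_of_le_three (hA : IsVArithmetic A) {x : entryField A}
    (hx : x ∈ groundIntegers A)
    (hi0 : 16 / 5 < (x : ℝ)) (hi1 : (x : ℝ) < 4)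
    (hσ : ∀ σ, IsNontrivial A σ → 0 ≤ σ x ∧ σ x ≤ 3) :
    Module.finrank ℚ (groundField A) ≤ 25 := by
  refine hA.finrank_le_of_check (x := x) (y := 0) (z := 0) pendant3Certificate_check
    hx (zero_mem _) (zero_mem _)
    (fun σ h => ⟨?_, ?_⟩) ?_
  · obtain ⟨h3, h4⟩ := hσ σ h
    refine ⟨_, List.mem_cons_self, ?_⟩
    norm_num [InBox]
    refine ⟨?_, ?_⟩ <;> linarith
  · simp [pendant3Certificate]
  · simp only [pendant3Certificate, List.forall_mem_cons, Factor.eval, NatPoly.eval]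
    push_cast
    refine ⟨bound_of_pos ?_ ?_, bound_of_pos ?_ ?_, bound_of_pos ?_ ?_, bound_of_pos ?_ ?_,
      bound_of_pos ?_ ?_, by simp⟩ <;> nlinarith

theorem IsVArithmetic.finrank_le_of_le_eight_thirds (hA : IsVArithmetic A) {x : entryField A}
    (hx : x ∈ groundIntegers A)
    (hi0 : 16 / 5 < (x : ℝ)) (hi1 : (x : ℝ) < 196)
    (hσ : ∀ σ, IsNontrivial A σ → 0 ≤ σ x ∧ σ x ≤ 8 / 3) :
    Module.finrank ℚ (groundField A) ≤ 25 := by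
  refine hA.finrank_le_of_check (x := x) (y := 0) (z := 0) path33Certificate_check
    hx (zero_mem _) (zero_mem _)
    (fun σ h => ⟨?_, ?_⟩) ?_
  · obtain ⟨h3, h4⟩ := hσ σ h
    refine ⟨_, List.mem_cons_self, ?_⟩
    norm_num [InBox]
    refine ⟨?_, ?_⟩ <;> linarith
  · simp [path33Certificate]
  · simp only [path33Certificate, List.forall_mem_cons, Factor.eval, NatPoly.eval]
    push_cast
    refine ⟨bound_of_pos ?_ ?_, bound_of_pos ?_ ?_, bound_of_pos ?_ ?_, bound_of_pos ?_ ?_,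
      by simp⟩ <;> nlinarith

theorem IsVArithmetic.finrank_le_of_golden_path (hA : IsVArithmetic A) {x c : entryField A}
    (hx : x ∈ groundIntegers A) (hc : c ∈ groundIntegers A)
    (hc2 : c ^ 2 = 3 * c - 1) (hc0 : 2 < (c : ℝ))
    (hi0 : 16 / 5 < (x : ℝ)) (hi1 : (x : ℝ) < 196)
    (hσ : ∀ σ, IsNontrivial A σ → 0 ≤ σ x ∧ 4 ≤ (4 - σ x) * (4 - σ c)) :
    Module.finrank ℚ (groundField A) ≤ 25 := by
  refine hA.finrank_le_of_check (x := x) (y := c) (z := 0) path35Certificate_check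
    hx hc (zero_mem _)
    (fun σ h => ⟨?_, ?_⟩) ?_
  · obtain ⟨h3, h4⟩ := hσ σ h
    rcases golden_bounds (golden_map hc2 σ) with ⟨g1, g2⟩ | ⟨g1, g2⟩
    · refine ⟨_, List.mem_cons_self, ?_⟩
      norm_num [InBox]
      refine ⟨⟨?_, ?_⟩, ?_, ?_⟩ <;> nlinarith
    · refine ⟨_, List.mem_cons_of_mem _ List.mem_cons_self, ?_⟩
      norm_num [InBox]
      refine ⟨⟨?_, ?_⟩, ?_, ?_⟩ <;> nlinarith
  · obtain ⟨h3, h4⟩ := hσ σ h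
    simp [path35Certificate, Factor.eval, NatPoly.eval]
    linarith
  · obtain ⟨g1, g2⟩ := golden_bounds_coe hc2 hc0
    simp only [path35Certificate, List.forall_mem_cons, Factor.eval, NatPoly.eval]
    push_cast
    refine ⟨bound_of_pos ?_ ?_, bound_of_pos ?_ ?_, bound_of_pos ?_ ?_, bound_of_pos ?_ ?_,
      by simp⟩ <;> linarith

theorem IsVArithmetic.finrank_le_of_cycle_one (hA : IsVArithmetic A) {x : entryField A}
    (hx : x ∈ groundIntegers A)
    (hi0 : 17 / 10 < (x : ℝ)) (hi1 : (x : ℝ) < 14)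
    (hσ : ∀ σ, IsNontrivial A σ → -5 / 3 ≤ σ x ∧ σ x ≤ 1) :
    Module.finrank ℚ (groundField A) ≤ 25 := by
  refine hA.finrank_le_of_check (x := x + 1 + 1) (y := 0) (z := 0) cycle3Certificate_check
    (add_mem (add_mem hx (one_mem _)) (one_mem _)) (zero_mem _) (zero_mem _)
    (fun σ h => ⟨?_, ?_⟩) ?_
  · obtain ⟨h3, h4⟩ := hσ σ h
    refine ⟨_, List.mem_cons_self, ?_⟩
    norm_num [InBox]
    refine ⟨?_, ?_⟩ <;> linarith
  · simp [cycle3Certificate]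
  · simp only [cycle3Certificate, List.forall_mem_cons, Factor.eval, NatPoly.eval]
    push_cast
    refine ⟨bound_of_pos ?_ ?_, bound_of_pos ?_ ?_, bound_of_pos ?_ ?_, bound_of_pos ?_ ?_,
      by simp⟩ <;> nlinarith

theorem IsVArithmetic.finrank_le_of_abs_le_half (hA : IsVArithmetic A) {x : entryField A}
    (hx : x ∈ groundIntegers A)
    (hi0 : 0 < (x : ℝ)) (hi1 : (x : ℝ) < 216)
    (hσ : ∀ σ, IsNontrivial A σ → -1 / 2 ≤ σ x ∧ σ x ≤ 1 / 2) :
    Module.finrank ℚ (groundField A) ≤ 25 := by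
  refine hA.finrank_le_of_check (x := x + 1) (y := 0) (z := 0) cycle4Certificate_check
    (add_mem hx (one_mem _)) (zero_mem _) (zero_mem _)
    (fun σ h => ⟨?_, ?_⟩) ?_
  · obtain ⟨h3, h4⟩ := hσ σ h
    refine ⟨_, List.mem_cons_self, ?_⟩
    norm_num [InBox]
    refine ⟨?_, ?_⟩ <;> linarith
  · simp [cycle4Certificate]
  · simp only [cycle4Certificate, List.forall_mem_cons, Factor.eval, NatPoly.eval]
    push_cast
    refine ⟨bound_of_pos ?_ ?_, by simp⟩ <;> linarith

theorem IsVArithmetic.finrank_le_of_cycle_golden (hA : IsVArithmetic A) {x c : entryField A}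
    (hx : x ∈ groundIntegers A) (hc : c ∈ groundIntegers A)
    (hc2 : c ^ 2 = 3 * c - 1) (hc0 : 2 < (c : ℝ))
    (hi0 : 17 / 10 < (x : ℝ)) (hi1 : (x : ℝ) < 14)
    (hσ : ∀ σ, IsNontrivial A σ → (4 - σ c) * σ x ≤ 7 - 3 * σ c ∧ -(5 - σ c) ≤ (4 - σ c) * σ x) :
    Module.finrank ℚ (groundField A) ≤ 25 := by
  refine hA.finrank_le_of_check (x := x + 1 + 1) (y := c) (z := 0) cycle5Certificate_check
    (add_mem (add_mem hx (one_mem _)) (one_mem _)) hc (zero_mem _)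
    (fun σ h => ⟨?_, ?_⟩) ?_
  · obtain ⟨h3, h4⟩ := hσ σ h
    rcases golden_bounds (golden_map hc2 σ) with ⟨g1, g2⟩ | ⟨g1, g2⟩
    · refine ⟨_, List.mem_cons_self, ?_⟩
      norm_num [InBox]
      refine ⟨⟨?_, ?_⟩, ?_, ?_⟩ <;> nlinarith
    · refine ⟨_, List.mem_cons_of_mem _ List.mem_cons_self, ?_⟩
      norm_num [InBox]
      refine ⟨⟨?_, ?_⟩, ?_, ?_⟩ <;> nlinarith
  · obtain ⟨h3, h4⟩ := hσ σ h
    simp [cycle5Certificate, Factor.eval, NatPoly.eval]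
    constructor <;> linarith
  · obtain ⟨g1, g2⟩ := golden_bounds_coe hc2 hc0
    simp only [cycle5Certificate, List.forall_mem_cons, Factor.eval, NatPoly.eval]
    push_cast
    refine ⟨bound_of_pos ?_ ?_, bound_of_pos ?_ ?_, bound_of_pos ?_ ?_, bound_of_pos ?_ ?_,
      by simp⟩ <;> linarith

/-! ### Degree bounds for forks -/

theorem IsVArithmetic.finrank_le_of_fork_one (hA : IsVArithmetic A) {x z : entryField A}
    (hx : x ∈ groundIntegers A) (hz : z ∈ groundIntegers A)
    (hi0 : 16 / 5 < (x : ℝ)) (hi1 : (x : ℝ) < 224) (hi2 : 0 ≤ (z : ℝ)) (hi3 : (z : ℝ) < 4)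
    (hσ : ∀ σ, IsNontrivial A σ → 0 ≤ σ z ∧ 0 ≤ 4 * σ x + σ z ∧ 4 * σ x + 3 * σ z ≤ 8) :
    Module.finrank ℚ (groundField A) ≤ 25 := by
  refine hA.finrank_le_of_check (x := x + 1) (y := z) (z := 0) fork3Certificate_check
    (add_mem hx (one_mem _)) hz (zero_mem _)
    (fun σ h => ⟨?_, ?_⟩) ?_
  · obtain ⟨h3, h4, h5⟩ := hσ σ h
    refine ⟨_, List.mem_cons_self, ?_⟩
    norm_num [InBox]
    refine ⟨⟨?_, ?_⟩, ?_, ?_⟩ <;> linarith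
  · obtain ⟨h3, h4, h5⟩ := hσ σ h
    simp [fork3Certificate, Factor.eval, NatPoly.eval]
    constructor <;> linarith
  · simp only [fork3Certificate, List.forall_mem_cons, Factor.eval, NatPoly.eval]
    push_cast
    refine ⟨bound_of_pos ?_ ?_, bound_of_pos ?_ ?_, bound_of_pos ?_ ?_, bound_of_pos ?_ ?_,
      bound_of_pos ?_ ?_, by simp⟩ <;> nlinarith

theorem IsVArithmetic.finrank_le_of_fork_two (hA : IsVArithmetic A) {x z : entryField A}
    (hx : x ∈ groundIntegers A) (hz : z ∈ groundIntegers A)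
    (hi0 : 16 / 5 < (x : ℝ)) (hi1 : (x : ℝ) < 236) (hi2 : 0 ≤ (z : ℝ)) (hi3 : (z : ℝ) < 4)
    (hσ : ∀ σ, IsNontrivial A σ → 0 ≤ σ z ∧ σ z ≤ 4 ∧ 0 ≤ 4 * σ x + 2 * σ z ∧
      4 * σ x + 3 * σ z ≤ 4) :
    Module.finrank ℚ (groundField A) ≤ 25 := by
  refine hA.finrank_le_of_check (x := x + 1 + 1) (y := z) (z := 0) fork4Certificate_check
    (add_mem (add_mem hx (one_mem _)) (one_mem _)) hz (zero_mem _)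
    (fun σ h => ⟨?_, ?_⟩) ?_
  · obtain ⟨h3, h4, h5, h6⟩ := hσ σ h
    refine ⟨_, List.mem_cons_self, ?_⟩
    norm_num [InBox]
    refine ⟨⟨?_, ?_⟩, ?_, ?_⟩ <;> linarith
  · obtain ⟨h3, h4, h5, h6⟩ := hσ σ h
    simp [fork4Certificate, Factor.eval, NatPoly.eval]
    constructor <;> linarith
  · simp only [fork4Certificate, List.forall_mem_cons, Factor.eval, NatPoly.eval]
    push_cast
    refine ⟨bound_of_pos ?_ ?_, bound_of_pos ?_ ?_, bound_of_pos ?_ ?_, by simp⟩ <;> linarith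

theorem IsVArithmetic.finrank_le_of_fork_golden (hA : IsVArithmetic A) {x z c : entryField A}
    (hx : x ∈ groundIntegers A) (hz : z ∈ groundIntegers A) (hc : c ∈ groundIntegers A)
    (hc2 : c ^ 2 = 3 * c - 1) (hc0 : 2 < (c : ℝ))
    (hi0 : 16 / 5 < (x : ℝ)) (hi1 : (x : ℝ) < 242) (hi2 : 0 ≤ (z : ℝ)) (hi3 : (z : ℝ) < 4)
    (hσ : ∀ σ, IsNontrivial A σ → 0 ≤ σ z ∧ σ z ≤ 4 ∧ 0 ≤ 4 * σ x + σ c * σ z ∧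
      4 * σ x + σ c * σ z ≤ (3 - σ c) * (4 - σ z)) :
    Module.finrank ℚ (groundField A) ≤ 25 := by
  refine hA.finrank_le_of_check (x := x + 1 + 1 + 1) (y := z) (z := c) fork5Certificate_check
    (add_mem (add_mem (add_mem hx (one_mem _)) (one_mem _)) (one_mem _)) hz hc
    (fun σ h => ⟨?_, ?_⟩) ?_
  · obtain ⟨h3, h4, h5, h6⟩ := hσ σ h
    rcases golden_bounds (golden_map hc2 σ) with ⟨g1, g2⟩ | ⟨g1, g2⟩
    · refine ⟨_, List.mem_cons_self, ?_⟩
      norm_num [InBox]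
      refine ⟨⟨?_, ?_⟩, ⟨?_, ?_⟩, ?_, ?_⟩ <;> nlinarith
    · refine ⟨_, List.mem_cons_of_mem _ List.mem_cons_self, ?_⟩
      norm_num [InBox]
      refine ⟨⟨?_, ?_⟩, ⟨?_, ?_⟩, ?_, ?_⟩ <;> nlinarith
  · obtain ⟨h3, h4, h5, h6⟩ := hσ σ h
    simp [fork5Certificate, Factor.eval, NatPoly.eval]
    constructor <;> linarith
  · obtain ⟨g1, g2⟩ := golden_bounds_coe hc2 hc0
    simp only [fork5Certificate, List.forall_mem_cons, Factor.eval, NatPoly.eval]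
    push_cast
    refine ⟨bound_of_pos ?_ ?_, bound_of_pos ?_ ?_, bound_of_pos ?_ ?_, bound_of_pos ?_ ?_,
      bound_of_pos ?_ ?_, bound_of_pos ?_ ?_, by simp⟩ <;> nlinarith

/-! ### Degree bounds for triangles -/

theorem IsVArithmetic.finrank_le_of_triangle_one_one (hA : IsVArithmetic A) {x : entryField A}
    (hx : x ∈ groundIntegers A)
    (hi0 : 16 / 5 < (x : ℝ)) (hi1 : (x : ℝ) ≤ 210)
    (hσ : ∀ σ, IsNontrivial A σ → 0 ≤ 4 * σ x + 1 ∧ 4 * σ x + 1 ≤ 9) :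
    Module.finrank ℚ (groundField A) ≤ 23 := by
  refine hA.finrank_le_of_check (x := x + 1) (y := 0) (z := 0) triangle33Certificate_check
    (add_mem hx (one_mem _)) (zero_mem _) (zero_mem _)
    (fun σ h => ⟨?_, ?_⟩) ?_
  · obtain ⟨h3, h4⟩ := hσ σ h
    refine ⟨_, List.mem_cons_self, ?_⟩
    norm_num [InBox]
    refine ⟨?_, ?_⟩ <;> linarith
  · simp [triangle33Certificate]
  · simp only [triangle33Certificate, List.forall_mem_cons, Factor.eval, NatPoly.eval]
    push_cast
    refine ⟨bound_of_pos ?_ ?_, bound_of_pos ?_ ?_, bound_of_pos ?_ ?_, by simp⟩ <;> linarith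

theorem IsVArithmetic.finrank_le_of_triangle_one_two (hA : IsVArithmetic A) {x : entryField A}
    (hx : x ∈ groundIntegers A)
    (hi0 : 16 / 5 < (x : ℝ)) (hi1 : (x : ℝ) ≤ 216)
    (hσ : ∀ σ, IsNontrivial A σ → 0 ≤ 4 * σ x + 2 ∧ 4 * σ x + 2 ≤ 6) :
    Module.finrank ℚ (groundField A) ≤ 23 := by
  refine hA.finrank_le_of_check (x := x + 1) (y := 0) (z := 0) triangle34Certificate_check
    (add_mem hx (one_mem _)) (zero_mem _) (zero_mem _)
    (fun σ h => ⟨?_, ?_⟩) ?_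
  · obtain ⟨h3, h4⟩ := hσ σ h
    refine ⟨_, List.mem_cons_self, ?_⟩
    norm_num [InBox]
    refine ⟨?_, ?_⟩ <;> linarith
  · simp [triangle34Certificate]
  · simp only [triangle34Certificate, List.forall_mem_cons, Factor.eval, NatPoly.eval]
    push_cast
    refine ⟨bound_of_pos ?_ ?_, bound_of_pos ?_ ?_, by simp⟩ <;> linarith

theorem IsVArithmetic.finrank_le_of_triangle_two_two (hA : IsVArithmetic A) {x : entryField A}
    (hx : x ∈ groundIntegers A)
    (hi0 : 16 / 5 < (x : ℝ)) (hi1 : (x : ℝ) ≤ 224)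
    (hσ : ∀ σ, IsNontrivial A σ → 0 ≤ 4 * σ x + 4 ∧ 4 * σ x + 4 ≤ 4) :
    Module.finrank ℚ (groundField A) ≤ 23 := by
  refine hA.finrank_le_of_check (x := x + 1) (y := 0) (z := 0) triangle44Certificate_check
    (add_mem hx (one_mem _)) (zero_mem _) (zero_mem _)
    (fun σ h => ⟨?_, ?_⟩) ?_
  · obtain ⟨h3, h4⟩ := hσ σ h
    refine ⟨_, List.mem_cons_self, ?_⟩
    norm_num [InBox]
    refine ⟨?_, ?_⟩ <;> linarith
  · simp [triangle44Certificate]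
  · simp only [triangle44Certificate, List.forall_mem_cons, Factor.eval, NatPoly.eval]
    push_cast
    refine ⟨bound_of_pos ?_ ?_, bound_of_pos ?_ ?_, by simp⟩ <;> linarith

theorem IsVArithmetic.finrank_le_of_triangle_one_golden (hA : IsVArithmetic A) {x c : entryField A}
    (hx : x ∈ groundIntegers A) (hc : c ∈ groundIntegers A)
    (hc2 : c ^ 2 = 3 * c - 1) (hc0 : 2 < (c : ℝ))
    (hi0 : 16 / 5 < (x : ℝ)) (hi1 : (x : ℝ) ≤ 219)
    (hσ : ∀ σ, IsNontrivial A σ → 0 ≤ 4 * σ x + σ c ∧ 4 * σ x + σ c ≤ 3 * (4 - σ c)) :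
    Module.finrank ℚ (groundField A) ≤ 23 := by
  refine hA.finrank_le_of_check (x := x + 1 + 1) (y := c) (z := 0) triangle35Certificate_check
    (add_mem (add_mem hx (one_mem _)) (one_mem _)) hc (zero_mem _)
    (fun σ h => ⟨?_, ?_⟩) ?_
  · obtain ⟨h3, h4⟩ := hσ σ h
    rcases golden_bounds (golden_map hc2 σ) with ⟨g1, g2⟩ | ⟨g1, g2⟩
    · refine ⟨_, List.mem_cons_self, ?_⟩
      norm_num [InBox]
      refine ⟨⟨?_, ?_⟩, ?_, ?_⟩ <;> linarith
    · refine ⟨_, List.mem_cons_of_mem _ List.mem_cons_self, ?_⟩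
      norm_num [InBox]
      refine ⟨⟨?_, ?_⟩, ?_, ?_⟩ <;> linarith
  · obtain ⟨h3, h4⟩ := hσ σ h
    simp [triangle35Certificate, Factor.eval, NatPoly.eval]
    constructor <;> nlinarith
  · obtain ⟨g1, g2⟩ := golden_bounds_coe hc2 hc0
    simp only [triangle35Certificate, List.forall_mem_cons, Factor.eval, NatPoly.eval]
    push_cast
    refine ⟨bound_of_pos ?_ ?_, bound_of_pos ?_ ?_, bound_of_pos ?_ ?_, bound_of_pos ?_ ?_,
      by simp⟩ <;> linarith

theorem IsVArithmetic.finrank_le_of_triangle_two_golden (hA : IsVArithmetic A) {x c : entryField A}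
    (hx : x ∈ groundIntegers A) (hc : c ∈ groundIntegers A)
    (hc2 : c ^ 2 = 3 * c - 1) (hc0 : 2 < (c : ℝ))
    (hi0 : 16 / 5 < (x : ℝ)) (hi1 : (x : ℝ) ≤ 229)
    (hσ : ∀ σ, IsNontrivial A σ → 0 ≤ 4 * σ x + 2 * σ c ∧ 4 * σ x + 2 * σ c ≤ 2 * (4 - σ c)) :
    Module.finrank ℚ (groundField A) ≤ 23 := by
  refine hA.finrank_le_of_check (x := x + 1 + 1) (y := c) (z := 0) triangle45Certificate_check
    (add_mem (add_mem hx (one_mem _)) (one_mem _)) hc (zero_mem _)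
    (fun σ h => ⟨?_, ?_⟩) ?_
  · obtain ⟨h3, h4⟩ := hσ σ h
    rcases golden_bounds (golden_map hc2 σ) with ⟨g1, g2⟩ | ⟨g1, g2⟩
    · refine ⟨_, List.mem_cons_self, ?_⟩
      norm_num [InBox]
      refine ⟨⟨?_, ?_⟩, ?_, ?_⟩ <;> linarith
    · refine ⟨_, List.mem_cons_of_mem _ List.mem_cons_self, ?_⟩
      norm_num [InBox]
      refine ⟨⟨?_, ?_⟩, ?_, ?_⟩ <;> linarith
  · obtain ⟨h3, h4⟩ := hσ σ h
    simp [triangle45Certificate, Factor.eval, NatPoly.eval]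
    constructor <;> nlinarith
  · obtain ⟨g1, g2⟩ := golden_bounds_coe hc2 hc0
    simp only [triangle45Certificate, List.forall_mem_cons, Factor.eval, NatPoly.eval]
    push_cast
    refine ⟨bound_of_pos ?_ ?_, bound_of_pos ?_ ?_, bound_of_pos ?_ ?_, bound_of_pos ?_ ?_,
      by simp⟩ <;> linarith

theorem IsVArithmetic.finrank_le_of_triangle_golden_golden (hA : IsVArithmetic A)
    {x c : entryField A}
    (hx : x ∈ groundIntegers A) (hc : c ∈ groundIntegers A)
    (hc2 : c ^ 2 = 3 * c - 1) (hc0 : 2 < (c : ℝ))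
    (hi0 : 16 / 5 < (x : ℝ)) (hi1 : (x : ℝ) ≤ 233)
    (hσ : ∀ σ, IsNontrivial A σ → 0 ≤ 4 * σ x + σ c * σ c ∧
      4 * σ x + σ c * σ c ≤ (4 - σ c) * (4 - σ c)) :
    Module.finrank ℚ (groundField A) ≤ 23 := by
  refine hA.finrank_le_of_check (x := x + 1 + 1) (y := c) (z := 0) triangle55Certificate_check
    (add_mem (add_mem hx (one_mem _)) (one_mem _)) hc (zero_mem _)
    (fun σ h => ⟨?_, ?_⟩) ?_
  · obtain ⟨h3, h4⟩ := hσ σ h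
    rcases golden_bounds (golden_map hc2 σ) with ⟨g1, g2⟩ | ⟨g1, g2⟩
    · refine ⟨_, List.mem_cons_self, ?_⟩
      norm_num [InBox]
      refine ⟨⟨?_, ?_⟩, ?_, ?_⟩ <;> nlinarith
    · refine ⟨_, List.mem_cons_of_mem _ List.mem_cons_self, ?_⟩
      norm_num [InBox]
      refine ⟨⟨?_, ?_⟩, ?_, ?_⟩ <;> nlinarith
  · obtain ⟨h3, h4⟩ := hσ σ h
    simp [triangle55Certificate, Factor.eval, NatPoly.eval]
    constructor <;> nlinarith
  · obtain ⟨g1, g2⟩ := golden_bounds_coe hc2 hc0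
    simp only [triangle55Certificate, List.forall_mem_cons, Factor.eval, NatPoly.eval]
    push_cast
    refine ⟨bound_of_pos ?_ ?_, bound_of_pos ?_ ?_, bound_of_pos ?_ ?_, by simp⟩ <;> linarith

theorem IsVArithmetic.finrank_le_of_triangle_three_two (hA : IsVArithmetic A) {x : entryField A}
    (hx : x ∈ groundIntegers A)
    (hi0 : 16 / 5 < (x : ℝ)) (hi1 : (x : ℝ) ≤ 14)
    (hσ : ∀ σ, IsNontrivial A σ → 0 ≤ 4 * σ x + 6 ∧ 4 * σ x + 6 ≤ 2) :
    Module.finrank ℚ (groundField A) ≤ 23 := by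
  refine hA.finrank_le_of_check (x := x + 1 + 1) (y := 0) (z := 0) triangle64Certificate_check
    (add_mem (add_mem hx (one_mem _)) (one_mem _)) (zero_mem _) (zero_mem _)
    (fun σ h => ⟨?_, ?_⟩) ?_
  · obtain ⟨h3, h4⟩ := hσ σ h
    refine ⟨_, List.mem_cons_self, ?_⟩
    norm_num [InBox]
    refine ⟨?_, ?_⟩ <;> linarith
  · simp [triangle64Certificate]
  · simp only [triangle64Certificate, List.forall_mem_cons, Factor.eval, NatPoly.eval]
    push_cast
    refine ⟨bound_of_pos ?_ ?_, by simp⟩ <;> linarith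

theorem IsVArithmetic.finrank_le_of_triangle_three_golden (hA : IsVArithmetic A)
    {x c : entryField A}
    (hx : x ∈ groundIntegers A) (hc : c ∈ groundIntegers A)
    (hc2 : c ^ 2 = 3 * c - 1) (hc0 : 2 < (c : ℝ))
    (hi0 : 16 / 5 < (x : ℝ)) (hi1 : (x : ℝ) ≤ 13)
    (hσ : ∀ σ, IsNontrivial A σ → 0 ≤ 4 * σ x + 3 * σ c ∧ 4 * σ x + 3 * σ c ≤ 4 - σ c) :
    Module.finrank ℚ (groundField A) ≤ 23 := by
  refine hA.finrank_le_of_check (x := x + 1 + 1) (y := c) (z := 0) triangle65Certificate_check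
    (add_mem (add_mem hx (one_mem _)) (one_mem _)) hc (zero_mem _)
    (fun σ h => ⟨?_, ?_⟩) ?_
  · obtain ⟨h3, h4⟩ := hσ σ h
    rcases golden_bounds (golden_map hc2 σ) with ⟨g1, g2⟩ | ⟨g1, g2⟩
    · refine ⟨_, List.mem_cons_self, ?_⟩
      norm_num [InBox]
      refine ⟨⟨?_, ?_⟩, ?_, ?_⟩ <;> linarith
    · refine ⟨_, List.mem_cons_of_mem _ List.mem_cons_self, ?_⟩
      norm_num [InBox]
      refine ⟨⟨?_, ?_⟩, ?_, ?_⟩ <;> linarith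
  · obtain ⟨h3, h4⟩ := hσ σ h
    simp [triangle65Certificate, Factor.eval, NatPoly.eval]
    constructor <;> nlinarith
  · obtain ⟨g1, g2⟩ := golden_bounds_coe hc2 hc0
    simp only [triangle65Certificate, List.forall_mem_cons, Factor.eval, NatPoly.eval]
    push_cast
    refine ⟨bound_of_pos ?_ ?_, bound_of_pos ?_ ?_, by simp⟩ <;> nlinarith

end

end HypEdge

namespace HypEdge

section

variable {ι : Type*} [Fintype ι] {A : Matrix ι ι ℝ}

/-! ### Inequalities for conjugates -/

lemma sq_le_mul_of_forall {m α β : ℝ}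
    (h : ∀ x y : ℝ, 2 * m * x * y ≤ α * x ^ 2 + β * y ^ 2) : m ^ 2 ≤ α * β := by
  have hα : 0 ≤ α := by have := h 1 0; linarith
  have hβ : 0 ≤ β := by have := h 0 1; linarith
  rcases hα.eq_or_lt with h0 | h0
  · subst h0
    by_contra! hm
    have hm0 : m ≠ 0 := by rintro rfl; simp at hm
    -- With α = 0 this choice would give 2(β + 1) ≤ β.
    have := h ((β + 1) / m) 1
    have e : m * ((β + 1) / m) = β + 1 := mul_div_cancel₀ _ hm0
    nlinarith
  · have := h m α
    have h2 : α * (m ^ 2) ≤ α * (α * β) := by nlinarith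
    exact le_of_mul_le_mul_left h2 h0

/-- Semidefiniteness of -σ(A) on four coordinates. The indices may coincide, so inequalities for
fewer vertices follow by setting surplus coordinates to zero. -/
theorem IsVArithmetic.conj_le (hA : IsVArithmetic A) {σ : entryField A →+* ℝ}
    (hσ : IsNontrivial A σ) (p q f g : ι) (x y z w : ℝ) :
    σ (entry A p q) * x * y + σ (entry A p f) * x * z + σ (entry A p g) * x * w +
      σ (entry A q f) * y * z + σ (entry A q g) * y * w + σ (entry A f g) * z * w ≤
      x ^ 2 + y ^ 2 + z ^ 2 + w ^ 2 := by
  have h := (hA.negative σ hσ).submatrix ![p, q, f, g]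
  have h2 := h.dotProduct_mulVec_nonneg ![x, y, z, w]
  have hd : ∀ i, σ (entry A i i) = -2 := fun i => by
    have : entry A i i = -2 := Subtype.ext (by rw [coe_entry, hA.fundamental.diag]; rfl)
    rw [this, map_neg, map_ofNat]
  have hs : ∀ i j, conjMatrix A σ i j = σ (entry A i j) := fun i j => rfl
  simp [dotProduct, Matrix.mulVec, Fin.sum_univ_succ, hs, hd] at h2
  rw [hA.entry_comm q p, hA.entry_comm f p, hA.entry_comm g p, hA.entry_comm f q,
    hA.entry_comm g q, hA.entry_comm g f] at h2
  linarith

variable {p q f g : ι}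

theorem IsVArithmetic.conj_sq_le_four (hA : IsVArithmetic A) {σ : entryField A →+* ℝ}
    (hσ : IsNontrivial A σ) (p q : ι) : σ (entry A p q) ^ 2 ≤ 4 := by
  have := hA.conj_le hσ p q p p 2 (σ (entry A p q)) 0 0
  nlinarith

theorem IsVArithmetic.conj_path (hA : IsVArithmetic A) {σ : entryField A →+* ℝ}
    (hσ : IsNontrivial A σ) (h : A p f = 0) :
    σ (entry A p q) ^ 2 + σ (entry A q f) ^ 2 ≤ 4 := by
  have h0 : entry A p f = 0 := Subtype.ext h
  have := hA.conj_le hσ p q f p (σ (entry A p q)) 2 (σ (entry A q f)) 0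
  rw [h0, map_zero] at this
  nlinarith

/-- For given coordinates at p and q the form is extremal in those at f and g at the values
substituted here. What remains is a binary form, and this is its discriminant condition; triangles
and long paths are treated in the same way. -/
theorem IsVArithmetic.conj_fork (hA : IsVArithmetic A) {σ : entryField A →+* ℝ}
    (hσ : IsNontrivial A σ) (h : A q g = 0) (h' : A f g = 0) :
    (2 * σ (entry A p q) + σ (entry A p f) * σ (entry A q f)) ^ 2 ≤
      (4 - σ (entry A p f) ^ 2 - σ (entry A p g) ^ 2) * (4 - σ (entry A q f) ^ 2) := by
  have h0 : entry A q g = 0 := Subtype.ext h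
  have h1 : entry A f g = 0 := Subtype.ext h'
  refine sq_le_mul_of_forall fun x y => ?_
  have := hA.conj_le hσ p q f g (2 * x) (2 * y) (σ (entry A p f) * x + σ (entry A q f) * y)
    (σ (entry A p g) * x)
  rw [h0, h1, map_zero] at this
  nlinarith

theorem IsVArithmetic.conj_triangle (hA : IsVArithmetic A) {σ : entryField A →+* ℝ}
    (hσ : IsNontrivial A σ) (p q f : ι) :
    (2 * σ (entry A p q) + σ (entry A p f) * σ (entry A q f)) ^ 2 ≤
      (4 - σ (entry A p f) ^ 2) * (4 - σ (entry A q f) ^ 2) := by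
  refine sq_le_mul_of_forall fun x y => ?_
  have := hA.conj_le hσ p q f p (2 * x) (2 * y) (σ (entry A p f) * x + σ (entry A q f) * y) 0
  nlinarith

theorem IsVArithmetic.conj_long_path (hA : IsVArithmetic A) {σ : entryField A →+* ℝ}
    (hσ : IsNontrivial A σ) (h : A p g = 0) (h1 : A q f = 0) (h2 : A q g = 0) :
    (2 * σ (entry A p f)) ^ 2 ≤ (4 - σ (entry A p q) ^ 2) * (4 - σ (entry A f g) ^ 2) := by
  have e0 : entry A p g = 0 := Subtype.ext h
  have e1 : entry A q f = 0 := Subtype.ext h1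
  have e2 : entry A q g = 0 := Subtype.ext h2
  refine sq_le_mul_of_forall fun x y => ?_
  have := hA.conj_le hσ p q f g (2 * x) (σ (entry A p q) * x) (2 * y) (σ (entry A f g) * y)
  rw [e0, e1, e2, map_zero] at this
  nlinarith

/-- The form is invariant under exchanging (p, f) with (q, g). The upper bound comes from a
symmetric test vector, the lower one from an antisymmetric one. -/
theorem IsVArithmetic.conj_cycle (hA : IsVArithmetic A) {σ : entryField A →+* ℝ}
    (hσ : IsNontrivial A σ) (h : A p g = 0) (h1 : A q f = 0) (h2 : A p f = 1) (h3 : A q g = 1)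
    (ht : σ (entry A f g) ^ 2 < 4) :
    σ (entry A p q) * (2 - σ (entry A f g)) ≤ 2 * (2 - σ (entry A f g)) - 1 ∧
      -(2 * (2 + σ (entry A f g)) - 1) ≤ σ (entry A p q) * (2 + σ (entry A f g)) := by
  have e0 : entry A p g = 0 := Subtype.ext h
  have e1 : entry A q f = 0 := Subtype.ext h1
  have e2 : entry A p f = 1 := Subtype.ext h2
  have e3 : entry A q g = 1 := Subtype.ext h3
  set t := σ (entry A f g)
  have ht1 : 0 < 2 - t := by nlinarith
  have ht2 : 0 < 2 + t := by nlinarith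
  have i1 := hA.conj_le hσ p q f g (2 - t) (2 - t) 1 1
  have i2 := hA.conj_le hσ p q f g (2 + t) (-(2 + t)) 1 (-1)
  rw [e0, e1, e2, e3, map_zero, map_one] at i1 i2
  constructor
  · refine le_of_mul_le_mul_right (a := 2 - t) ?_ ht1
    nlinarith
  · refine le_of_mul_le_mul_right (a := 2 + t) ?_ ht2
    nlinarith

end

end HypEdge

namespace HypEdge

/-! ### Values of the entries -/

lemma thin_mono {m k : ℕ} (hm : 1 ≤ m) (h : m ≤ k) : thin m ≤ thin k := by
  have hm' : (1 : ℝ) ≤ m := by exact_mod_cast hm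
  have hk : (m : ℝ) ≤ k := by exact_mod_cast h
  unfold thin
  have : Real.cos (Real.pi / m) ≤ Real.cos (Real.pi / k) := by
    apply Real.cos_le_cos_of_nonneg_of_le_pi (by positivity)
    · exact div_le_self Real.pi_pos.le hm'
    · exact div_le_div_of_nonneg_left Real.pi_pos.le (by linarith) hk
  linarith

lemma thin_two : thin 2 = 0 := by simp [thin]

lemma thin_three : thin 3 = 1 := by simp [thin]

lemma thin_four : thin 4 = √2 := by simp [thin]; ring

lemma thin_five : thin 5 = (1 + √5) / 2 := by simp [thin]; ring

lemma thin_six : thin 6 = √3 := by simp [thin]; ring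

/-- The number 16/5 separates the squares of entries of weight at most 6, which are at most 3, from
4cos²(π/7) ≈ 3.247. -/
lemma sq_thin_of_seven_le {m : ℕ} (hm : 7 ≤ m) : 16 / 5 < thin m ^ 2 := by
  have h1 := thin_mono (by norm_num) hm
  have h3 : 1.79 < thin 7 := by
    have := Real.one_sub_sq_div_two_le_cos (x := Real.pi / (7 : ℕ))
    have h3 := Real.pi_lt_d2
    have h4 : Real.pi / (7 : ℕ) ≤ 0.45 := by push_cast; linarith
    have h5 : 0 < Real.pi / (7 : ℕ) := by positivity
    unfold thin
    nlinarith
  nlinarith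

/-- The positive values below `√3` of entries of fundamental matrices. -/
def IsSmall (a : ℝ) : Prop := a = 1 ∨ a ^ 2 = 2 ∨ a ^ 2 = a + 1

variable {ι : Type*} {A : Matrix ι ι ℝ}

theorem IsFundamental.entry_cases (hA : IsFundamental A) {i j : ι} (hij : i ≠ j) (h2 : A i j < 2) :
    A i j = 0 ∨ IsSmall (A i j) ∨ A i j ^ 2 = 3 ∨ 16 / 5 < A i j ^ 2 := by
  obtain ⟨m, hm, h⟩ := hA.angle i j hij h2
  change A i j = thin m at h
  rw [h]
  rcases Nat.lt_or_ge m 7 with h7 | h7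
  · have h5 := Real.sq_sqrt (show (0 : ℝ) ≤ 5 by norm_num)
    interval_cases m
    · exact Or.inl thin_two
    · exact Or.inr (Or.inl (Or.inl thin_three))
    · refine Or.inr (Or.inl (Or.inr (Or.inl ?_)))
      rw [thin_four, Real.sq_sqrt (by norm_num)]
    · refine Or.inr (Or.inl (Or.inr (Or.inr ?_)))
      rw [thin_five]
      nlinarith
    · refine Or.inr (Or.inr (Or.inl ?_))
      rw [thin_six, Real.sq_sqrt (by norm_num)]
  · exact Or.inr (Or.inr (Or.inr (sq_thin_of_seven_le h7)))

theorem IsFundamental.small_of_sq_lt (hA : IsFundamental A) {i j : ι} (hij : i ≠ j)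
    (h0 : A i j ≠ 0) (h : A i j ^ 2 < 3) : IsSmall (A i j) := by
  have hn := hA.nonneg i j hij
  rcases hA.entry_cases hij (by nlinarith) with h1 | h1 | h1 | h1
  · exact absurd h1 h0
  · exact h1
  · linarith
  · linarith

lemma IsSmall.one_le {a : ℝ} (h : IsSmall a) (h0 : 0 ≤ a) : 1 ≤ a := by
  rcases h with h | h | h <;> nlinarith

lemma IsSmall.lt {a : ℝ} (h : IsSmall a) (h0 : 0 ≤ a) : a < 1.6181 := by
  rcases h with h | h | h <;> nlinarith

theorem IsFundamental.one_le (hA : IsFundamental A) {i j : ι} (hij : i ≠ j)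
    (h0 : A i j ≠ 0) : 1 ≤ A i j := by
  have hn := hA.nonneg i j hij
  by_contra! h
  rcases hA.entry_cases hij (by linarith) with h1 | h1 | h1 | h1
  · exact absurd h1 h0
  · exact absurd (h1.one_le hn) (by linarith)
  · nlinarith
  · nlinarith

lemma golden_sq {R : Type*} [CommRing R] {a : R} (h : a ^ 2 = a + 1) :
    (a ^ 2) ^ 2 = 3 * a ^ 2 - 1 := by
  linear_combination (a ^ 2 + a - 1) * h

section

variable [Fintype ι] {p q f g : ι}

/-! ### Paths -/

/-- On the path p, q, f one has a_pq² + a_qf² ≤ 4 at the conjugates. Weight 3 at qf is excluded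
because it only yields a_pq² ≤ 3; it is settled with a fourth vertex, or when a_pq < 2. -/
theorem IsVArithmetic.finrank_le_of_path (hA : IsVArithmetic A) (h : A p f = 0)
    (h1 : 16 / 5 < A p q ^ 2) (h2 : A p q ^ 2 < 196) (hqf : A q f ≠ 1) (hn : q ≠ f)
    (hf : A q f ≠ 0) (hf2 : A q f < 2) : Module.finrank ℚ (groundField A) ≤ 25 := by
  have hx := hA.sq_mem p q
  have hc := hA.sq_mem q f
  have hσ := fun σ hσ => hA.conj_path (σ := σ) (q := q) hσ h
  have h0 := hA.fundamental.nonneg q f hn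
  -- From weight 6 on, y = 4 - a_qf² lies in (0, 1] at the identity, and its conjugates bound those
  -- of a_pq².
  have hy : 3 ≤ A q f ^ 2 → Module.finrank ℚ (groundField A) ≤ 25 := fun h3 => by
    refine hA.finrank_le_of_add_le hx (y := 1 + 1 + 1 + 1 - entry A q f ^ 2) (sub_mem (add_mem
      (add_mem (add_mem (one_mem _) (one_mem _)) (one_mem _)) (one_mem _)) hc) ?_ ?_ ?_ ?_
      fun σ h => ?_
    · simpa [coe_entry] using h1
    · simpa [coe_entry] using h2
    · push_cast [coe_entry]; nlinarith
    · push_cast [coe_entry]; nlinarith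
    · have := hσ σ h
      simp only [map_pow, map_sub, map_add, map_one]
      refine ⟨by positivity, by linarith, by nlinarith [sq_nonneg (σ (entry A q f))]⟩
  rcases hA.fundamental.entry_cases hn hf2 with h3 | (h3 | h3 | h3) | h3 | h3
  · exact absurd h3 hf
  · exact absurd h3 hqf
  · refine hA.finrank_le_of_le_two hx (by simpa [coe_entry] using h1)
      (by simpa [coe_entry] using h2) fun σ h => ?_
    have e : entry A q f ^ 2 = 2 := Subtype.ext h3
    have := congrArg σ e
    rw [map_pow, map_ofNat] at this
    have h5 := hσ σ h
    rw [map_pow]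
    exact ⟨by positivity, by linarith⟩
  · have e : entry A q f ^ 2 = entry A q f + 1 := Subtype.ext h3
    refine hA.finrank_le_of_add_golden_le hx hc (golden_sq e) ?_ (by simpa [coe_entry] using h1)
      (by simpa [coe_entry] using h2) fun σ h => ?_
    · push_cast [coe_entry]; nlinarith
    · have h5 := hσ σ h
      rw [map_pow, map_pow]
      exact ⟨by positivity, by linarith⟩
  · exact hy h3.ge
  · exact hy (by linarith)

/-! ### Triangles -/

theorem IsVArithmetic.triangle_elem_mem (hA : IsVArithmetic A) (p q f : ι) :
    entry A p q ^ 2 + entry A p q * (entry A p f * entry A q f) ∈ groundIntegers A := by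
  have := add_mem (hA.sq_mem p q) (hA.triangle_mem p q f)
  rw [hA.entry_comm f p] at this
  convert this using 2
  ring

/-- The sum of the cyclic products pq and pqf completes a square: 4x + a_pf²·a_qf² = (2a_pq +
a_pf·a_qf)². B and C name the squares of the sides, so that they can be replaced by constants. -/
theorem IsVArithmetic.finrank_le_of_triangle_aux (hA : IsVArithmetic A) (hpq : p ≠ q)
    (hpf : p ≠ f) (hqf : q ≠ f) (h1 : 16 / 5 < A p q ^ 2) (h2 : A p q < 14)
    {B C : entryField A} (hB : ∀ σ : entryField A →+* ℝ, σ (entry A p f) ^ 2 = σ B)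
    (hC : ∀ σ : entryField A →+* ℝ, σ (entry A q f) ^ 2 = σ C) :
    let x := entry A p q ^ 2 + entry A p q * (entry A p f * entry A q f)
    x ∈ groundIntegers A ∧ 16 / 5 < (x : ℝ) ∧ (x : ℝ) ≤ 196 + 14 * (A p f * A q f) ∧
    ∀ σ, IsNontrivial A σ → 0 ≤ 4 * σ x + σ B * σ C ∧
      4 * σ x + σ B * σ C ≤ (4 - σ B) * (4 - σ C) := by
  intro x
  have h3 := hA.fundamental.nonneg p q hpq
  have h4 := mul_nonneg (hA.fundamental.nonneg p f hpf) (hA.fundamental.nonneg q f hqf)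
  have hx : (x : ℝ) = A p q ^ 2 + A p q * (A p f * A q f) := rfl
  refine ⟨hA.triangle_elem_mem p q f, ?_, ?_, fun σ hσ => ?_⟩
  · rw [hx]; nlinarith
  · rw [hx]; nlinarith
  · have := hA.conj_triangle hσ p q f
    have hx' : 4 * σ x + σ B * σ C =
        (2 * σ (entry A p q) + σ (entry A p f) * σ (entry A q f)) ^ 2 := by
      simp only [x, map_add, map_mul, map_pow]
      rw [← hB, ← hC]
      ring
    rw [hx']
    exact ⟨sq_nonneg _, by rwa [← hB, ← hC]⟩

lemma map_one_add_one {R : Type*} [CommRing R] (σ : R →+* ℝ) : σ (1 + 1) = 2 := by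
  rw [map_add, map_one]
  norm_num

lemma map_sq_of_eq {R : Type*} [CommRing R] {a b : R} (h : a ^ 2 = b) (σ : R →+* ℝ) :
    σ a ^ 2 = σ b := by rw [← h, map_pow]

theorem IsVArithmetic.finrank_le_of_triangle (hA : IsVArithmetic A) (hpq : p ≠ q)
    (hpf : p ≠ f) (hqf : q ≠ f) (h1 : 16 / 5 < A p q ^ 2) (h2 : A p q < 14)
    (ha : IsSmall (A p f)) (hb : IsSmall (A q f)) : Module.finrank ℚ (groundField A) ≤ 23 := by
  wlog hab : A p f ≤ A q f generalizing p q
  · exact this hpq.symm hqf hpf (by rwa [hA.fundamental.symm.apply p q])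
      (by rwa [hA.fundamental.symm.apply p q]) hb ha (le_of_not_ge hab)
  have ha0 := hA.fundamental.nonneg p f hpf
  have hb0 := hA.fundamental.nonneg q f hqf
  have hc := hA.sq_mem q f
  rcases ha with ha | ha | ha <;> rcases hb with hb | hb | hb
  all_goals try (exfalso; nlinarith)
  · obtain ⟨hx, hx1, hx2, hσ⟩ := hA.finrank_le_of_triangle_aux hpq hpf hqf h1 h2 (B := 1) (C := 1)
      (map_sq_of_eq (Subtype.ext (by push_cast [coe_entry]; nlinarith)))
      (map_sq_of_eq (Subtype.ext (by push_cast [coe_entry]; nlinarith)))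
    refine hA.finrank_le_of_triangle_one_one hx hx1 (by nlinarith) fun σ h => ?_
    have := hσ σ h
    simp only [map_one] at this
    constructor <;> linarith
  · obtain ⟨hx, hx1, hx2, hσ⟩ := hA.finrank_le_of_triangle_aux hpq hpf hqf h1 h2 (B := 1)
      (C := 1 + 1)
      (map_sq_of_eq (Subtype.ext (by push_cast [coe_entry]; nlinarith)))
      (map_sq_of_eq (Subtype.ext (by push_cast [coe_entry]; linarith)))
    refine hA.finrank_le_of_triangle_one_two hx hx1 (by nlinarith) fun σ h => ?_
    have := hσ σ h
    simp only [map_one, map_one_add_one] at this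
    constructor <;> linarith
  · have e : entry A q f ^ 2 = entry A q f + 1 := Subtype.ext hb
    obtain ⟨hx, hx1, hx2, hσ⟩ := hA.finrank_le_of_triangle_aux hpq hpf hqf h1 h2 (B := 1)
      (C := entry A q f ^ 2)
      (map_sq_of_eq (Subtype.ext (by push_cast [coe_entry]; nlinarith)))
      (map_sq_of_eq rfl)
    refine hA.finrank_le_of_triangle_one_golden hx hc (golden_sq e)
      (by push_cast [coe_entry]; nlinarith) hx1 (by nlinarith) fun σ h => ?_
    have := hσ σ h
    simp only [map_one] at this
    constructor <;> linarith
  · obtain ⟨hx, hx1, hx2, hσ⟩ := hA.finrank_le_of_triangle_aux hpq hpf hqf h1 h2 (B := 1 + 1)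
      (C := 1 + 1)
      (map_sq_of_eq (Subtype.ext (by push_cast [coe_entry]; linarith)))
      (map_sq_of_eq (Subtype.ext (by push_cast [coe_entry]; linarith)))
    refine hA.finrank_le_of_triangle_two_two hx hx1 (by nlinarith) fun σ h => ?_
    have := hσ σ h
    simp only [map_one_add_one] at this
    constructor <;> linarith
  · have e : entry A q f ^ 2 = entry A q f + 1 := Subtype.ext hb
    obtain ⟨hx, hx1, hx2, hσ⟩ := hA.finrank_le_of_triangle_aux hpq hpf hqf h1 h2 (B := 1 + 1)
      (C := entry A q f ^ 2)
      (map_sq_of_eq (Subtype.ext (by push_cast [coe_entry]; linarith)))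
      (map_sq_of_eq rfl)
    refine hA.finrank_le_of_triangle_two_golden hx hc (golden_sq e)
      (by push_cast [coe_entry]; nlinarith) hx1 ?_ fun σ h => ?_
    · have : A p f < 1.4143 := by nlinarith
      have : A q f < 1.6181 := by nlinarith
      nlinarith
    · have := hσ σ h
      simp only [map_one_add_one] at this
      constructor <;> linarith
  · exfalso
    have : 3 / 2 < A p f := by nlinarith
    nlinarith
  · have e : entry A q f ^ 2 = entry A q f + 1 := Subtype.ext hb
    have e2 : A p f = A q f := by
      have h3 : (A p f - A q f) * (A p f + A q f - 1) = 0 := by linear_combination ha - hb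
      rcases mul_eq_zero.1 h3 with h3 | h3 <;> nlinarith
    obtain ⟨hx, hx1, hx2, hσ⟩ := hA.finrank_le_of_triangle_aux hpq hpf hqf h1 h2
      (B := entry A q f ^ 2) (C := entry A q f ^ 2)
      (map_sq_of_eq (Subtype.ext (by push_cast [coe_entry]; rw [e2])))
      (map_sq_of_eq rfl)
    refine hA.finrank_le_of_triangle_golden_golden hx hc (golden_sq e)
      (by push_cast [coe_entry]; nlinarith) hx1 ?_ fun σ h => hσ σ h
    have : A q f < 1.6181 := by nlinarith
    nlinarith

end

end HypEdge

namespace HypEdge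

variable {ι : Type*} {A : Matrix ι ι ℝ}

section

variable [Fintype ι] {p q f g : ι}

/-! ### Triangles with a side of weight 6, and paths with an edge of weight 3 -/

theorem IsVArithmetic.finrank_le_of_triangle_three (hA : IsVArithmetic A) (hpq : p ≠ q)
    (hpf : p ≠ f) (hqf : q ≠ f) (h1 : 16 / 5 < A p q ^ 2) (h2 : A p q < 2)
    (ha : A p f ^ 2 = 3) (hb : IsSmall (A q f)) : Module.finrank ℚ (groundField A) ≤ 23 := by
  have hu0 := hA.fundamental.nonneg p q hpq
  have ha0 := hA.fundamental.nonneg p f hpf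
  have hb0 := hA.fundamental.nonneg q f hqf
  have hc := hA.sq_mem q f
  have hb2 := hb.lt hb0
  have ha3 : entry A p f ^ 2 = 1 + 1 + 1 := Subtype.ext (by push_cast [coe_entry]; linarith)
  have h3 (σ : entryField A →+* ℝ) : σ (1 + 1 + 1) = 3 := by
    rw [map_add, map_one_add_one, map_one]; norm_num
  have hlt : A p q ^ 2 + A p q * (A p f * A q f) < 11 := by
    have h5 : A p f < 1.7321 := by nlinarith
    have h6 : A p f * A q f ≤ 1.7321 * 1.6181 :=
      mul_le_mul h5.le hb2.le hb0 (by norm_num)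
    nlinarith
  rcases hb with hb | hb | hb
  · obtain ⟨hx, hx1, -, hσ⟩ := hA.finrank_le_of_triangle_aux hpq hpf hqf h1 (by linarith)
      (map_sq_of_eq ha3) (C := 1)
      (map_sq_of_eq (Subtype.ext (by push_cast [coe_entry]; nlinarith)))
    -- The interval 0 ≤ 4x + 3 ≤ 3 lies inside the one for two sides of weight 4.
    refine hA.finrank_le_of_triangle_two_two hx hx1 ?_ fun σ h => ?_
    · push_cast [coe_entry]; linarith
    · have := hσ σ h
      simp only [map_one, h3] at this
      constructor <;> linarith
  · obtain ⟨hx, hx1, -, hσ⟩ := hA.finrank_le_of_triangle_aux hpq hpf hqf h1 (by linarith)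
      (map_sq_of_eq ha3) (C := 1 + 1)
      (map_sq_of_eq (Subtype.ext (by push_cast [coe_entry]; linarith)))
    refine hA.finrank_le_of_triangle_three_two hx hx1 ?_ fun σ h => ?_
    · push_cast [coe_entry]; linarith
    · have := hσ σ h
      simp only [map_one_add_one, h3] at this
      constructor <;> linarith
  · have e : entry A q f ^ 2 = entry A q f + 1 := Subtype.ext hb
    obtain ⟨hx, hx1, -, hσ⟩ := hA.finrank_le_of_triangle_aux hpq hpf hqf h1 (by linarith)
      (map_sq_of_eq ha3) (map_sq_of_eq (b := entry A q f ^ 2) rfl)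
    refine hA.finrank_le_of_triangle_three_golden hx hc (golden_sq e)
      (by push_cast [coe_entry]; nlinarith) hx1 ?_ fun σ h => ?_
    · push_cast [coe_entry]; linarith
    · have := hσ σ h
      simp only [h3] at this
      constructor <;> linarith

theorem IsVArithmetic.finrank_le_of_path_one (hA : IsVArithmetic A) (h : A p f = 0)
    (h1 : 16 / 5 < A p q ^ 2) (h2 : A p q ^ 2 < 4) (hqf : A q f = 1) :
    Module.finrank ℚ (groundField A) ≤ 25 := by
  refine hA.finrank_le_of_le_three (hA.sq_mem p q) (by push_cast [coe_entry]; exact h1)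
    (by push_cast [coe_entry]; exact h2) fun σ hσ => ?_
  have e : entry A q f = 1 := Subtype.ext hqf
  have := hA.conj_path hσ (q := q) h
  rw [e, map_one] at this
  rw [map_pow]
  exact ⟨by positivity, by linarith⟩

/-! ### Trees and cycles with four vertices -/

theorem IsVArithmetic.finrank_le_of_long_path (hA : IsVArithmetic A) (h : A p g = 0)
    (h' : A q f = 0) (h'' : A q g = 0) (h1 : 16 / 5 < A p q ^ 2) (h2 : A p q ^ 2 < 196)
    (hpf : A p f = 1) (hfg : IsSmall (A f g)) (hfg0 : 0 ≤ A f g) :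
    Module.finrank ℚ (groundField A) ≤ 25 := by
  have hx := hA.sq_mem p q
  have hc := hA.sq_mem f g
  have hx1 : 16 / 5 < ((entry A p q ^ 2 : entryField A) : ℝ) := by push_cast [coe_entry]; exact h1
  have hx2 : ((entry A p q ^ 2 : entryField A) : ℝ) < 196 := by push_cast [coe_entry]; exact h2
  have hσ : ∀ σ, IsNontrivial A σ →
      4 ≤ (4 - σ (entry A p q ^ 2)) * (4 - σ (entry A f g ^ 2)) := fun σ hσ => by
    have e : entry A p f = 1 := Subtype.ext hpf
    have := hA.conj_long_path hσ h h' h''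
    rw [e, map_one] at this
    simp only [map_pow]
    linarith
  have hn (σ : entryField A →+* ℝ) : 0 ≤ σ (entry A p q ^ 2) := by rw [map_pow]; positivity
  rcases hfg with hb | hb | hb
  · refine hA.finrank_le_of_le_eight_thirds hx hx1 hx2 fun σ h => ⟨hn σ, ?_⟩
    have e : entry A f g = 1 := Subtype.ext hb
    have := hσ σ h
    rw [e, map_pow σ 1, map_one] at this
    linarith
  · refine hA.finrank_le_of_le_two hx hx1 hx2 fun σ h => ⟨hn σ, ?_⟩
    have e : entry A f g ^ 2 = 1 + 1 := Subtype.ext (by push_cast [coe_entry]; linarith)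
    have := hσ σ h
    rw [e, map_one_add_one] at this
    linarith
  · have e : entry A f g ^ 2 = entry A f g + 1 := Subtype.ext hb
    exact hA.finrank_le_of_golden_path hx hc (golden_sq e)
      (by push_cast [coe_entry]; nlinarith) hx1 hx2 fun σ h => ⟨hn σ, hσ σ h⟩

/-- A 4-cycle whose edge fg is absent: the conjugates of a_pq are at most 3/2 in absolute value, and
9/4 ≤ 8/3. -/
theorem IsVArithmetic.finrank_le_of_end_paths (hA : IsVArithmetic A) (h : A p g = 0)
    (h' : A q f = 0) (hfg : A f g = 0) (h1 : 16 / 5 < A p q ^ 2) (h2 : A p q ^ 2 < 196)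
    (hpf : A p f = 1) (hqg : A q g = 1) : Module.finrank ℚ (groundField A) ≤ 25 := by
  refine hA.finrank_le_of_le_eight_thirds (hA.sq_mem p q) (by push_cast [coe_entry]; exact h1)
    (by push_cast [coe_entry]; exact h2) fun σ hσ => ?_
  have e : entry A f g = 0 := Subtype.ext hfg
  have := hA.conj_cycle hσ h h' hpf hqg (by rw [e, map_zero]; norm_num)
  rw [e, map_zero] at this
  rw [map_pow]
  exact ⟨by positivity, by nlinarith⟩

theorem IsVArithmetic.finrank_le_of_cycle (hA : IsVArithmetic A) (h : A p g = 0)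
    (h' : A q f = 0) (h1 : 16 / 5 < A p q ^ 2) (h0 : 0 ≤ A p q) (h2 : A p q < 14)
    (hpf : A p f = 1) (hqg : A q g = 1) (hfg : IsSmall (A f g)) (hfg0 : 0 ≤ A f g) :
    Module.finrank ℚ (groundField A) ≤ 25 := by
  have hx1 : 17 / 10 < A p q := by nlinarith
  have e1 : entry A f p = 1 := Subtype.ext ((hA.fundamental.symm.apply p f).trans hpf)
  have e2 : entry A q g = 1 := Subtype.ext hqg
  have hm := hA.quadrilateral_mem p q g f
  rw [e1, e2, mul_one, mul_one, hA.entry_comm g f] at hm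
  have hσ := fun σ hσ => hA.conj_cycle (σ := σ) hσ h h' hpf hqg
  rcases hfg with hb | hb | hb
  · have e : entry A f g = 1 := Subtype.ext hb
    rw [e, mul_one] at hm
    refine hA.finrank_le_of_cycle_one hm hx1 h2 fun σ h => ?_
    have := hσ σ h (by rw [e, map_one]; norm_num)
    rw [e, map_one] at this
    constructor <;> linarith
  · have hb2 := IsSmall.lt (Or.inr (Or.inl hb)) hfg0
    -- Let u, t be the conjugates of a_pq and a_fg. With t² = 2 the cycle inequalities become |u +
    -- t/2| ≤ 1, and u² + ut = (u + t/2)² - 1/2.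
    refine hA.finrank_le_of_abs_le_half (x := entry A p q ^ 2 + entry A p q * entry A f g)
      (add_mem (hA.sq_mem p q) hm) ?_ ?_ fun σ h => ?_
    · push_cast [coe_entry]; positivity
    · have : A f g < 1.4143 := by nlinarith
      push_cast [coe_entry]; nlinarith
    · have e : entry A f g ^ 2 = 1 + 1 := Subtype.ext (by push_cast [coe_entry]; linarith)
      have ht := map_sq_of_eq e σ
      rw [map_one_add_one] at ht
      have h3 := hσ σ h (by rw [ht]; norm_num)
      set t := σ (entry A f g)
      set u := σ (entry A p q)
      have i1 : u ≤ 1 - t / 2 := by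
        have h4 := h3.1
        have : 0 < 2 + t := by nlinarith
        nlinarith
      have i2 : -1 - t / 2 ≤ u := by
        have h4 := h3.2
        have : 0 < 2 - t := by nlinarith
        nlinarith
      rw [map_add, map_pow, map_mul]
      constructor
      · nlinarith [sq_nonneg (u + t / 2)]
      · nlinarith [mul_nonneg (sub_nonneg.2 i1) (sub_nonneg.2 i2)]
  · have e : entry A f g ^ 2 = entry A f g + 1 := Subtype.ext hb
    have hc := hA.sq_mem f g
    have ht : entry A f g ∈ groundIntegers A := by
      have := sub_mem hc (one_mem _)
      rwa [e, add_sub_cancel_right] at this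
    -- The cyclic product is a_pq·a_fg, and the golden ratio is a unit of the ground field with
    -- inverse a_fg - 1; so a_pq itself may be used.
    have hu : entry A p q ∈ groundIntegers A := by
      have := Subring.mul_mem _ hm (sub_mem ht (one_mem _))
      have e3 : entry A p q * entry A f g * (entry A f g - 1) = entry A p q := by
        linear_combination entry A p q * e
      rwa [e3] at this
    refine hA.finrank_le_of_cycle_golden hu hc (golden_sq e)
      (by push_cast [coe_entry]; nlinarith) hx1 h2 fun σ h => ?_
    have ht2 : σ (entry A f g) ^ 2 = σ (entry A f g) + 1 := by
      have := congrArg σ e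
      rwa [map_pow, map_add, map_one] at this
    have h3 := hσ σ h (by nlinarith)
    rw [map_pow]
    set t := σ (entry A f g)
    set u := σ (entry A p q)
    have i0 : t < 2 := by nlinarith
    have i0' : -2 < t := by nlinarith
    have i1 := mul_le_mul_of_nonneg_right h3.1 (show 0 ≤ 2 + t by linarith)
    have i2 := mul_le_mul_of_nonneg_right h3.2 (show 0 ≤ 2 - t by linarith)
    constructor <;> nlinarith

theorem IsVArithmetic.finrank_le_of_fork (hA : IsVArithmetic A) (hpq : p ≠ q)
    (hpf : p ≠ f) (hqf : q ≠ f) (h : A q g = 0) (h' : A f g = 0) (hpg : A p g = 1)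
    (h1 : 16 / 5 < A p q ^ 2) (h2 : A p q < 14) (ha : IsSmall (A p f)) (hb : A q f < 2) :
    Module.finrank ℚ (groundField A) ≤ 25 := by
  have hu0 := hA.fundamental.nonneg p q hpq
  have ha0 := hA.fundamental.nonneg p f hpf
  have hb0 := hA.fundamental.nonneg q f hqf
  have hx := hA.triangle_elem_mem p q f
  have hz := hA.sq_mem q f
  have hz0 : 0 ≤ ((entry A q f ^ 2 : entryField A) : ℝ) := by push_cast [coe_entry]; positivity
  have hz4 : ((entry A q f ^ 2 : entryField A) : ℝ) < 4 := by push_cast [coe_entry]; nlinarith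
  have hx1 : 16 / 5 < ((entry A p q ^ 2 + entry A p q * (entry A p f * entry A q f) :
      entryField A) : ℝ) := by
    push_cast [coe_entry]
    have := mul_nonneg hu0 (mul_nonneg ha0 hb0)
    linarith
  have hx2 (k : ℝ) (hk : A p f ≤ k) : ((entry A p q ^ 2 + entry A p q * (entry A p f *
      entry A q f) : entryField A) : ℝ) < 196 + 28 * k := by
    push_cast [coe_entry]
    have h3 : A p f * A q f ≤ k * 2 := mul_le_mul hk hb.le hb0 (ha0.trans hk)
    -- The edge qf may have any thin weight, so only a_qf < 2 is available.
    have h4 : A p q * (A p f * A q f) ≤ 14 * (k * 2) :=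
      mul_le_mul h2.le h3 (mul_nonneg ha0 hb0) (by norm_num)
    nlinarith
  have hσ : ∀ σ, IsNontrivial A σ → ∀ B, σ (entry A p f) ^ 2 = B →
      let x := entry A p q ^ 2 + entry A p q * (entry A p f * entry A q f)
      0 ≤ σ (entry A q f ^ 2) ∧ σ (entry A q f ^ 2) ≤ 4 ∧
      0 ≤ 4 * σ x + B * σ (entry A q f ^ 2) ∧
      4 * σ x + B * σ (entry A q f ^ 2) ≤ (3 - B) * (4 - σ (entry A q f ^ 2)) := by
    intro σ hσ B hB x
    have h3 := hA.conj_fork (p := p) hσ h h'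
    have e : entry A p g = 1 := Subtype.ext hpg
    have h4 := hA.conj_sq_le_four hσ q f
    have hx' : 4 * σ x + B * σ (entry A q f ^ 2) =
        (2 * σ (entry A p q) + σ (entry A p f) * σ (entry A q f)) ^ 2 := by
      simp only [x, map_add, map_mul, map_pow]
      rw [← hB]
      ring
    rw [e, map_one, hB] at h3
    rw [hx', map_pow]
    exact ⟨by positivity, h4, by positivity, by linarith⟩
  rcases ha with ha | ha | ha
  · have e : entry A p f = 1 := Subtype.ext ha
    refine hA.finrank_le_of_fork_one hx hz hx1 ?_ hz0 hz4 fun σ h => ?_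
    · linarith [hx2 1 ha.le]
    · obtain ⟨i1, i2, i3, i4⟩ := hσ σ h 1 (by rw [e, map_one]; norm_num)
      exact ⟨i1, by linarith, by linarith⟩
  · have e : entry A p f ^ 2 = 1 + 1 := Subtype.ext (by push_cast [coe_entry]; linarith)
    refine hA.finrank_le_of_fork_two hx hz hx1 ?_ hz0 hz4 fun σ h => ?_
    · linarith [hx2 1.4143 (by nlinarith)]
    · obtain ⟨i1, i2, i3, i4⟩ := hσ σ h 2 (by rw [map_sq_of_eq e, map_one_add_one])
      exact ⟨i1, i2, by linarith, by linarith⟩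
  · have e : entry A p f ^ 2 = entry A p f + 1 := Subtype.ext ha
    refine hA.finrank_le_of_fork_golden hx hz (hA.sq_mem p f) (golden_sq e)
      (by push_cast [coe_entry]; nlinarith) hx1 ?_ hz0 hz4 fun σ h => ?_
    · linarith [hx2 1.6181 (by nlinarith)]
    · have := hσ σ h (σ (entry A p f ^ 2)) (map_sq_of_eq rfl σ)
      exact this

end

end HypEdge

namespace HypEdge

variable {ι : Type*} {A : Matrix ι ι ℝ}

/-! ### Finite edge graphs -/

/-- The combinatorial properties of the Gram matrix of a finite edge chamber, where `p` and `q` are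
the indices of the faces that do not contain the edge: the faces through a finite vertex form a
spherical graph. -/
structure EdgeData (A : Matrix ι ι ℝ) (p q : ι) : Prop where
  ne : p ≠ q
  lt : ∀ i j, i ≠ j → (i ≠ p ∧ j ≠ p ∨ i ≠ q ∧ j ≠ q) → A i j < 2
  triple : ∀ i j k, i ≠ j → j ≠ k → i ≠ k →
    (i ≠ p ∧ j ≠ p ∧ k ≠ p ∨ i ≠ q ∧ j ≠ q ∧ k ≠ q) →
    A i j ≠ 0 → A j k ≠ 0 → A i k = 0 ∧ A i j ^ 2 + A j k ^ 2 < 4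

theorem EdgeData.swap {p q : ι} (h : EdgeData A p q) : EdgeData A q p :=
  ⟨h.ne.symm, fun i j hij hh => h.lt i j hij hh.symm,
    fun i j k h1 h2 h3 hh => h.triple i j k h1 h2 h3 hh.symm⟩

/-- The other entry is at least 1, which leaves a square below 3. -/
theorem IsFundamental.small_of_add_lt (hA : IsFundamental A) {i j k l : ι} (hij : i ≠ j)
    (hkl : k ≠ l) (h0 : A i j ≠ 0) (h1 : A k l ≠ 0) (h : A i j ^ 2 + A k l ^ 2 < 4) :
    IsSmall (A i j) := by
  refine hA.small_of_sq_lt hij h0 ?_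
  have := hA.one_le hkl h1
  nlinarith

/-! ### Case analysis of four vertices p, q, f, g -/

section

variable [Fintype ι] {p q f g : ι}

/-- A face `f` that is joined to `p` and `q`, and a face `g` that is joined to `f`, or to both `p`
and `q`: the triangle `p q f` has small weights. -/
theorem IsVArithmetic.finrank_le_of_edge_triangle (hA : IsVArithmetic A) (hE : EdgeData A p q)
    (hu : 16 / 5 < A p q ^ 2) (hu2 : A p q < 14) (hfp : f ≠ p) (hfq : f ≠ q) (hgp : g ≠ p)
    (hgq : g ≠ q) (hfg : f ≠ g) (ha : A p f ≠ 0) (hb : A q f ≠ 0)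
    (h : A f g ≠ 0 ∨ A p g ≠ 0 ∧ A q g ≠ 0) : Module.finrank ℚ (groundField A) ≤ 23 := by
  have hs := fun i j => hA.fundamental.symm.apply i j
  have hF := hA.fundamental
  refine hA.finrank_le_of_triangle hE.ne hfp.symm hfq.symm hu hu2 ?_ ?_
  · rcases h with h | ⟨h1, h2⟩
    · exact hF.small_of_add_lt hfp.symm hfg ha h
        (hE.triple p f g hfp.symm hfg hgp.symm (Or.inr ⟨hE.ne, hfq, hgq⟩) ha h).2
    · have := (hE.triple f p g hfp hgp.symm hfg (Or.inr ⟨hfq, hE.ne, hgq⟩)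
        (by rwa [hs]) h1).2
      rw [hs p f] at this
      exact hF.small_of_add_lt hfp.symm hgp.symm ha h1 this
  · rcases h with h | ⟨h1, h2⟩
    · exact hF.small_of_add_lt hfq.symm hfg hb h
        (hE.triple q f g hfq.symm hfg hgq.symm (Or.inl ⟨hE.ne.symm, hfp, hgp⟩) hb h).2
    · have := (hE.triple f q g hfq hgq.symm hfg (Or.inl ⟨hfp, hE.ne.symm, hgp⟩)
        (by rwa [hs]) h2).2
      rw [hs q f] at this
      exact hF.small_of_add_lt hfq.symm hgq.symm hb h2 this

/-- A face `f` that is joined to `p` and not to `q` by an edge of weight different from `3`. -/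
theorem IsVArithmetic.finrank_le_of_pendant (hA : IsVArithmetic A) (hE : EdgeData A p q)
    (hu : 16 / 5 < A p q ^ 2) (hu2 : A p q < 14) (hfp : f ≠ p) (hfq : f ≠ q)
    (ha : A p f ≠ 0) (hb : A q f = 0) (h1 : A p f ≠ 1) :
    Module.finrank ℚ (groundField A) ≤ 25 := by
  have hs := fun i j => hA.fundamental.symm.apply i j
  have h0 := hA.fundamental.nonneg p q hE.ne
  refine hA.finrank_le_of_path (p := q) (q := p) (f := f) hb (by rwa [hs]) ?_ h1 hfp.symm ha
    (hE.lt p f hfp.symm (Or.inr ⟨hE.ne, hfq⟩))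
  rw [hs]
  nlinarith

/-- A face `f` that is joined to `p` and `q`, and a face `g` that is joined to `p` only. -/
theorem IsVArithmetic.finrank_le_of_edge_fork (hA : IsVArithmetic A) (hE : EdgeData A p q)
    (hu : 16 / 5 < A p q ^ 2) (hu2 : A p q < 14) (hfp : f ≠ p) (hfq : f ≠ q) (hgp : g ≠ p)
    (hgq : g ≠ q) (hfg : f ≠ g) (ha : A p f ≠ 0) (hc : A p g ≠ 0) (hd : A q g = 0)
    (ht : A f g = 0) : Module.finrank ℚ (groundField A) ≤ 25 := by
  by_cases h1 : A p g = 1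
  · have hs := fun i j => hA.fundamental.symm.apply i j
    have := (hE.triple f p g hfp hgp.symm hfg (Or.inr ⟨hfq, hE.ne, hgq⟩) (by rwa [hs]) hc).2
    rw [hs p f] at this
    exact hA.finrank_le_of_fork hE.ne hfp.symm hfq.symm hd ht h1 hu hu2
      (hA.fundamental.small_of_add_lt hfp.symm hgp.symm ha hc this)
      (hE.lt q f hfq.symm (Or.inl ⟨hE.ne.symm, hfp⟩))
  · exact hA.finrank_le_of_pendant hE hu hu2 hgp hgq hc hd h1

theorem IsVArithmetic.finrank_le_of_edge_aux (hA : IsVArithmetic A) (hE : EdgeData A p q)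
    (hu : 16 / 5 < A p q ^ 2) (hu2 : A p q < 14) (hfp : f ≠ p) (hfq : f ≠ q) (hgp : g ≠ p)
    (hgq : g ≠ q) (hfg : f ≠ g) (ha : A p f ≠ 0) (hg : A p g ≠ 0 ∨ A q g ≠ 0 ∨ A f g ≠ 0) :
    Module.finrank ℚ (groundField A) ≤ 25 := by
  have hs := fun i j => hA.fundamental.symm.apply i j
  have hF := hA.fundamental
  have hu' : 16 / 5 < A q p ^ 2 := by rwa [hs]
  have hu2' : A q p < 14 := by rwa [hs]
  by_cases hb : A q f = 0
  · by_cases h1 : A p f = 1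
    swap
    · exact hA.finrank_le_of_pendant hE hu hu2 hfp hfq ha hb h1
    by_cases ht : A f g = 0
    · by_cases hc : A p g = 0
      · have hd : A q g ≠ 0 := by tauto
        by_cases h2 : A q g = 1
        · refine hA.finrank_le_of_end_paths hc hb ht hu ?_ h1 h2
          have := hF.nonneg p q hE.ne
          nlinarith
        · exact hA.finrank_le_of_pendant hE.swap hu' hu2' hgq hgp hd hc h2
      · exact hA.finrank_le_of_edge_fork hE hu hu2 hgp hgq hfp hfq hfg.symm hc ha hb
          (by rwa [hs])
    · have h3 := hE.triple p f g hfp.symm hfg hgp.symm (Or.inr ⟨hE.ne, hfq, hgq⟩) ha ht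
      have h4 : IsSmall (A f g) := hF.small_of_add_lt hfg hfp.symm ht ha (by linarith [h3.2])
      by_cases hd : A q g = 0
      · refine hA.finrank_le_of_long_path h3.1 hb hd hu ?_ h1 h4 (hF.nonneg f g hfg)
        have := hF.nonneg p q hE.ne
        nlinarith
      · by_cases h5 : A q g = 1
        · exact hA.finrank_le_of_cycle h3.1 hb hu (hF.nonneg p q hE.ne) hu2 h1 h5 h4
            (hF.nonneg f g hfg)
        · exact hA.finrank_le_of_pendant hE.swap hu' hu2' hgq hgp hd h3.1 h5
  · by_cases h : A f g ≠ 0 ∨ A p g ≠ 0 ∧ A q g ≠ 0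
    · exact (hA.finrank_le_of_edge_triangle hE hu hu2 hfp hfq hgp hgq hfg ha hb h).trans
        (by norm_num)
    · push Not at h
      by_cases hc : A p g = 0
      · exact hA.finrank_le_of_edge_fork hE.swap hu' hu2' hfq hfp hgq hgp hfg hb (by tauto) hc h.1
      · exact hA.finrank_le_of_edge_fork hE hu hu2 hfp hfq hgp hgq hfg ha hc (h.2 hc) h.1

theorem IsVArithmetic.finrank_le_of_edge (hA : IsVArithmetic A) (hE : EdgeData A p q)
    (hu : 16 / 5 < A p q ^ 2) (hu2 : A p q < 14) (hfp : f ≠ p) (hfq : f ≠ q) (hgp : g ≠ p)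
    (hgq : g ≠ q) (hfg : f ≠ g) (hf : A p f ≠ 0 ∨ A q f ≠ 0)
    (hg : A p g ≠ 0 ∨ A q g ≠ 0 ∨ A f g ≠ 0) :
    Module.finrank ℚ (groundField A) ≤ 25 := by
  have hs := hA.fundamental.symm.apply p q
  rcases hf with hf | hf
  · exact hA.finrank_le_of_edge_aux hE hu hu2 hfp hfq hgp hgq hfg hf hg
  · exact hA.finrank_le_of_edge_aux hE.swap (by rwa [hs]) (by rwa [hs]) hfq hfp hgq hgp hfg hf
      (by tauto)

end

end HypEdge

namespace HypEdge

open IntermediateField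

/-! ### Components with small entries -/

lemma finrank_adjoin_sqrt_le (k : ℕ) :
    FiniteDimensional ℚ ℚ⟮√(k : ℝ)⟯ ∧ Module.finrank ℚ ℚ⟮√(k : ℝ)⟯ ≤ 2 := by
  have hmonic : (Polynomial.X ^ 2 - Polynomial.C (k : ℚ)).Monic :=
    Polynomial.monic_X_pow_sub_C _ (by norm_num)
  have hroot : Polynomial.aeval (√(k : ℝ)) (Polynomial.X ^ 2 - Polynomial.C (k : ℚ)) = 0 := by
    simp [Real.sq_sqrt]
  have hint : IsIntegral ℚ (√(k : ℝ)) := ⟨_, hmonic, hroot⟩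
  refine ⟨adjoin.finiteDimensional hint, ?_⟩
  rw [adjoin.finrank hint]
  refine (Polynomial.natDegree_le_natDegree (minpoly.min ℚ _ hmonic hroot)).trans ?_
  rw [Polynomial.natDegree_X_pow_sub_C]

lemma finrank_le_of_le {E F : IntermediateField ℚ ℝ} [FiniteDimensional ℚ F] (h : E ≤ F) :
    Module.finrank ℚ E ≤ Module.finrank ℚ F :=
  LinearMap.finrank_le_finrank_of_injective (f := (inclusion h).toLinearMap)
    (inclusion_injective h)

variable {ι : Type*} {A : Matrix ι ι ℝ}

section

variable [Fintype ι]

/-- An embedding that fixes the entries on S preserves the positive value at x. The conjugate form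
is then not negative semidefinite, so the embedding is the identity on the ground field. -/
theorem IsVArithmetic.groundField_le_adjoin (hA : IsVArithmetic A) {S : Set ι} {x : ι → ℝ}
    (hx : ∀ i ∉ S, x i = 0) (hpos : 0 < x ⬝ᵥ A.mulVec x) :
    groundField A ≤ adjoin ℚ {a | ∃ i ∈ S, ∃ j ∈ S, a = A i j} := by
  have := hA.finiteDimensional_entryField
  have := hA.totallyReal
  have hle : adjoin ℚ {a | ∃ i ∈ S, ∃ j ∈ S, a = A i j} ≤ entryField A := by
    refine adjoin_le_iff.2 ?_
    rintro _ ⟨i, -, j, -, rfl⟩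
    exact entry_mem A i j
  intro b hb
  refine mem_of_forall_fixed hle ⟨b, groundField_le_entryField A hb⟩ fun σ hσ => ?_
  by_contra hne
  have hneg := (hA.negative σ ⟨_, hb, hne⟩).dotProduct_mulVec_nonneg x
  have hsame : x ⬝ᵥ (conjMatrix A σ).mulVec x = x ⬝ᵥ A.mulVec x := by
    simp only [dotProduct, Matrix.mulVec, Finset.mul_sum]
    refine Finset.sum_congr rfl fun i _ => Finset.sum_congr rfl fun j _ => ?_
    by_cases hi : i ∈ S
    · by_cases hj : j ∈ S
      · have : conjMatrix A σ i j = A i j :=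
          hσ (entry A i j) (subset_adjoin ℚ _ ⟨i, hi, j, hj, rfl⟩)
        rw [this]
      · simp [hx j hj]
    · simp [hx i hi]
  simp only [star_trivial, Matrix.neg_mulVec, dotProduct_neg, hsame] at hneg
  linarith

theorem IsVArithmetic.finrank_le_of_small (hA : IsVArithmetic A) {S : Set ι}
    (hS : ∀ i ∈ S, ∀ j ∈ S, i ≠ j → A i j ^ 2 ≤ 16 / 5) {x : ι → ℝ}
    (hx : ∀ i ∉ S, x i = 0) (hpos : 0 < x ⬝ᵥ A.mulVec x) :
    Module.finrank ℚ (groundField A) ≤ 8 := by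
  obtain ⟨f2, d2⟩ := finrank_adjoin_sqrt_le 2
  obtain ⟨f3, d3⟩ := finrank_adjoin_sqrt_le 3
  obtain ⟨f5, d5⟩ := finrank_adjoin_sqrt_le 5
  set F := ℚ⟮√((2 : ℕ) : ℝ)⟯ ⊔ ℚ⟮√((3 : ℕ) : ℝ)⟯ ⊔ ℚ⟮√((5 : ℕ) : ℝ)⟯ with hF
  have m2 : √2 ∈ F := (le_sup_left.trans le_sup_left : _ ≤ F) (mem_adjoin_simple_self ℚ _)
  have m3 : √3 ∈ F := (le_sup_right.trans le_sup_left : _ ≤ F) (mem_adjoin_simple_self ℚ _)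
  have m5 : √5 ∈ F := (le_sup_right : _ ≤ F) (mem_adjoin_simple_self ℚ _)
  have hle : groundField A ≤ F := by
    refine (hA.groundField_le_adjoin hx hpos).trans (adjoin_le_iff.2 ?_)
    rintro _ ⟨i, hi, j, hj, rfl⟩
    by_cases hij : i = j
    · subst hij
      rw [hA.fundamental.diag]
      exact neg_mem (_root_.natCast_mem F 2)
    · have h := hS i hi j hj hij
      have h0 := hA.fundamental.nonneg i j hij
      rcases hA.fundamental.entry_cases hij (by nlinarith) with h1 | (h1 | h1 | h1) | h1 | h1
      · rw [h1]
        exact zero_mem F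
      · rw [h1]
        exact one_mem F
      · rwa [← h1, Real.sqrt_sq h0] at m2
      · have h5 := Real.sq_sqrt (show (0 : ℝ) ≤ 5 by norm_num)
        have h6 := Real.sqrt_nonneg (5 : ℝ)
        have h7 : A i j = (1 + √5) / 2 := by
          have : (A i j - (1 + √5) / 2) * (A i j - (1 - √5) / 2) = 0 := by nlinarith
          rcases mul_eq_zero.1 this with h8 | h8
          · linarith
          · nlinarith
        rw [h7]
        exact div_mem (add_mem (one_mem F) m5) (_root_.natCast_mem F 2)
      · rwa [← h1, Real.sqrt_sq h0] at m3
      · linarith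
  refine (finrank_le_of_le hle).trans ((finrank_sup_le _ _).trans ?_)
  have := finrank_sup_le ℚ⟮√((2 : ℕ) : ℝ)⟯ ℚ⟮√((3 : ℕ) : ℝ)⟯
  calc _ ≤ (2 * 2) * 2 := Nat.mul_le_mul (this.trans (Nat.mul_le_mul d2 d3)) d5
    _ = 8 := by norm_num

end

/-! ### Leaving a set of vertices inside a component -/

theorem IsFundamental.exists_edge_leaving (hA : IsFundamental A)
    {C : (gramGraph A).ConnectedComponent} {S : Set ι} (hS : S ⊆ C.supp) {a b : ι} (ha : a ∈ S)
    (hb : b ∈ C.supp) (hbS : b ∉ S) :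
    ∃ i ∈ S, ∃ j ∈ C.supp, j ∉ S ∧ A i j ≠ 0 := by
  have hreach : (gramGraph A).Reachable a b := by
    have h1 := hS ha
    rw [SimpleGraph.ConnectedComponent.mem_supp_iff] at h1 hb
    exact SimpleGraph.ConnectedComponent.exact (h1.trans hb.symm)
  obtain ⟨w⟩ := hreach
  obtain ⟨d, -, h1, h2⟩ := w.exists_boundary_dart S ha hbS
  refine ⟨d.fst, h1, d.snd, ?_, h2, ?_⟩
  · have h3 := hS h1
    rw [SimpleGraph.ConnectedComponent.mem_supp_iff] at h3 ⊢
    rw [← h3]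
    exact SimpleGraph.ConnectedComponent.sound d.adj.symm.reachable
  · have := ((SimpleGraph.fromRel_adj _ _ _).1 d.adj).2
    rwa [hA.symm.apply d.fst d.snd, or_self] at this

lemma ncard_pair_le' {α : Type*} (a b : α) : ({a, b} : Set α).ncard ≤ 2 := by
  simpa using Set.ncard_insert_le a {b}

lemma ncard_triple_le {α : Type*} (a b c : α) : ({a, b, c} : Set α).ncard ≤ 3 :=
  (Set.ncard_insert_le a {b, c}).trans (Nat.succ_le_succ (ncard_pair_le' b c))

lemma exists_mem_notMem_of_ncard_lt {α : Type*} [Finite α] {S T : Set α} (h : S.ncard < T.ncard) :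
    ∃ b ∈ T, b ∉ S := by
  by_contra! hh
  exact absurd (Set.ncard_le_ncard hh) (by omega)

/-- An adjacent nonzero entry is at least 1, and 16/5 + 1 > 4. -/
lemma EdgeData.no_triple (hA : IsFundamental A) {p q : ι} (hE : EdgeData A p q)
    {i j k : ι} (hij : i ≠ j) (hjk : j ≠ k) (hik : i ≠ k) (hh : i ≠ p ∧ j ≠ p ∧ k ≠ p ∨ i ≠ q ∧ j ≠ q ∧ k ≠ q)
    (h1 : 16 / 5 < A i j ^ 2) : A j k = 0 := by
  by_contra h
  have h0 : A i j ≠ 0 := by rintro h0; rw [h0] at h1; norm_num at h1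
  have := (hE.triple i j k hij hjk hik hh h0 h).2
  have := hA.one_le hjk h
  nlinarith

/-! ### Components with at least four vertices -/

section

variable [Fintype ι] {p q f g : ι}

/-- The edge pf is so large that p and f have no further neighbour except q. Hence q is joined to p
or f, and also to a fourth vertex, which makes a_fq small if it is nonzero. Now pf acts as the
distinguished edge of a path or triangle with third vertex q. -/
theorem IsVArithmetic.finrank_le_of_large_pendant (hA : IsVArithmetic A) (hE : EdgeData A p q)
    {C : (gramGraph A).ConnectedComponent} (hp : p ∈ C.supp) (hq : q ∈ C.supp)
    (hcard : 4 ≤ C.supp.ncard) (hu : A p q ^ 2 ≤ 16 / 5) (hf : f ∈ C.supp) (hfp : f ≠ p)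
    (hfq : f ≠ q) (hv : 16 / 5 < A p f ^ 2) : Module.finrank ℚ (groundField A) ≤ 25 := by
  have hF := hA.fundamental
  have hs := fun i j => hF.symm.apply i j
  have hv' : 16 / 5 < A f p ^ 2 := by rwa [hs]
  have hn1 : ∀ l, l ≠ p → l ≠ f → l ≠ q → A p l = 0 := fun l h1 h2 h3 =>
    hE.no_triple hF hfp h1.symm h2.symm (Or.inr ⟨hfq, hE.ne, h3⟩) hv'
  have hn2 : ∀ l, l ≠ p → l ≠ f → l ≠ q → A f l = 0 := fun l h1 h2 h3 =>
    hE.no_triple hF hfp.symm h2.symm h1.symm (Or.inr ⟨hE.ne, hfq, h3⟩) hv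
  have hpq0 := hF.nonneg p q hE.ne
  have hv0 := hF.nonneg p f hfp.symm
  have hv2 : A p f < 2 := hE.lt p f hfp.symm (Or.inr ⟨hE.ne, hfq⟩)
  have hv4 : A p f ^ 2 < 4 := by nlinarith
  have hu2 : A p q < 2 := by nlinarith
  have hqf : A p q ≠ 0 ∨ A f q ≠ 0 := by
    obtain ⟨i, hi, j, hj, hj2, hij⟩ := hF.exists_edge_leaving (S := {p, f})
      (by rintro x (rfl | rfl) <;> assumption) (Or.inl rfl) hq
      (by rintro (h | h); exacts [hE.ne h.symm, hfq h.symm])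
    simp only [Set.mem_insert_iff, Set.mem_singleton_iff, not_or] at hi hj2
    by_cases hjq : j = q
    · subst hjq
      rcases hi with rfl | rfl <;> tauto
    · rcases hi with rfl | rfl
      · exact absurd (hn1 j hj2.1 hj2.2 hjq) hij
      · exact absurd (hn2 j hj2.1 hj2.2 hjq) hij
  have hg : ∃ g, g ≠ p ∧ g ≠ f ∧ g ≠ q ∧ A q g ≠ 0 := by
    obtain ⟨b, hb, hb2⟩ := exists_mem_notMem_of_ncard_lt (S := {p, f, q}) (T := C.supp)
      ((ncard_triple_le p f q).trans_lt (by omega))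
    obtain ⟨i, hi, j, hj, hj2, hij⟩ := hF.exists_edge_leaving (S := {p, f, q})
      (by rintro x (rfl | rfl | rfl) <;> assumption) (Or.inl rfl) hb hb2
    simp only [Set.mem_insert_iff, Set.mem_singleton_iff, not_or] at hi hj2
    refine ⟨j, hj2.1, hj2.2.1, hj2.2.2, ?_⟩
    rcases hi with rfl | rfl | rfl
    · exact absurd (hn1 j hj2.1 hj2.2.1 hj2.2.2) hij
    · exact absurd (hn2 j hj2.1 hj2.2.1 hj2.2.2) hij
    · exact hij
  obtain ⟨g, hgp, hgf, hgq, hg⟩ := hg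
  have hb : A f q ≠ 0 → IsSmall (A f q) := fun h => hF.small_of_add_lt hfq hgq.symm h hg
    (hE.triple f q g hfq hgq.symm hgf.symm (Or.inl ⟨hfp, hE.ne.symm, hgp⟩) h hg).2
  by_cases h1 : A f q = 0
  · have h2 : A p q ≠ 0 := by tauto
    by_cases h3 : A p q = 1
    · exact hA.finrank_le_of_path_one h1 hv' (by rwa [hs]) h3
    · exact hA.finrank_le_of_path h1 hv' (by rw [hs]; linarith) h3 hE.ne h2 hu2
  · have hb := hb h1
    have hb2 := hb.lt (hF.nonneg f q hfq)
    by_cases h2 : A p q = 0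
    · by_cases h3 : A f q = 1
      · exact hA.finrank_le_of_path_one h2 hv hv4 h3
      · exact hA.finrank_le_of_path h2 hv (by linarith) h3 hfq h1 (by linarith)
    · rcases hF.entry_cases hE.ne hu2 with h3 | h3 | h3 | h3
      · exact absurd h3 h2
      · exact (hA.finrank_le_of_triangle hfp.symm hE.ne hfq hv (by linarith) h3 hb).trans
          (by norm_num)
      · exact (hA.finrank_le_of_triangle_three hfp.symm hE.ne hfq hv hv2 h3 hb).trans
          (by norm_num)
      · linarith

theorem IsVArithmetic.finrank_le_of_component (hA : IsVArithmetic A) (hE : EdgeData A p q)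
    {C : (gramGraph A).ConnectedComponent} (hp : p ∈ C.supp) (hq : q ∈ C.supp)
    (hcard : 4 ≤ C.supp.ncard) (hu2 : A p q < 14) {x : ι → ℝ} (hx : ∀ i ∉ C.supp, x i = 0)
    (hpos : 0 < x ⬝ᵥ A.mulVec x) : Module.finrank ℚ (groundField A) ≤ 25 := by
  have hF := hA.fundamental
  have hs := fun i j => hF.symm.apply i j
  rcases lt_or_ge (16 / 5) (A p q ^ 2) with hu | hu
  · have hS : ∀ T : Set ι, T.ncard < 4 → T ⊆ C.supp → p ∈ T →
        ∃ i ∈ T, ∃ j ∈ C.supp, j ∉ T ∧ A i j ≠ 0 := fun T hT hTC hpT => by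
      obtain ⟨b, hb, hb2⟩ := exists_mem_notMem_of_ncard_lt (S := T) (T := C.supp) (by omega)
      exact hF.exists_edge_leaving hTC hpT hb hb2
    obtain ⟨i, hi, f, hf, hf2, hif⟩ := hS {p, q}
      ((ncard_pair_le' p q).trans_lt (by omega))
      (by rintro x (rfl | rfl) <;> assumption) (Or.inl rfl)
    obtain ⟨j, hj, g, -, hg2, hjg⟩ := hS {p, q, f}
      ((ncard_triple_le p q f).trans_lt (by omega))
      (by rintro x (rfl | rfl | rfl) <;> assumption) (Or.inl rfl)
    simp only [Set.mem_insert_iff, Set.mem_singleton_iff, not_or] at hi hf2 hj hg2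
    refine hA.finrank_le_of_edge hE hu hu2 hf2.1 hf2.2 hg2.1 hg2.2.1 (Ne.symm hg2.2.2) ?_ ?_
    · rcases hi with rfl | rfl <;> tauto
    · rcases hj with rfl | rfl | rfl <;> tauto
  · by_cases hall : ∀ i ∈ C.supp, ∀ j ∈ C.supp, i ≠ j → A i j ^ 2 ≤ 16 / 5
    · exact (hA.finrank_le_of_small hall hx hpos).trans (by norm_num)
    · push Not at hall
      obtain ⟨i, hi, j, hj, hij, hlt⟩ := hall
      have hu' : A q p ^ 2 ≤ 16 / 5 := by rwa [hs]
      have hlt' : 16 / 5 < A j i ^ 2 := by rwa [hs]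
      by_cases hip : i = p
      · subst hip
        by_cases hjq : j = q
        · subst hjq
          linarith
        · exact hA.finrank_le_of_large_pendant hE hp hq hcard hu hj hij.symm hjq hlt
      by_cases hiq : i = q
      · subst hiq
        by_cases hjp : j = p
        · subst hjp
          linarith
        · exact hA.finrank_le_of_large_pendant hE.swap hq hp hcard hu' hj hij.symm hjp hlt
      by_cases hjp : j = p
      · subst hjp
        exact hA.finrank_le_of_large_pendant hE hp hq hcard hu hi hip hiq hlt'
      by_cases hjq : j = q
      · subst hjq
        exact hA.finrank_le_of_large_pendant hE.swap hq hp hcard hu' hi hiq hip hlt'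
      -- A large edge ij avoiding both p and q cannot occur: by connectedness it has a neighbour l,
      -- and l differs from p or from q, so i, j, l pass through a common vertex.
      obtain ⟨k, hk, l, hl, hl2, hkl⟩ := hF.exists_edge_leaving (S := {i, j})
        (by rintro x (rfl | rfl) <;> assumption) (Or.inl rfl) hp
        (by rintro (h | h); exacts [hip h.symm, hjp h.symm])
      simp only [Set.mem_insert_iff, Set.mem_singleton_iff, not_or] at hk hl2
      have hlpq : l ≠ p ∨ l ≠ q := by
        by_contra! h
        exact hE.ne (h.1.symm.trans h.2)
      have key : ∀ a b, a ≠ b → 16 / 5 < A a b ^ 2 → a ≠ p → a ≠ q → b ≠ p → b ≠ q → l ≠ a →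
          l ≠ b → A b l = 0 := fun a b hab h1 h2 h3 h4 h5 h6 h7 =>
        hE.no_triple hF hab h7.symm h6.symm (by tauto) h1
      rcases hk with rfl | rfl
      · exact absurd (key j k hij.symm hlt' hjp hjq hip hiq hl2.2 hl2.1) hkl
      · exact absurd (key i k hij hlt hip hiq hjp hjq hl2.1 hl2.2) hkl

end

end HypEdge

namespace HypEdge

/-! ### The Lorentz form -/

/-- The Lorentz form as a bilinear form. -/
noncomputable def lorentzForm (n : ℕ) : LinearMap.BilinForm ℝ (Fin (n + 1) → ℝ) :=
  LinearMap.mk₂ ℝ lorentz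
    (fun x y z => by simp only [lorentz, Pi.add_apply, add_mul, Finset.sum_add_distrib]; ring)
    (fun c x y => by
      simp only [lorentz, Pi.smul_apply, smul_eq_mul, mul_assoc, mul_sub, Finset.mul_sum])
    (fun x y z => by simp only [lorentz, Pi.add_apply, mul_add, Finset.sum_add_distrib]; ring)
    (fun c x y => by
      simp only [lorentz, Pi.smul_apply, smul_eq_mul, mul_left_comm _ c, mul_sub, Finset.mul_sum])

@[simp] lemma lorentzForm_apply {n : ℕ} (x y : Fin (n + 1) → ℝ) :
    lorentzForm n x y = lorentz x y := rfl

lemma lorentz_comm {n : ℕ} (x y : Fin (n + 1) → ℝ) : lorentz x y = lorentz y x := by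
  simp only [lorentz, mul_comm]

/-- The orthogonal complement of a timelike vector is negative definite. -/
lemma lorentz_self_neg {n : ℕ} {v w : Fin (n + 1) → ℝ} (hv : v ∈ posCone n)
    (h : lorentz v w = 0) (hw : w ≠ 0) : lorentz w w < 0 := by
  obtain ⟨hv1, hv2⟩ := hv
  simp only [lorentz] at *
  have hcs := Finset.sum_mul_sq_le_sq_mul_sq Finset.univ (fun i : Fin n => v i.succ)
    (fun i => w i.succ)
  set a := ∑ i : Fin n, v i.succ * w i.succ
  simp only [← sq] at *
  set b := ∑ i : Fin n, v i.succ ^ 2 with hb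
  set c := ∑ i : Fin n, w i.succ ^ 2 with hc
  have hb0 : 0 ≤ b := Finset.sum_nonneg fun _ _ => sq_nonneg _
  have hc0 : 0 ≤ c := Finset.sum_nonneg fun _ _ => sq_nonneg _
  have ha : v 0 * w 0 = a := by linarith
  rw [← ha] at hcs
  rcases hc0.eq_or_lt with h0 | h0
  · exfalso
    apply hw
    rw [← h0, mul_zero] at hcs
    have hw0 : v 0 * w 0 = 0 := by nlinarith
    have h1 := (Finset.sum_eq_zero_iff_of_nonneg fun _ _ => sq_nonneg _).1 h0.symm
    ext i
    refine Fin.cases ?_ (fun j => ?_) i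
    · exact (mul_eq_zero.1 hw0).resolve_left hv2.ne'
    · exact pow_eq_zero_iff (two_ne_zero) |>.1 (h1 j (Finset.mem_univ _))
  · have h1 : b * c < v 0 ^ 2 * c := mul_lt_mul_of_pos_right (by linarith) h0
    have h2 : v 0 ^ 2 * w 0 ^ 2 < v 0 ^ 2 * c := by nlinarith
    have := lt_of_mul_lt_mul_left h2 (by positivity)
    linarith

lemma lorentz_self_nonpos {n : ℕ} {v w : Fin (n + 1) → ℝ} (hv : v ∈ posCone n)
    (h : lorentz v w = 0) : lorentz w w ≤ 0 := by
  by_cases hw : w = 0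
  · simp [hw, lorentz]
  · exact (lorentz_self_neg hv h hw).le

variable {ι : Type*} [Fintype ι] {n : ℕ} {e : ι → Fin (n + 1) → ℝ}

lemma lorentz_sum_right (v : Fin (n + 1) → ℝ) (x : ι → ℝ) :
    lorentz v (∑ i, x i • e i) = ∑ i, x i * lorentz v (e i) :=
  (map_sum (lorentzForm n v) _ _).trans
    (Finset.sum_congr rfl fun i _ => (lorentzForm n v).map_smul (x i) (e i))

lemma lorentz_sum_sum (x y : ι → ℝ) :
    lorentz (∑ i, x i • e i) (∑ i, y i • e i) = ∑ i, ∑ j, x i * y j * gramMatrix e i j := by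
  rw [lorentz_sum_right, Finset.sum_comm]
  refine Finset.sum_congr rfl fun j _ => ?_
  rw [lorentz_comm, lorentz_sum_right, Finset.mul_sum]
  refine Finset.sum_congr rfl fun i _ => ?_
  rw [lorentz_comm (e j)]
  change y j * (x i * gramMatrix e i j) = _
  ring

lemma dotProduct_gramMatrix (x : ι → ℝ) :
    x ⬝ᵥ (gramMatrix e).mulVec x = lorentz (∑ i, x i • e i) (∑ i, x i • e i) := by
  rw [lorentz_sum_sum]
  simp only [dotProduct, Matrix.mulVec, Finset.mul_sum]
  refine Finset.sum_congr rfl fun i _ => Finset.sum_congr rfl fun j _ => by ring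

/-! ### Finite edge chambers -/

/-- The faces through a finite vertex that do not contain the edge coincide. -/
lemma eq_of_vertex {v₁ v₂ : Fin (n + 1) → ℝ} (he : IsFundamental (gramMatrix e))
    (h₁ : v₁ ∈ polyhedron e) (h₂ : v₂ ∈ polyhedron e)
    (hedge : ∀ x, (∀ i, lorentz v₁ (e i) = 0 → lorentz v₂ (e i) = 0 → lorentz x (e i) = 0) →
      x ∈ Submodule.span ℝ {v₁, v₂}) {p p' : ι}
    (hp : lorentz v₁ (e p) = 0) (hp2 : lorentz v₂ (e p) ≠ 0)
    (hp' : lorentz v₁ (e p') = 0) (hp2' : lorentz v₂ (e p') ≠ 0) : p = p' := by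
  classical
  by_contra hne
  have hpos : 0 < lorentz v₂ (e p) := lt_of_le_of_ne (h₂.2 p) hp2.symm
  have hpos' : 0 < lorentz v₂ (e p') := lt_of_le_of_ne (h₂.2 p') hp2'.symm
  -- This t makes e_p' - t·e_p orthogonal to v₂ as well as to v₁; since the edge is one-dimensional,
  -- the difference is then a combination of normals of faces containing the edge.
  set t := lorentz v₂ (e p') / lorentz v₂ (e p) with ht
  have ht0 : 0 < t := div_pos hpos' hpos
  let B := lorentzForm n
  let L : ι → (Fin (n + 1) → ℝ) →ₗ[ℝ] ℝ := fun j =>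
    if lorentz v₁ (e j) = 0 ∧ lorentz v₂ (e j) = 0 then B.flip (e j) else 0
  have hK : B.flip (e p' - t • e p) ∈ Submodule.span ℝ (Set.range L) := by
    refine mem_span_of_iInf_ker_le_ker fun x hx => ?_
    simp only [Submodule.mem_iInf, LinearMap.mem_ker] at hx
    have hx2 : x ∈ Submodule.span ℝ {v₁, v₂} := hedge x fun i hi1 hi2 => by
      have := hx i
      simp only [L, if_pos (And.intro hi1 hi2)] at this
      exact this
    obtain ⟨a, b, rfl⟩ := Submodule.mem_span_pair.1 hx2
    have e1 : B v₁ (e p' - t • e p) = 0 := by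
      simp only [B, map_sub, map_smul, lorentzForm_apply, hp, hp', smul_zero, sub_zero]
    have e2 : B v₂ (e p' - t • e p) = 0 := by
      simp only [B, map_sub, map_smul, lorentzForm_apply, smul_eq_mul, ht]
      rw [div_mul_cancel₀ _ hp2, sub_self]
    change B (a • v₁ + b • v₂) (e p' - t • e p) = 0
    rw [map_add, map_smul, map_smul, LinearMap.add_apply,
      LinearMap.smul_apply, LinearMap.smul_apply, e1, e2]
    simp
  obtain ⟨c, hc⟩ := (Submodule.mem_span_range_iff_exists_fun ℝ).1 hK
  let J : ι → Prop := fun j => lorentz v₁ (e j) = 0 ∧ lorentz v₂ (e j) = 0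
  -- Moving negative coefficients across the relation writes one vector as two nonnegative
  -- combinations with disjoint supports.
  let a : ι → ℝ := fun j => if j = p' then 1 else if J j then max (-c j) 0 else 0
  let b : ι → ℝ := fun j => if j = p then t else if J j then max (c j) 0 else 0
  have hJp : ¬ J p := fun h => hp2 h.2
  have hJp' : ¬ J p' := fun h => hp2' h.2
  have ha0 : ∀ j, 0 ≤ a j := fun j => by
    simp only [a]; split_ifs <;> simp
  have hb0 : ∀ j, 0 ≤ b j := fun j => by
    simp only [b]; split_ifs <;> simp [ht0.le]
  have hab : ∀ j, a j * b j = 0 := fun j => by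
    by_cases h1 : j = p'
    · subst h1
      simp [b, Ne.symm hne, hJp']
    · by_cases h2 : j = p
      · subst h2
        simp [a, h1, hJp]
      · simp only [a, b, if_neg h1, if_neg h2]
        split_ifs
        · rcases le_total 0 (c j) with h | h
          · rw [max_eq_right (by linarith), zero_mul]
          · rw [max_eq_right h, mul_zero]
        · simp
  have hdiff : ∀ j, b j - a j = (if j = p then t else 0) - (if j = p' then 1 else 0) +
      (if J j then c j else 0) := fun j => by
    by_cases h1 : j = p'
    · subst h1
      simp [a, b, Ne.symm hne, hJp']
    · by_cases h2 : j = p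
      · subst h2
        simp [a, b, h1, hJp]
      · simp only [a, b, if_neg h1, if_neg h2]
        split_ifs
        · rcases le_total 0 (c j) with h | h
          · rw [max_eq_right (a := -c j) (by linarith), max_eq_left h]; ring
          · rw [max_eq_right h, max_eq_left (a := -c j) (by linarith)]; ring
        · simp
  have hsame : ∀ x, lorentz x (∑ j, a j • e j) = lorentz x (∑ j, b j • e j) := fun x => by
    have h1 := LinearMap.congr_fun hc x
    rw [LinearMap.sum_apply] at h1
    have h2 : ∑ j, (if J j then c j else 0) * lorentz x (e j) =
        lorentz x (e p') - t * lorentz x (e p) := by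
      have h3 : B.flip (e p' - t • e p) x = lorentz x (e p') - t * lorentz x (e p) := by
        simp [B]
      rw [← h3, ← h1]
      refine Finset.sum_congr rfl fun j _ => ?_
      by_cases hj : J j
      · rw [if_pos hj]
        simp only [LinearMap.smul_apply, L]
        rw [if_pos hj]
        rfl
      · rw [if_neg hj]
        simp only [LinearMap.smul_apply, L]
        rw [if_neg hj]
        simp
    rw [lorentz_sum_right, lorentz_sum_right, ← sub_eq_zero, ← neg_eq_zero, neg_sub,
      ← Finset.sum_sub_distrib]
    simp only [← sub_mul, hdiff, add_mul, Finset.sum_add_distrib, h2]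
    simp only [sub_mul, Finset.sum_sub_distrib, ite_mul, zero_mul, one_mul, Finset.sum_ite_eq',
      Finset.mem_univ, if_true]
    ring
  set w := ∑ j, a j • e j with hw
  have hw1 : lorentz v₁ w = 0 := by
    rw [hw, lorentz_sum_right]
    refine Finset.sum_eq_zero fun j _ => ?_
    simp only [a]
    split_ifs with h1 h2
    · rw [h1, hp', mul_zero]
    · rw [h2.1, mul_zero]
    · simp
  have hw2 : lorentz v₂ w = lorentz v₂ (e p') := by
    rw [hw, lorentz_sum_right, Finset.sum_eq_single p']
    · simp [a]
    · intro j _ hj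
      simp only [a, if_neg hj]
      split_ifs with h2
      · rw [h2.2, mul_zero]
      · simp
    · simp
  -- Pairing the two expressions of w involves only off-diagonal Gram entries, which are
  -- nonnegative. But w is orthogonal to the timelike v₁ and nonzero because w · v₂ > 0.
  have hww : 0 ≤ lorentz w w := by
    rw [hsame w, hw, lorentz_sum_sum]
    refine Finset.sum_nonneg fun i _ => Finset.sum_nonneg fun j _ => ?_
    by_cases hij : i = j
    · subst hij
      rw [hab, zero_mul]
    · exact mul_nonneg (mul_nonneg (ha0 i) (hb0 j)) (he.nonneg i j hij)
  by_cases hw0 : w = 0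
  · rw [hw0] at hw2
    simp [lorentz] at hw2
    exact hp2' hw2.symm
  · exact absurd (lorentz_self_neg h₁.1 hw1 hw0) (by linarith)

/-- Non-negative combinations of three vectors orthogonal to faces through a point. -/
lemma combination_neg {ι : Type*} {e : ι → Fin (n + 1) → ℝ} (he : IsFundamentalChamber e)
    {v : Fin (n + 1) → ℝ} (hv : v ∈ posCone n)
    {i j k : ι} (hij : i ≠ j) (hik : i ≠ k)
    (hi : lorentz v (e i) = 0) (hj : lorentz v (e j) = 0) (hk : lorentz v (e k) = 0) {a b c : ℝ}
    (hb : 0 < b) (hc : 0 ≤ c) :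
    a * b * gramMatrix e i j + b * c * gramMatrix e j k + a * c * gramMatrix e i k <
      a ^ 2 + b ^ 2 + c ^ 2 := by
  obtain ⟨x, -, hx1, hx2⟩ := he.facet i
  let B := lorentzForm n
  set w := a • e i + b • e j + c • e k with hw
  have hexp : ∀ y, lorentz y w = a * lorentz y (e i) + b * lorentz y (e j) +
      c * lorentz y (e k) := fun y => by
    rw [← lorentzForm_apply, hw]
    simp only [map_add, map_smul, lorentzForm_apply, smul_eq_mul]
  -- The witness x of the face i annihilates e_i and is positive on the other normals, so x · w > 0
  -- whatever a is.
  have hw0 : w ≠ 0 := by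
    intro h
    have h1 := hexp x
    rw [h, hx1] at h1
    have h2 : lorentz x 0 = 0 := by simp [lorentz]
    have h3 := mul_pos hb (hx2 j hij.symm)
    have h4 := mul_nonneg hc (hx2 k hik.symm).le
    linarith
  have hneg := lorentz_self_neg hv (by rw [hexp, hi, hj, hk]; ring) hw0
  have hd : ∀ l, lorentz (e l) (e l) = -2 := he.fundamental.diag
  have hg : ∀ l m, gramMatrix e l m = lorentz (e l) (e m) := fun _ _ => rfl
  rw [hexp, lorentz_comm w, lorentz_comm w, lorentz_comm w, hexp, hexp, hexp, hd, hd, hd,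
    lorentz_comm (e j) (e i), lorentz_comm (e k) (e i), lorentz_comm (e k) (e j)] at hneg
  rw [hg, hg, hg]
  linarith

lemma lt_two_of_vertex {ι : Type*} {e : ι → Fin (n + 1) → ℝ} (he : IsFundamentalChamber e)
    {v : Fin (n + 1) → ℝ} (hv : v ∈ posCone n)
    {i j : ι} (hij : i ≠ j) (hi : lorentz v (e i) = 0) (hj : lorentz v (e j) = 0) :
    gramMatrix e i j < 2 := by
  have := combination_neg he hv hij hij hi hj hj (a := 1) (b := 1) (c := 0) one_pos le_rfl
  linarith

lemma triple_of_vertex {ι : Type*} {e : ι → Fin (n + 1) → ℝ} (he : IsFundamentalChamber e)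
    {v : Fin (n + 1) → ℝ} (hv : v ∈ posCone n)
    {i j k : ι} (hij : i ≠ j) (hjk : j ≠ k) (hik : i ≠ k) (hi : lorentz v (e i) = 0)
    (hj : lorentz v (e j) = 0) (hk : lorentz v (e k) = 0) (h1 : gramMatrix e i j ≠ 0)
    (h2 : gramMatrix e j k ≠ 0) :
    gramMatrix e i k = 0 ∧ gramMatrix e i j ^ 2 + gramMatrix e j k ^ 2 < 4 := by
  have hF := he.fundamental
  have i1 := hF.one_le hij h1
  have i2 := hF.one_le hjk h2
  have h3 : gramMatrix e i k = 0 := by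
    by_contra h3
    have i3 := hF.one_le hik h3
    have := combination_neg he hv hij hik hi hj hk (a := 1) (b := 1) (c := 1) one_pos zero_le_one
    linarith
  refine ⟨h3, ?_⟩
  -- The coefficients (a_ij, 2, a_jk) maximize the form when the middle coordinate is 2.
  have := combination_neg he hv hij hik hi hj hk (a := gramMatrix e i j) (b := 2)
    (c := gramMatrix e j k) two_pos (by linarith)
  rw [h3] at this
  nlinarith

theorem IsFiniteEdgeChamber.exists_edgeData (h : IsFiniteEdgeChamber e) :
    ∃ p q, EdgeData (gramMatrix e) p q ∧
      ∀ x : ι → ℝ, x p = 0 ∨ x q = 0 → x ⬝ᵥ (gramMatrix e).mulVec x ≤ 0 := by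
  obtain ⟨he, v₁, v₂, ⟨h₁, hv₁⟩, ⟨h₂, hv₂⟩, hne, hedge, hall⟩ := h
  have hF := he.fundamental
  -- If every face through v₁ contained v₂, the vertex condition would make the two vertices equal.
  obtain ⟨p, hp1, hp2⟩ : ∃ p, lorentz v₁ (e p) = 0 ∧ lorentz v₂ (e p) ≠ 0 := by
    by_contra! hh
    exact hne (hv₁ v₂ hh)
  obtain ⟨q, hq2, hq1⟩ : ∃ q, lorentz v₂ (e q) = 0 ∧ lorentz v₁ (e q) ≠ 0 := by
    by_contra! hh
    have h3 := hv₂ v₁ hh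
    obtain ⟨a, ha⟩ := Submodule.mem_span_singleton.1 h3
    have ha0 : a ≠ 0 := by
      rintro rfl
      rw [zero_smul] at ha
      have := h₁.1.2
      rw [← ha] at this
      simp at this
    refine hne (Submodule.mem_span_singleton.2 ⟨a⁻¹, ?_⟩)
    rw [← ha, smul_smul, inv_mul_cancel₀ ha0, one_smul]
  have hI₂ : ∀ i, i ≠ p → lorentz v₂ (e i) = 0 := fun i hi => by
    by_contra h3
    exact hi (eq_of_vertex hF h₁ h₂ hedge ((hall i).resolve_right h3) h3 hp1 hp2)
  have hI₁ : ∀ i, i ≠ q → lorentz v₁ (e i) = 0 := fun i hi => by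
    by_contra h3
    refine hi (eq_of_vertex hF h₂ h₁ (fun x hx => ?_) ((hall i).resolve_left h3) h3 hq2 hq1)
    rw [Set.pair_comm]
    exact hedge x fun j hj1 hj2 => hx j hj2 hj1
  refine ⟨p, q, ⟨?_, ?_, ?_⟩, ?_⟩
  · rintro rfl
    exact hp2 hq2
  · rintro i j hij (⟨h3, h4⟩ | ⟨h3, h4⟩)
    · exact lt_two_of_vertex he h₂.1 hij (hI₂ i h3) (hI₂ j h4)
    · exact lt_two_of_vertex he h₁.1 hij (hI₁ i h3) (hI₁ j h4)
  · rintro i j k hij hjk hik (⟨h3, h4, h5⟩ | ⟨h3, h4, h5⟩) h6 h7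
    · exact triple_of_vertex he h₂.1 hij hjk hik (hI₂ i h3) (hI₂ j h4) (hI₂ k h5) h6 h7
    · exact triple_of_vertex he h₁.1 hij hjk hik (hI₁ i h3) (hI₁ j h4) (hI₁ k h5) h6 h7
  · rintro x (hx | hx) <;> rw [dotProduct_gramMatrix]
    · refine lorentz_self_nonpos h₂.1 ?_
      rw [lorentz_sum_right]
      refine Finset.sum_eq_zero fun i _ => ?_
      by_cases hi : i = p
      · rw [hi, hx, zero_mul]
      · rw [hI₂ i hi, mul_zero]
    · refine lorentz_self_nonpos h₁.1 ?_
      rw [lorentz_sum_right]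
      refine Finset.sum_eq_zero fun i _ => ?_
      by_cases hi : i = q
      · rw [hi, hx, zero_mul]
      · rw [hI₁ i hi, mul_zero]

end HypEdge

namespace HypEdge

/-! ### Hyperbolic components -/

/-- The image of a maximal positive definite subspace is positive definite of the same dimension. -/
lemma sigPos_le_of_injective {V W : Type*} [AddCommGroup V] [Module ℝ V] [Module.Finite ℝ V]
    [AddCommGroup W] [Module ℝ W] [Module.Finite ℝ W] {Q : QuadraticForm ℝ V}
    {Q' : QuadraticForm ℝ W} (φ : V →ₗ[ℝ] W) (hφ : Function.Injective φ)
    (h : ∀ x, Q' (φ x) = Q x) : sigPos Q ≤ sigPos Q' := by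
  obtain ⟨U, hU, hpos⟩ := exists_finrank_eq_sigPos_and_posDef Q
  rw [← hU, LinearEquiv.finrank_eq (Submodule.equivMapOfInjective φ hφ U)]
  refine le_sigPos_of_posDef Q' ?_
  rintro ⟨_, x, hx, rfl⟩ hne
  have hx0 : (⟨x, hx⟩ : U) ≠ 0 := by
    intro h0
    apply hne
    have : x = 0 := congrArg Subtype.val h0
    subst this
    exact Subtype.ext (map_zero φ)
  have := hpos ⟨x, hx⟩ hx0
  simpa [h] using this

lemma one_le_sigPos {V : Type*} [AddCommGroup V] [Module ℝ V] [Module.Finite ℝ V]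
    {Q : QuadraticForm ℝ V} {x : V} (hx : 0 < Q x) : 1 ≤ sigPos Q := by
  have hx0 : x ≠ 0 := by rintro rfl; simp at hx
  rw [← finrank_span_singleton (K := ℝ) hx0]
  refine le_sigPos_of_posDef Q ?_
  rintro ⟨y, hy⟩ hne
  obtain ⟨c, rfl⟩ := Submodule.mem_span_singleton.1 hy
  have hc : c ≠ 0 := by
    rintro rfl
    exact hne (Subtype.ext (zero_smul ℝ x))
  simp only [QuadraticMap.restrict_apply, QuadraticMap.map_smul, smul_eq_mul]
  exact mul_pos (mul_self_pos.2 hc) hx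

lemma exists_pos_of_sigPos {V : Type*} [AddCommGroup V] [Module ℝ V] [Module.Finite ℝ V]
    {Q : QuadraticForm ℝ V} (h : sigPos Q = 1) : ∃ x, 0 < Q x := by
  obtain ⟨U, hU, hpos⟩ := exists_finrank_eq_sigPos_and_posDef Q
  have : Nontrivial U := (Module.finrank_pos_iff (R := ℝ)).1 (by omega)
  obtain ⟨x, hx⟩ := exists_ne (0 : U)
  exact ⟨x, hpos x hx⟩

lemma toQuadraticForm'_apply {ι : Type*} {_ : Fintype ι} {_ : DecidableEq ι} (M : Matrix ι ι ℝ)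
    (x : ι → ℝ) : M.toQuadraticForm' x = x ⬝ᵥ M.mulVec x := by
  simp [Matrix.toQuadraticForm', Matrix.toLinearMap₂'_apply']

variable {ι : Type*} [Fintype ι]

theorem IsHyperbolicMatrix.exists_pos {M : Matrix ι ι ℝ} (h : IsHyperbolicMatrix M) :
    ∃ x, 0 < x ⬝ᵥ M.mulVec x := by
  classical
  obtain ⟨x, hx⟩ := exists_pos_of_sigPos h
  exact ⟨x, by rwa [toQuadraticForm'_apply] at hx⟩

open Classical in
lemma dotProduct_extend (M : Matrix ι ι ℝ) (S : Set ι) (y : S → ℝ) :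
    Function.ExtendByZero.linearMap ℝ (Subtype.val : S → ι) y ⬝ᵥ
      M.mulVec (Function.ExtendByZero.linearMap ℝ (Subtype.val : S → ι) y) =
      y ⬝ᵥ (M.submatrix (Subtype.val : S → ι) Subtype.val).mulVec y := by
  have hval : ∀ i : S, Function.ExtendByZero.linearMap ℝ (Subtype.val : S → ι) y i = y i :=
    fun i => Subtype.val_injective.extend_apply _ _ i
  have hzero : ∀ i ∉ Set.range (Subtype.val : S → ι),
      Function.ExtendByZero.linearMap ℝ (Subtype.val : S → ι) y i = 0 :=
    fun i hi => Function.extend_apply' _ _ _ hi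
  symm
  refine Fintype.sum_of_injective _ Subtype.val_injective _ _ (fun i hi => by simp [hzero i hi])
    fun i => ?_
  rw [hval]
  congr 1
  refine Fintype.sum_of_injective _ Subtype.val_injective _ _ (fun j hj => by simp [hzero j hj])
    fun j => ?_
  rw [hval]
  rfl

theorem IsHyperbolicComponent.exists_pos {A : Matrix ι ι ℝ}
    {C : (gramGraph A).ConnectedComponent} (h : IsHyperbolicComponent A C) :
    ∃ x : ι → ℝ, (∀ i ∉ C.supp, x i = 0) ∧ 0 < x ⬝ᵥ A.mulVec x := by
  classical
  obtain ⟨y, hy⟩ := IsHyperbolicMatrix.exists_pos h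
  refine ⟨Function.ExtendByZero.linearMap ℝ (Subtype.val : C.supp → ι) y, fun i hi => ?_, ?_⟩
  · exact Function.extend_apply' _ _ _ (by rwa [← Set.mem_range, Subtype.range_val])
  · rw [dotProduct_extend]
    convert hy

theorem IsHyperbolicMatrix.isHyperbolicComponent {A : Matrix ι ι ℝ} (hA : IsHyperbolicMatrix A)
    {C : (gramGraph A).ConnectedComponent} {x : ι → ℝ} (hx : ∀ i ∉ C.supp, x i = 0)
    (hpos : 0 < x ⬝ᵥ A.mulVec x) : IsHyperbolicComponent A C := by
  classical
  refine le_antisymm ?_ ?_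
  · rw [← hA]
    refine sigPos_le_of_injective (Function.ExtendByZero.linearMap ℝ (Subtype.val : C.supp → ι))
      (Function.extend_injective Subtype.val_injective _) fun y => ?_
    rw [toQuadraticForm'_apply, toQuadraticForm'_apply]
    convert dotProduct_extend A C.supp y
  · refine one_le_sigPos (x := fun i : C.supp => x i) ?_
    rw [toQuadraticForm'_apply]
    have : Function.ExtendByZero.linearMap ℝ (Subtype.val : C.supp → ι) (fun i => x i) = x := by
      ext i
      by_cases hi : i ∈ C.supp
      · exact Subtype.val_injective.extend_apply (fun i : C.supp => x i) 0 ⟨i, hi⟩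
      · rw [hx i hi]
        exact Function.extend_apply' (f := (Subtype.val : C.supp → ι)) (fun i : C.supp => x i)
          (0 : ι → ℝ) i (by rwa [← Set.mem_range, Subtype.range_val])
    have h2 := dotProduct_extend A C.supp (fun i => x i)
    rw [this] at h2
    rw [h2] at hpos
    convert hpos

end HypEdge

namespace HypEdge

/-! ### The main results -/

lemma dotProduct_mulVec_add_of_component {ι : Type*} [Fintype ι] {A : Matrix ι ι ℝ}
    (hA : IsFundamental A) (C : (gramGraph A).ConnectedComponent) {x y : ι → ℝ}
    (hx : ∀ i ∉ C.supp, x i = 0) (hy : ∀ i ∈ C.supp, y i = 0) :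
    (x + y) ⬝ᵥ A.mulVec (x + y) = x ⬝ᵥ A.mulVec x + y ⬝ᵥ A.mulVec y := by
  have hzero : ∀ i ∈ C.supp, ∀ j ∉ C.supp, A i j = 0 := fun i hi j hj => by
    by_contra h
    have hij : i ≠ j := fun h => hj (h ▸ hi)
    have hadj : (gramGraph A).Adj i j := (SimpleGraph.fromRel_adj _ _ _).2 ⟨hij, Or.inl h⟩
    rw [SimpleGraph.ConnectedComponent.mem_supp_iff] at hi hj
    exact hj (hi ▸ SimpleGraph.ConnectedComponent.sound hadj.symm.reachable)
  have hcross : ∀ i j, x i * (A i j * y j) = 0 := fun i j => by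
    by_cases hi : i ∈ C.supp
    · by_cases hj : j ∈ C.supp
      · simp [hy j hj]
      · simp [hzero i hi j hj]
    · simp [hx i hi]
  have h1 : x ⬝ᵥ A.mulVec y = 0 := by
    simp only [dotProduct, Matrix.mulVec, Finset.mul_sum, hcross, Finset.sum_const_zero]
  have h2 : y ⬝ᵥ A.mulVec x = 0 := by
    rw [Matrix.dotProduct_mulVec, ← Matrix.mulVec_transpose, hA.symm.eq, dotProduct_comm, h1]
  rw [Matrix.mulVec_add, dotProduct_add, add_dotProduct, add_dotProduct, h1, h2]
  ring

theorem isTransitionBound : IsTransitionBound 14 25 := by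
  intro n ι _ e he hA hmin
  obtain ⟨p, q, hE, hneg⟩ := he.exists_edgeData
  refine ⟨hA.finiteDimensional_groundField, fun hlt => ?_⟩
  set A := gramMatrix e
  set C := (gramGraph A).connectedComponentMk p with hC
  have hp : p ∈ C.supp := rfl
  have hmem : ∀ D : (gramGraph A).ConnectedComponent, ∀ x : ι → ℝ, (∀ i ∉ D.supp, x i = 0) →
      0 < x ⬝ᵥ A.mulVec x → p ∈ D.supp ∧ q ∈ D.supp := by
    intro D x hx hpos
    constructor
    · by_contra h
      exact absurd (hneg x (Or.inl (hx p h))) (by linarith)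
    · by_contra h
      exact absurd (hneg x (Or.inr (hx q h))) (by linarith)
  obtain ⟨x, hx⟩ := hA.hyperbolic.exists_pos
  classical
  set y : ι → ℝ := fun i => if i ∈ C.supp then x i else 0 with hy
  set z : ι → ℝ := fun i => if i ∈ C.supp then 0 else x i with hz
  have hy0 : ∀ i ∉ C.supp, y i = 0 := fun i hi => if_neg hi
  have hz0 : ∀ i ∈ C.supp, z i = 0 := fun i hi => if_pos hi
  have hxyz : x = y + z := by
    ext i
    simp only [Pi.add_apply, hy, hz]
    split_ifs <;> simp
  have hypos : 0 < y ⬝ᵥ A.mulVec y := by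
    -- The part z outside the component of p vanishes at p and so contributes nothing positive.
    have h1 := hneg z (Or.inl (hz0 p hp))
    rw [hxyz, dotProduct_mulVec_add_of_component hA.fundamental C hy0 hz0] at hx
    linarith
  have hq := (hmem C y hy0 hypos).2
  refine ⟨C, hA.hyperbolic.isHyperbolicComponent hy0 hypos, fun D hD => ?_, ?_⟩
  · obtain ⟨w, hw0, hw⟩ := hD.exists_pos
    exact ((SimpleGraph.ConnectedComponent.mem_supp_iff _ _).1 (hmem D w hw0 hw).1).symm
  · by_contra! hcard
    exact absurd (hA.finrank_le_of_component hE hp hq hcard (hmin p q) hy0 hypos) (by omega)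

/-! ### Four-vertex graphs -/

lemma exists_edgeData_zero_one {A : Matrix (Fin 4) (Fin 4) ℝ} (hA : IsFiniteEdgeMatrix A)
    (h : 2 < A 0 1) : EdgeData A 0 1 := by
  obtain ⟨n, e, he, rfl⟩ := hA
  obtain ⟨p, q, hE, -⟩ := he.exists_edgeData
  -- Two faces through a common vertex have entry below 2, so the broken edge must join p and q.
  have h1 : ¬ (((0 : Fin 4) ≠ p ∧ 1 ≠ p) ∨ ((0 : Fin 4) ≠ q ∧ 1 ≠ q)) := fun h2 =>
    absurd (hE.lt 0 1 (by decide) h2) (by linarith)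
  have hne := hE.ne
  have : p = 0 ∧ q = 1 ∨ p = 1 ∧ q = 0 := by
    revert h1 hne
    clear hE
    revert p q
    decide
  rcases this with ⟨rfl, rfl⟩ | ⟨rfl, rfl⟩
  · exact hE
  · exact hE.swap

lemma thin_ne_zero {m : ℕ} (hm : 3 ≤ m) : thin m ≠ 0 := by
  have := thin_mono (by norm_num) hm
  rw [thin_three] at this
  linarith

variable {A : Matrix (Fin 4) (Fin 4) ℝ}

lemma IsVArithmetic.finrank_le_of_four (hA : IsVArithmetic A) (hE : IsFiniteEdgeMatrix A)
    (hu : 2 < A 0 1) (hu2 : A 0 1 < 14) :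
    (A 0 2 ≠ 0 → A 1 2 ≠ 0 → (A 2 3 ≠ 0 ∨ A 0 3 ≠ 0 ∧ A 1 3 ≠ 0) →
      Module.finrank ℚ (groundField A) ≤ 23) ∧
    ((A 0 2 ≠ 0 ∨ A 1 2 ≠ 0) → (A 0 3 ≠ 0 ∨ A 1 3 ≠ 0 ∨ A 2 3 ≠ 0) →
      Module.finrank ℚ (groundField A) ≤ 25) ∧
    ((A 0 3 ≠ 0 ∨ A 1 3 ≠ 0) → A 3 2 ≠ 0 → Module.finrank ℚ (groundField A) ≤ 25) := by
  have hD := exists_edgeData_zero_one hE hu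
  have h1 : 16 / 5 < A 0 1 ^ 2 := by nlinarith
  exact ⟨hA.finrank_le_of_edge_triangle hD h1 hu2 (by decide) (by decide) (by decide) (by decide)
      (by decide),
    hA.finrank_le_of_edge hD h1 hu2 (by decide) (by decide) (by decide) (by decide) (by decide),
    fun h2 h3 => hA.finrank_le_of_edge hD h1 hu2 (by decide) (by decide) (by decide) (by decide)
      (by decide) h2 (Or.inr (Or.inr h3))⟩

end HypEdge

theorem mainTheorem1 :
    (∀ K ∈ HypEdge.groundFields HypEdge.Gamma1 14,
      FiniteDimensional ℚ K ∧ Module.finrank ℚ K ≤ 23) ∧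
    (∀ K ∈ HypEdge.groundFields HypEdge.Gamma2 14,
      FiniteDimensional ℚ K ∧ Module.finrank ℚ K ≤ 23) ∧
    (∀ K ∈ HypEdge.groundFields HypEdge.Gamma3 14,
      FiniteDimensional ℚ K ∧ Module.finrank ℚ K ≤ 25) ∧
    (∀ K ∈ HypEdge.groundFields HypEdge.Gamma4 14,
      FiniteDimensional ℚ K ∧ Module.finrank ℚ K ≤ 25) ∧
    (∀ K ∈ HypEdge.groundFields HypEdge.Gamma5 14,
      FiniteDimensional ℚ K ∧ Module.finrank ℚ K ≤ 25) ∧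
    HypEdge.IsTransitionBound 14 25 := by
  refine ⟨?_, ?_, ?_, ?_, ?_, HypEdge.isTransitionBound⟩
  · rintro _ ⟨u, A, hu, hu2, ⟨s, k, r, p, hs, hk, hr, hp, hA⟩, hE, hV, rfl⟩
    have h01 : A 0 1 = u := by rw [hA]; rfl
    have h02 : A 0 2 = HypEdge.thin s := by rw [hA]; rfl
    have h12 : A 1 2 = HypEdge.thin k := by rw [hA]; rfl
    have h03 : A 0 3 = HypEdge.thin r := by rw [hA]; rfl
    have h13 : A 1 3 = HypEdge.thin p := by rw [hA]; rfl
    refine ⟨hV.finiteDimensional_groundField,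
      (hV.finrank_le_of_four hE (by rwa [h01]) (by rwa [h01])).1 ?_ ?_ (Or.inr ⟨?_, ?_⟩)⟩
    · rw [h02]; exact HypEdge.thin_ne_zero hs
    · rw [h12]; exact HypEdge.thin_ne_zero hk
    · rw [h03]; exact HypEdge.thin_ne_zero hr
    · rw [h13]; exact HypEdge.thin_ne_zero hp
  · rintro _ ⟨u, A, hu, hu2, ⟨s, k, p, hs, hk, hp, hA⟩, hE, hV, rfl⟩
    have h01 : A 0 1 = u := by rw [hA]; rfl
    have h02 : A 0 2 = HypEdge.thin s := by rw [hA]; rfl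
    have h12 : A 1 2 = HypEdge.thin k := by rw [hA]; rfl
    have h23 : A 2 3 = HypEdge.thin p := by rw [hA]; rfl
    refine ⟨hV.finiteDimensional_groundField,
      (hV.finrank_le_of_four hE (by rwa [h01]) (by rwa [h01])).1 ?_ ?_ (Or.inl ?_)⟩
    · rw [h02]; exact HypEdge.thin_ne_zero hs
    · rw [h12]; exact HypEdge.thin_ne_zero hk
    · rw [h23]; exact HypEdge.thin_ne_zero hp
  · rintro _ ⟨u, A, hu, hu2, ⟨s, k, r, -, hk, hr, hA⟩, hE, hV, rfl⟩
    have h01 : A 0 1 = u := by rw [hA]; rfl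
    have h13 : A 1 3 = HypEdge.thin k := by rw [hA]; rfl
    have h32 : A 3 2 = HypEdge.thin r := by rw [hA]; rfl
    -- The weight s may be 2, so the walk starts at g, which is joined to e₂, and then reaches f.
    refine ⟨hV.finiteDimensional_groundField,
      (hV.finrank_le_of_four hE (by rwa [h01]) (by rwa [h01])).2.2 (Or.inr ?_) ?_⟩
    · rw [h13]; exact HypEdge.thin_ne_zero hk
    · rw [h32]; exact HypEdge.thin_ne_zero hr
  · rintro _ ⟨u, A, hu, hu2, ⟨s, k, r, hs, -, hr, hA⟩, hE, hV, rfl⟩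
    have h01 : A 0 1 = u := by rw [hA]; rfl
    have h02 : A 0 2 = HypEdge.thin s := by rw [hA]; rfl
    have h03 : A 0 3 = HypEdge.thin r := by rw [hA]; rfl
    refine ⟨hV.finiteDimensional_groundField,
      (hV.finrank_le_of_four hE (by rwa [h01]) (by rwa [h01])).2.1 (Or.inl ?_) (Or.inl ?_)⟩
    · rw [h02]; exact HypEdge.thin_ne_zero hs
    · rw [h03]; exact HypEdge.thin_ne_zero hr
  · rintro _ ⟨u, A, hu, hu2, ⟨s, k, hs, hk, hA⟩, hE, hV, rfl⟩
    have h01 : A 0 1 = u := by rw [hA]; rfl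
    have h02 : A 0 2 = HypEdge.thin s := by rw [hA]; rfl
    have h13 : A 1 3 = HypEdge.thin k := by rw [hA]; rfl
    refine ⟨hV.finiteDimensional_groundField,
      (hV.finrank_le_of_four hE (by rwa [h01]) (by rwa [h01])).2.1 (Or.inl ?_)
        (Or.inr (Or.inl ?_))⟩
    · rw [h02]; exact HypEdge.thin_ne_zero hs
    · rw [h13]; exact HypEdge.thin_ne_zero hk
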